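/- **Notation.** Labels $1,\dots,5$ stand for the bases x, y, z, x+y, x−y, and $\sigma_1=\sigma_x$, $\sigma_2=\sigma_y$, $\sigma_3=\sigma_z$, $\sigma_4=(\sigma_x+\sigma_y)/\sqrt2$, $\sigma_5=(\sigma_x-\sigma_y)/\sqrt2$, $|\Phi^+\rangle=(|00\rangle+|11\rangle)/\sqrt2$. For vectors, $u\approx_\delta v$ means $\|u-v\|\le\delta$. An operator on one tensor factor is extended by the identity to the others. For a string $x=(x_1,\dots,x_n)$, $\boldsymbol x_j$ is $x$ with its $j$th entry removed. $[P]$ is 1 if $P$ holds and 0 otherwise. **Setting.** Let $n\ge1$, let $\mathcal S\subset\{1,\dots,5\}^n$ be a set of special questions, and let $\mathcal X$ be the set of all strings that differ from some $\chi\in\mathcal S$ in at most two positions. For $1\le j\le n$ let $\mathcal R^{(j)}$ be the set of strings $r$ indexed by the positions $\ne j$ that differ from $\boldsymbol\chi_j$ in at most one position, for some $\chi\in\mathcal S$. A strategy consists of complex Hilbert spaces $\mathcal A,\mathcal B$, a unit vector $|\psi\rangle\in\mathcal A\otimes\mathcal B$, projective measurements of Alice on $\mathcal A$ with outcomes in $\{+1,-1\}^n$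 for each $x\in\mathcal X$, and projective measurements of Bob on $\mathcal B$ for each question $y\in\{1,\dots,6\}$ with outcomes in $\{+1,-1\}^n$, for $y=\lozenge$ with outcomes in $\{1,2,3,4\}^{\lfloor n/2\rfloor}$, and for $y=\blacklozenge$ with outcomes in $\{1,2,3,4\}^{\lceil n/2\rceil-1}$. Let $A_x^{(j)}$ (resp. $B_y^{(j)}$, $y\le 6$) be the $\pm1$-valued observable for the $j$th entry of the outcome, and write $D_{zx}^{(j)},E_{zx}^{(j)},D_{zy}^{(j)},E_{zy}^{(j)},D_{xy}^{(j)},E_{xy}^{(j)}$ for $B_1^{(j)},\dots,B_6^{(j)}$. Write $A_{q,r}^{(j)}=A_x^{(j)}$ for the question $x$ with $x_j=q$ and $\boldsymbol x_j=r$. For $1\le j<n$ and $b\in\{1,2,3,4\}$ let $\Gamma_b^{(j)}$ be the projection for the outcome $b$ at position $\lceil j/2\rceil$ of the answer to $\lozenge$ if $j$ is odd, and to $\blacklozenge$ if $j$ is even. The *requested Bell values and correlations are attained within tolerance $\varepsilon\ge0$* if: 1. for all $j$ and all $r\in\mathcal R^{(j)}$, $\langle\psi|C_r^{(j)}|\psi\rangle\ge6\sqrt2-\varepsilon/\sqrt2$,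 where $$\begin{aligned}C_r^{(j)}={}&A_{3,r}^{(j)}\otimes(D_{zx}^{(j)}+E_{zx}^{(j)})+A_{1,r}^{(j)}\otimes(D_{zx}^{(j)}-E_{zx}^{(j)})+A_{3,r}^{(j)}\otimes(D_{zy}^{(j)}+E_{zy}^{(j)})\\&+A_{2,r}^{(j)}\otimes(D_{zy}^{(j)}-E_{zy}^{(j)})+A_{1,r}^{(j)}\otimes(D_{xy}^{(j)}+E_{xy}^{(j)})+A_{2,r}^{(j)}\otimes(D_{xy}^{(j)}-E_{xy}^{(j)});\end{aligned}$$ 2. for all $\chi\in\mathcal S$ and all $j$, $\langle\psi|A_{4,\boldsymbol\chi_j}^{(j)}\otimes D_{xy}^{(j)}|\psi\rangle\ge1-\varepsilon$ and $\langle\psi|A_{5,\boldsymbol\chi_j}^{(j)}\otimes E_{xy}^{(j)}|\psi\rangle\ge1-\varepsilon$; 3. for some fixed $\chi\in\mathcal S$, for all $1\le j<n$ and $q\in\{1,2,3\}$, with $w=(\chi_1,\dots,\chi_{j-1},q,q,\chi_{j+2},\dots,\chi_n)$, $$\langle\psi|A_w^{(j)}A_w^{(j+1)}\otimes\big[(-1)^{[q=2]}\Gamma_1^{(j)}+(-1)^{[q=1]}\Gamma_2^{(j)}+(-1)^{[q=3]}\Gamma_3^{(j)}-\Gamma_4^{(j)}\big]|\psi\rangle\ge1-\tfrac{\varepsilon}{2}.$$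 **Theorem.** There is a function $\delta:\mathbb R_{\ge0}\times\mathbb N_{\ge1}\to\mathbb R_{\ge0}$ with $\delta(0,n)=0$ for all $n$ such that the following holds for all $n$, $\mathcal S$, all strategies and all $\varepsilon\ge0$. If the requested Bell values and correlations are attained within tolerance $\varepsilon$, then there exist $|\xi_0\rangle,|\xi_1\rangle\in\mathcal A\otimes\mathcal B$ with $\langle\xi_0|\xi_0\rangle+\langle\xi_1|\xi_1\rangle=1$, an isometry $V_{\mathcal B}:\mathcal B\to\mathcal B\otimes\mathcal B'\otimes\mathcal B''$, and isometries $V_{\mathcal A}^{\chi}:\mathcal A\to\mathcal A\otimes\mathcal A'\otimes\mathcal A''$ for all $\chi\in\mathcal S$, where $\mathcal A',\mathcal A'',\mathcal B',\mathcal B''$ are $n$-qubit registers with $|0\rangle=|0\dots0\rangle$ and $|1\rangle=|1\dots1\rangle$ in $\mathcal A''$ and $\mathcal B''$, such that for all $\chi\in\mathcal S$, $k\in\{1,\dots,n\}$ and $q\in\{1,\dots,5\}$, with $V^\chi=V_{\mathcal A}^\chi\otimes V_{\mathcal B}$ and $$|\xi\rangle=|0\rangle_{\mathcal A''}|0\rangle_{\mathcal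 B''}\otimes|\xi_0\rangle+|1\rangle_{\mathcal A''}|1\rangle_{\mathcal B''}\otimes|\xi_1\rangle,$$ we have $$V^\chi|\psi\rangle\approx_{\delta(\varepsilon,n)}\bigotimes_{j=1}^n|\Phi^+\rangle_{\mathcal A_j'\mathcal B_j'}\otimes|\xi\rangle,$$ $$V^\chi A_{q,\boldsymbol\chi_k}^{(k)}|\psi\rangle\approx_{\delta(\varepsilon,n)}\sigma_q^{\mathcal B_k'}\bigotimes_{j=1}^n|\Phi^+\rangle_{\mathcal A_j'\mathcal B_j'}\otimes Z_q|\xi\rangle,$$ where $Z_q=I$ for $q\ne3$ and $Z_3$ is $\sigma_z=|0\rangle\langle0|-|1\rangle\langle1|$ on the span of $|0\rangle,|1\rangle$ in $\mathcal B''$. -/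

import Mathlib

open scoped NNReal TensorProduct

noncomputable section

namespace SelfTest

/-! ### Hilbert tensor products -/

/-- The Hilbert space tensor product: the completion of the algebraic tensor product for its
canonical inner product. -/
abbrev HilbertTensor (H K : Type*) [NormedAddCommGroup H] [InnerProductSpace ℂ H]
    [NormedAddCommGroup K] [InnerProductSpace ℂ K] : Type _ :=
  UniformSpace.Completion (H ⊗[ℂ] K)

section Tensor

variable {H H' K K' X Y : Type*}
  [NormedAddCommGroup H] [InnerProductSpace ℂ H] [NormedAddCommGroup H'] [InnerProductSpace ℂ H']
  [NormedAddCommGroup K] [InnerProductSpace ℂ K] [NormedAddCommGroup K'] [InnerProductSpace ℂ K']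
  [NormedAddCommGroup X] [InnerProductSpace ℂ X] [NormedAddCommGroup Y] [InnerProductSpace ℂ Y]

/-- The bounded operator `S ⊗ T` between Hilbert tensor products. -/
def opTensor (S : H →L[ℂ] H') (T : K →L[ℂ] K') : HilbertTensor H K →L[ℂ] HilbertTensor H' K' :=
  (TensorProduct.mapL S T).completion

/-- An operator of Alice, extended by the identity on Bob's space. -/
def onAlice (S : H →L[ℂ] H') : HilbertTensor H K →L[ℂ] HilbertTensor H' K :=
  opTensor S (ContinuousLinearMap.id ℂ K)

/-- An operator of Bob, extended by the identity on Alice's space. -/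
def onBob (T : K →L[ℂ] K') : HilbertTensor H K →L[ℂ] HilbertTensor H K' :=
  opTensor (ContinuousLinearMap.id ℂ H) T

/-- Appending the local ancilla states `u` (on Alice's side) and `w` (on Bob's side) to a vector
of `H ⊗ K`, giving a vector of `(H ⊗ X) ⊗ (K ⊗ Y)`. -/
def attach (u : X) (w : Y) : HilbertTensor H K →L[ℂ] HilbertTensor (H ⊗[ℂ] X) (K ⊗[ℂ] Y) :=
  opTensor ((TensorProduct.mkL ℂ H X).flip u) ((TensorProduct.mkL ℂ K Y).flip w)

/-- A projective measurement with (finite) outcome set `α`. -/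
structure IsProjectiveMeasurement {α : Type*} [Fintype α] [CompleteSpace H]
    (P : α → H →L[ℂ] H) : Prop where
  isProj : ∀ a, IsStarProjection (P a)
  orthogonal : ∀ a b, a ≠ b → P a * P b = 0
  complete : ∑ a, P a = 1

end Tensor

/-! ### Qubit registers and reference objects -/

/-- A register of `n` qubits, with orthonormal computational basis indexed by `{0,1}ⁿ`. -/
abbrev Qubits (n : ℕ) : Type := EuclideanSpace ℂ (Fin n → Fin 2)

/-- The computational basis vector `|s⟩`. -/
def ket {n : ℕ} (s : Fin n → Fin 2) : Qubits n := EuclideanSpace.single s 1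

/-- `|0⟩ = |0…0⟩` for `c = 0` and `|1⟩ = |1…1⟩` for `c = 1`. -/
def ketRep (n : ℕ) (c : Fin 2) : Qubits n := ket fun _ => c

/-- The input labels `1, …, 5` (bases x, y, z, x+y, x-y) are represented by `0, …, 4 : Fin 5`;
this is `σ₁ = σ_x`, `σ₂ = σ_y`, `σ₃ = σ_z`, `σ₄ = (σ_x + σ_y)/√2`, `σ₅ = (σ_x - σ_y)/√2`. -/
def pauli (q : Fin 5) : Matrix (Fin 2) (Fin 2) ℂ :=
  let sx : Matrix (Fin 2) (Fin 2) ℂ := !![0, 1; 1, 0]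
  let sy : Matrix (Fin 2) (Fin 2) ℂ := !![0, -Complex.I; Complex.I, 0]
  let sz : Matrix (Fin 2) (Fin 2) ℂ := !![1, 0; 0, -1]
  ![sx, sy, sz, ((1 / √2 : ℝ) : ℂ) • (sx + sy), ((1 / √2 : ℝ) : ℂ) • (sx - sy)] q

/-- The single-qubit operator with matrix `M`, acting on qubit `k` of an `n`-qubit register. -/
def onQubit {n : ℕ} (k : Fin n) (M : Matrix (Fin 2) (Fin 2) ℂ) : Qubits n →L[ℂ] Qubits n :=
  Matrix.toEuclideanCLM (𝕜 := ℂ)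
    (Matrix.of fun s t : Fin n → Fin 2 => if ∀ i, i ≠ k → s i = t i then M (s k) (t k) else 0)

/-- `σ_z` of the qubit spanned by `|0⟩ = |0…0⟩` and `|1⟩ = |1…1⟩`. -/
def kickbackZ (n : ℕ) : Qubits n →L[ℂ] Qubits n :=
  InnerProductSpace.rankOne ℂ (ketRep n 0) (ketRep n 0) -
    InnerProductSpace.rankOne ℂ (ketRep n 1) (ketRep n 1)

/-- The coefficients `⟨a b|Φ⁺⟩` of the Bell state `|Φ⁺⟩ = (|00⟩ + |11⟩)/√2`. -/
def bellCoeff (a b : Fin 2) : ℂ := if a = b then ((1 / √2 : ℝ) : ℂ) else 0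

section Reference

variable {A B : Type*} [NormedAddCommGroup A] [InnerProductSpace ℂ A]
  [NormedAddCommGroup B] [InnerProductSpace ℂ B]

/-- `(⨂ⱼ |Φ⁺⟩_{A'ⱼ B'ⱼ}) ⊗ v`, where `A'` and `B'` are `n`-qubit registers appended to
the local spaces of the vector `v`. -/
def bellTensor (n : ℕ) (v : HilbertTensor A B) :
    HilbertTensor (A ⊗[ℂ] Qubits n) (B ⊗[ℂ] Qubits n) :=
  ∑ s : Fin n → Fin 2, ∑ t : Fin n → Fin 2, (∏ j, bellCoeff (s j) (t j)) • attach (ket s) (ket t) v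

/-- The junk state `|0⟩_{A''} |0⟩_{B''} ⊗ ξ₀ + |1⟩_{A''} |1⟩_{B''} ⊗ ξ₁`. -/
def junk (n : ℕ) (ξ₀ ξ₁ : HilbertTensor A B) :
    HilbertTensor (A ⊗[ℂ] Qubits n) (B ⊗[ℂ] Qubits n) :=
  attach (ketRep n 0) (ketRep n 0) ξ₀ + attach (ketRep n 1) (ketRep n 1) ξ₁

end Reference

/-- The local output space, with tensor factors in the order `H`, `H''`, `H'` (original space,
junk ancilla register, register holding the halves of the Bell states). -/
abbrev LocalOut (H : Type*) [NormedAddCommGroup H] [InnerProductSpace ℂ H] (n : ℕ) : Type _ :=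
  (H ⊗[ℂ] Qubits n) ⊗[ℂ] Qubits n

/-! ### Alice's questions -/

/-- Strings in `{1, …, 5}ⁿ`, with componentwise addition modulo `5`. -/
abbrev Question (n : ℕ) : Type := Fin n → Fin 5

/-- The expanded question set: all `χ + k eᵢ + l eⱼ` with `χ ∈ S`. (Allowing `i = j` changes
nothing for `n ≥ 2`, and gives all of `{1, …, 5}` for `n = 1`.) -/
def questionSet {n : ℕ} (S : Set (Question n)) : Set (Question n) :=
  {x | ∃ χ ∈ S, ∃ (i j : Fin n) (k l : Fin 5), x = χ + Pi.single i k + Pi.single j l}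

/-- The string `x` with its `j`th element removed. -/
def removeAt {n : ℕ} (j : Fin n) (x : Question n) : {i : Fin n // i ≠ j} → Fin 5 := fun i => x i

/-- The string with `q` at position `j` and `r` at the other positions. -/
def insertAt {n : ℕ} (j : Fin n) (q : Fin 5) (r : {i : Fin n // i ≠ j} → Fin 5) : Question n :=
  fun i => if h : i = j then q else r ⟨i, h⟩

/-- The set `R⁽ʲ⁾` of questions at the positions other than `j`: the strings `χⱼ` (the string `χ`
with its `j`th element removed) for `χ ∈ S`, and those that differ from one of them in a single
entry. (The strings `χⱼ` are listed separately for the sake of `n = 1`.) -/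
def remainingSet {n : ℕ} (S : Set (Question n)) (j : Fin n) :
    Set ({i : Fin n // i ≠ j} → Fin 5) :=
  {r | ∃ χ ∈ S, r = removeAt j χ ∨ ∃ i k, r = removeAt j χ + Pi.single i k}

/-! ### Physical strategies -/

/-- A physical strategy: a state `ψ` of `A ⊗ B`, projective measurements of Alice for all questions
in the expanded question set (with answers in `{+1,-1}ⁿ`), and projective measurements of
Bob for the questions `1, …, 6` (with answers in `{+1,-1}ⁿ`), `◇` (with answers in
`{1,2,3,4}^⌊n/2⌋`) and `◆` (with answers in `{1,2,3,4}^(⌈n/2⌉-1)`). -/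
structure Strategy (n : ℕ) (S : Set (Question n)) (A B : Type*)
    [NormedAddCommGroup A] [InnerProductSpace ℂ A] [CompleteSpace A]
    [NormedAddCommGroup B] [InnerProductSpace ℂ B] [CompleteSpace B] where
  ψ : HilbertTensor A B
  norm_ψ : ‖ψ‖ = 1
  alice : Question n → (Fin n → ℤˣ) → A →L[ℂ] A
  alice_meas : ∀ x ∈ questionSet S, IsProjectiveMeasurement (alice x)
  bob : Fin 6 → (Fin n → ℤˣ) → B →L[ℂ] B
  bob_meas : ∀ y, IsProjectiveMeasurement (bob y)
  bobWhite : (Fin (n / 2) → Fin 4) → B →L[ℂ] B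
  bobWhite_meas : IsProjectiveMeasurement bobWhite
  bobBlack : (Fin ((n + 1) / 2 - 1) → Fin 4) → B →L[ℂ] B
  bobBlack_meas : IsProjectiveMeasurement bobBlack

namespace Strategy

variable {n : ℕ} {S : Set (Question n)} {A B : Type*}
  [NormedAddCommGroup A] [InnerProductSpace ℂ A] [CompleteSpace A]
  [NormedAddCommGroup B] [InnerProductSpace ℂ B] [CompleteSpace B]
  (st : Strategy n S A B)

/-- The projection for Alice's `j`th answer being `a` upon the question `x`. -/
def aliceProj (x : Question n) (j : Fin n) (a : ℤˣ) : A →L[ℂ] A :=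
  ∑ s : Fin n → ℤˣ with s j = a, st.alice x s

/-- The projection for Bob's `j`th answer being `b` upon the question `y ∈ {1, …, 6}`. -/
def bobProj (y : Fin 6) (j : Fin n) (b : ℤˣ) : B →L[ℂ] B :=
  ∑ s : Fin n → ℤˣ with s j = b, st.bob y s

/-- Alice's observable `A_x⁽ʲ⁾`. -/
def aliceObs (x : Question n) (j : Fin n) : A →L[ℂ] A :=
  st.aliceProj x j 1 - st.aliceProj x j (-1)

/-- Alice's observable `A_{q,r}⁽ʲ⁾` for the input `q` at position `j` and `r` elsewhere. -/
def aliceObsAt (j : Fin n) (q : Fin 5) (r : {i : Fin n // i ≠ j} → Fin 5) : A →L[ℂ] A :=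
  st.aliceObs (insertAt j q r) j

/-- Bob's observable `B_y⁽ʲ⁾`. -/
def bobObs (y : Fin 6) (j : Fin n) : B →L[ℂ] B := st.bobProj y j 1 - st.bobProj y j (-1)

/-- `D_{z,x}⁽ʲ⁾` -/
def Dzx (j : Fin n) : B →L[ℂ] B := st.bobObs 0 j
/-- `E_{z,x}⁽ʲ⁾` -/
def Ezx (j : Fin n) : B →L[ℂ] B := st.bobObs 1 j
/-- `D_{z,y}⁽ʲ⁾` -/
def Dzy (j : Fin n) : B →L[ℂ] B := st.bobObs 2 j
/-- `E_{z,y}⁽ʲ⁾` -/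
def Ezy (j : Fin n) : B →L[ℂ] B := st.bobObs 3 j
/-- `D_{x,y}⁽ʲ⁾` -/
def Dxy (j : Fin n) : B →L[ℂ] B := st.bobObs 4 j
/-- `E_{x,y}⁽ʲ⁾` -/
def Exy (j : Fin n) : B →L[ℂ] B := st.bobObs 5 j

/-- Bob's projection `Γ_b⁽ʲ⁾`, for `1 ≤ j < n` (here `j` is counted from `0`): it collects the
outcomes of `◇` (`j` odd when counted from `1`) or `◆` (`j` even when counted from `1`) that have
`b` at position `⌈j/2⌉`. -/
def bellProj (j : ℕ) (hj : j + 1 < n) (b : Fin 4) : B →L[ℂ] B :=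
  if hpar : j % 2 = 0 then
    ∑ s : Fin (n / 2) → Fin 4 with s ⟨j / 2, by omega⟩ = b, st.bobWhite s
  else
    ∑ s : Fin ((n + 1) / 2 - 1) → Fin 4 with s ⟨j / 2, by omega⟩ = b, st.bobBlack s

/-- The (real) expectation value `⟨ψ|O|ψ⟩`. -/
def expect (O : HilbertTensor A B →L[ℂ] HilbertTensor A B) : ℝ := (inner ℂ st.ψ (O st.ψ)).re

/-- The triple CHSH operator `C_r⁽ʲ⁾`. -/
def tripleCHSH (j : Fin n) (r : {i : Fin n // i ≠ j} → Fin 5) :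
    HilbertTensor A B →L[ℂ] HilbertTensor A B :=
  opTensor (st.aliceObsAt j 2 r) (st.Dzx j + st.Ezx j)
    + opTensor (st.aliceObsAt j 0 r) (st.Dzx j - st.Ezx j)
    + opTensor (st.aliceObsAt j 2 r) (st.Dzy j + st.Ezy j)
    + opTensor (st.aliceObsAt j 1 r) (st.Dzy j - st.Ezy j)
    + opTensor (st.aliceObsAt j 0 r) (st.Dxy j + st.Exy j)
    + opTensor (st.aliceObsAt j 1 r) (st.Dxy j - st.Exy j)

/-- The combination of Bob's projections `Γ_b⁽ʲ⁾` that is compared with Alice's question `q, q` at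
positions `j, j+1`. -/
def bellObs (j : ℕ) (hj : j + 1 < n) (q : Fin 5) : B →L[ℂ] B :=
  (if q = 1 then (-1 : ℂ) else 1) • st.bellProj j hj 0
    + (if q = 0 then (-1 : ℂ) else 1) • st.bellProj j hj 1
    + (if q = 2 then (-1 : ℂ) else 1) • st.bellProj j hj 2
    - st.bellProj j hj 3

/-- All requested Bell values and correlations are attained within the tolerance given by `ε`. -/
structure AttainsRequests (ε : ℝ) : Prop where
  chsh : ∀ j, ∀ r ∈ remainingSet S j, 6 * √2 - ε / √2 ≤ st.expect (st.tripleCHSH j r)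
  corr_add : ∀ χ ∈ S, ∀ j,
    1 - ε ≤ st.expect (opTensor (st.aliceObsAt j 3 (removeAt j χ)) (st.Dxy j))
  corr_sub : ∀ χ ∈ S, ∀ j,
    1 - ε ≤ st.expect (opTensor (st.aliceObsAt j 4 (removeAt j χ)) (st.Exy j))
  conj : ∃ χ ∈ S, ∀ (j : ℕ) (hj : j + 1 < n), ∀ q ∈ ({0, 1, 2} : Set (Fin 5)),
    let j₀ : Fin n := ⟨j, by omega⟩
    let j₁ : Fin n := ⟨j + 1, hj⟩
    let w : Question n := Function.update (Function.update χ j₀ q) j₁ q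
    1 - ε / 2 ≤ st.expect (opTensor (st.aliceObs w j₀ * st.aliceObs w j₁) (st.bellObs j hj q))

end Strategy

end SelfTest

end

/-! A nearly maximal triple CHSH value is a sum of small squares (`chsh_sos`). On the state, each of
Alice's observables x, y, z therefore acts almost like one of Bob's combinations (D ± E)/√2,
whatever the rest of her question is. Some Pauli relations are exact on one side only: Alice's
observables square to 1 and commute across positions because they come from one joint measurement,
while D + E and D - E anticommute exactly on Bob's side.

To use both kinds together, n is fixed and all strategies are treated at once. Bounded families of
pairs (a, b) with a ψ = b ψ + O(√ε) form an algebra, `mirrorAlgebra`, in which Bob's products are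
reversed; the pairs with a ψ = O(√ε) form a two-sided ideal. In the quotient the approximate
relations become exact (`Scenario.pauliRelations_cls`), and the remaining argument is ring
identities. The constants depend on n alone because the families run over all strategies.

In the quotient, w = -i y x is a phase flip for x at each position, and z w is an involution
commuting with every x and y; its sign is the freedom of complex conjugation. The Bell measurements
give w w' = z z' for neighbouring positions, so all the z w equal a single j
(`Scenario.cls_mul_phaseFlip`). In each of the two branches of j, z = ± w with one sign for all
positions; this is the operator Z_q of the theorem.

The isometries record the branch of j in the register H'' and swap each qubit, with bit flip x and
phase flip w, into H'. By `PauliRelations.swap_coefficient` their components on the state are the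
coefficients of σ_q on Bell pairs, times one operator of Bob per branch. Bob's combinations need not
preserve norms, so `exists_regularisation` replaces them by isometric ones with the same action on
the state up to O(√ε). The junk vectors involve Bob's operators only, hence are the same for every
χ; `exists_unit_weightedJunk` normalises them. -/

namespace SelfTest

/-! ### Operators on completed tensor products. -/

section TensorCalculus

variable {H H' H'' K K' K'' X Y : Type*}
  [NormedAddCommGroup H] [InnerProductSpace ℂ H] [NormedAddCommGroup H'] [InnerProductSpace ℂ H']
  [NormedAddCommGroup H''] [InnerProductSpace ℂ H'']
  [NormedAddCommGroup K] [InnerProductSpace ℂ K] [NormedAddCommGroup K'] [InnerProductSpace ℂ K']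
  [NormedAddCommGroup K''] [InnerProductSpace ℂ K'']
  [NormedAddCommGroup X] [InnerProductSpace ℂ X] [NormedAddCommGroup Y] [InnerProductSpace ℂ Y]

theorem opTensor_coe (S : H →L[ℂ] H') (T : K →L[ℂ] K') (v : H ⊗[ℂ] K) :
    opTensor S T (v : HilbertTensor H K) = (TensorProduct.mapL S T v : H' ⊗[ℂ] K') :=
  ContinuousLinearMap.completion_apply_coe _ _

/-- Continuous linear maps out of a Hilbert tensor product are determined by pure tensors. -/
theorem hilbertTensor_ext {Z : Type*} [NormedAddCommGroup Z] [InnerProductSpace ℂ Z]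
    {f g : HilbertTensor H K →L[ℂ] Z}
    (h : ∀ (a : H) (b : K), f ((a ⊗ₜ[ℂ] b : H ⊗[ℂ] K) : HilbertTensor H K) =
      g ((a ⊗ₜ[ℂ] b : H ⊗[ℂ] K) : HilbertTensor H K)) : f = g := by
  ext v
  induction v using UniformSpace.Completion.induction_on with
  | hp => exact isClosed_eq f.continuous g.continuous
  | ih v =>
    induction v using TensorProduct.induction_on with
    | zero => rw [UniformSpace.Completion.coe_zero, map_zero, map_zero]
    | tmul a b => exact h a b
    | add u v hu hv => simp only [UniformSpace.Completion.coe_add, map_add, hu, hv]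

theorem opTensor_tmul (S : H →L[ℂ] H') (T : K →L[ℂ] K') (a : H) (b : K) :
    opTensor S T ((a ⊗ₜ[ℂ] b : H ⊗[ℂ] K) : HilbertTensor H K) =
      ((S a ⊗ₜ[ℂ] T b : H' ⊗[ℂ] K') : HilbertTensor H' K') := by
  rw [opTensor_coe, TensorProduct.mapL_tmul]

theorem opTensor_comp_apply (S : H' →L[ℂ] H'') (T : K' →L[ℂ] K'') (S' : H →L[ℂ] H')
    (T' : K →L[ℂ] K') (v : HilbertTensor H K) :
    opTensor S T (opTensor S' T' v) = opTensor (S ∘L S') (T ∘L T') v := by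
  have : opTensor S T ∘L opTensor S' T' = opTensor (S ∘L S') (T ∘L T') :=
    hilbertTensor_ext fun a b => by simp [opTensor_tmul]
  exact DFunLike.congr_fun this v

/-- `opTensor` as a bilinear map. -/
noncomputable def opTensorBilin : (H →L[ℂ] H') →ₗ[ℂ] (K →L[ℂ] K') →ₗ[ℂ]
    (HilbertTensor H K →L[ℂ] HilbertTensor H' K') :=
  LinearMap.mk₂ ℂ opTensor
    (fun S S' T => hilbertTensor_ext fun a b => by
      simp [opTensor_tmul, TensorProduct.add_tmul, UniformSpace.Completion.coe_add])
    (fun c S T => hilbertTensor_ext fun a b => by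
      simp [opTensor_tmul, ← TensorProduct.smul_tmul'])
    (fun S T T' => hilbertTensor_ext fun a b => by
      simp [opTensor_tmul, TensorProduct.tmul_add, UniformSpace.Completion.coe_add])
    (fun c S T => hilbertTensor_ext fun a b => by
      simp [opTensor_tmul])

theorem opTensor_eq_bilin (S : H →L[ℂ] H') (T : K →L[ℂ] K') :
    opTensor S T = opTensorBilin S T := rfl

theorem norm_opTensor_apply_le (S : H →L[ℂ] H') (T : K →L[ℂ] K') (v : HilbertTensor H K) :
    ‖opTensor S T v‖ ≤ ‖S‖ * ‖T‖ * ‖v‖ := by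
  induction v using UniformSpace.Completion.induction_on with
  | hp => exact isClosed_le (by fun_prop) (by fun_prop)
  | ih v =>
    rw [opTensor_coe, UniformSpace.Completion.norm_coe, UniformSpace.Completion.norm_coe]
    exact (ContinuousLinearMap.le_opNorm _ _).trans
      (mul_le_mul_of_nonneg_right (TensorProduct.norm_mapL_le S T) (norm_nonneg _))

/-- The hypotheses say S* S' = S₂ and T* T' = T₂ without adjoints, so no completeness is needed.
Self-adjointness of tensor operators, isometry of tensored isometries and the inner products of
`attach` are all instances. -/
theorem inner_opTensor_opTensor (S : H →L[ℂ] H') (T : K →L[ℂ] K') (S' : X →L[ℂ] H')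
    (T' : Y →L[ℂ] K') (S₂ : X →L[ℂ] H) (T₂ : Y →L[ℂ] K)
    (h : ∀ a b, inner ℂ (S a) (S' b) = inner ℂ a (S₂ b))
    (h' : ∀ a b, inner ℂ (T a) (T' b) = inner ℂ a (T₂ b))
    (u : HilbertTensor H K) (v : HilbertTensor X Y) :
    inner ℂ (opTensor S T u) (opTensor S' T' v) = inner ℂ u (opTensor S₂ T₂ v) := by
  induction u, v using UniformSpace.Completion.induction_on₂ with
  | hp => exact isClosed_eq (by fun_prop) (by fun_prop)
  | ih u v =>
    simp only [opTensor_coe, UniformSpace.Completion.inner_coe]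
    induction u using TensorProduct.induction_on with
    | zero => simp
    | add u u' hu hu' => rw [map_add, inner_add_left, inner_add_left, hu, hu']
    | tmul a b =>
      induction v using TensorProduct.induction_on with
      | zero => simp
      | add v v' hv hv' => rw [map_add, inner_add_right, map_add, inner_add_right, hv, hv']
      | tmul c d => simp only [TensorProduct.mapL_tmul, TensorProduct.inner_tmul, h, h']

theorem opTensor_id_id (v : HilbertTensor H K) :
    opTensor (ContinuousLinearMap.id ℂ H) (ContinuousLinearMap.id ℂ K) v = v := by
  have : opTensor (ContinuousLinearMap.id ℂ H) (ContinuousLinearMap.id ℂ K) =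
      ContinuousLinearMap.id ℂ (HilbertTensor H K) :=
    hilbertTensor_ext fun a b => by simp [opTensor_tmul]
  exact DFunLike.congr_fun this v

theorem inner_opTensor_of_selfAdjoint (S : H →L[ℂ] H) (T : K →L[ℂ] K)
    (hS : ∀ a b, inner ℂ (S a) b = inner ℂ a (S b))
    (hT : ∀ a b, inner ℂ (T a) b = inner ℂ a (T b)) (u v : HilbertTensor H K) :
    inner ℂ (opTensor S T u) v = inner ℂ u (opTensor S T v) := by
  conv_lhs => rw [← opTensor_id_id v]
  exact inner_opTensor_opTensor S T _ _ S T hS hT u v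

theorem norm_opTensor_isometry (V : H →ₗᵢ[ℂ] H') (W : K →ₗᵢ[ℂ] K') (v : HilbertTensor H K) :
    ‖opTensor V.toContinuousLinearMap W.toContinuousLinearMap v‖ = ‖v‖ := by
  have := inner_opTensor_opTensor V.toContinuousLinearMap W.toContinuousLinearMap
    V.toContinuousLinearMap W.toContinuousLinearMap (ContinuousLinearMap.id ℂ H)
    (ContinuousLinearMap.id ℂ K) (fun a b => by simp) (fun a b => by simp) v v
  rw [opTensor_id_id, inner_self_eq_norm_sq_to_K, inner_self_eq_norm_sq_to_K] at this
  have h : ‖opTensor V.toContinuousLinearMap W.toContinuousLinearMap v‖ ^ 2 = ‖v‖ ^ 2 := by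
    exact_mod_cast this
  exact (sq_eq_sq₀ (norm_nonneg _) (norm_nonneg _)).1 h

theorem inner_attach (u u' : X) (w w' : Y) (v v' : HilbertTensor H K) :
    inner ℂ (attach u w v) (attach u' w' v') = inner ℂ u u' * inner ℂ w w' * inner ℂ v v' := by
  have := inner_opTensor_opTensor ((TensorProduct.mkL ℂ H X).flip u)
    ((TensorProduct.mkL ℂ K Y).flip w) ((TensorProduct.mkL ℂ H X).flip u')
    ((TensorProduct.mkL ℂ K Y).flip w') (inner ℂ u u' • ContinuousLinearMap.id ℂ H)
    (inner ℂ w w' • ContinuousLinearMap.id ℂ K)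
    (fun a b => by simp [mul_comm])
    (fun a b => by simp [mul_comm]) v v'
  rw [attach, attach, this, opTensor_eq_bilin, map_smul, map_smul, LinearMap.smul_apply,
    ← opTensor_eq_bilin, smul_apply, smul_apply,
    opTensor_id_id, inner_smul_right, inner_smul_right]
  ring

theorem norm_attach (u : X) (w : Y) (v : HilbertTensor H K) :
    ‖attach u w v‖ = ‖u‖ * ‖w‖ * ‖v‖ := by
  have := inner_attach u u w w v v
  simp only [inner_self_eq_norm_sq_to_K] at this
  have h : ‖attach u w v‖ ^ 2 = (‖u‖ * ‖w‖ * ‖v‖) ^ 2 := by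
    rw [mul_pow, mul_pow]; exact_mod_cast this
  exact (sq_eq_sq₀ (norm_nonneg _) (by positivity)).1 h

theorem attach_opTensor (u : X) (w : Y) (S : H →L[ℂ] H') (T : K →L[ℂ] K')
    (v : HilbertTensor H K) :
    attach u w (opTensor S T v) =
      opTensor ((TensorProduct.mkL ℂ H' X).flip u ∘L S) ((TensorProduct.mkL ℂ K' Y).flip w ∘L T)
        v :=
  opTensor_comp_apply _ _ _ _ _

theorem onBob_lTensor_attach (T : Y →L[ℂ] Y) (u : X) (w : Y) (v : HilbertTensor H K) :
    onBob (ContinuousLinearMap.lTensor K T) (attach u w v) = attach u (T w) v := by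
  rw [onBob, attach, opTensor_comp_apply]
  rfl

theorem attach_sum_right {ι : Type*} (s : Finset ι) (u : X) (c : ι → ℂ) (w : ι → Y)
    (v : HilbertTensor H K) :
    attach u (∑ i ∈ s, c i • w i) v = ∑ i ∈ s, c i • attach u (w i) v := by
  simp only [attach, opTensor_eq_bilin, map_sum, map_smul, sum_apply,
    smul_apply]

end TensorCalculus

/-! ### Qubit registers, Bell pairs and the junk register. -/

section Registers

variable {n : ℕ}

theorem inner_ket (s t : Fin n → Fin 2) : inner ℂ (ket s) (ket t) = if s = t then 1 else 0 := by
  simp [ket, EuclideanSpace.inner_single_left]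

theorem norm_ket (s : Fin n → Fin 2) : ‖ket s‖ = 1 := by simp [ket]

theorem inner_ketRep (hn : 1 ≤ n) (c d : Fin 2) :
    inner ℂ (ketRep n c) (ketRep n d) = if c = d then 1 else 0 := by
  rw [ketRep, ketRep, inner_ket]
  have : ((fun _ => c) = fun _ : Fin n => d) ↔ c = d :=
    ⟨fun h => congrFun h ⟨0, hn⟩, fun h => h ▸ rfl⟩
  simp only [this]

theorem norm_ketRep (c : Fin 2) : ‖ketRep n c‖ = 1 := norm_ket _

theorem kickbackZ_ketRep (hn : 1 ≤ n) (c : Fin 2) :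
    kickbackZ n (ketRep n c) = (if c = 1 then (-1 : ℂ) else 1) • ketRep n c := by
  fin_cases c <;> simp [kickbackZ, inner_ketRep hn, -inner_self_eq_norm_sq_to_K]

/-- The coefficient is written as a product over all qubits, with the identity matrix away from `k`,
because the Kraus words produce their coefficients in this form. -/
theorem onQubit_ket (k : Fin n) (M : Matrix (Fin 2) (Fin 2) ℂ) (s : Fin n → Fin 2) :
    onQubit k M (ket s) =
      ∑ t : Fin n → Fin 2, (∏ i, (if i = k then M else 1) (t i) (s i)) • ket t := by
  have : ∀ u : Fin n → Fin 2, (∏ i, (if i = k then M else 1) (u i) (s i)) =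
      if ∀ i, i ≠ k → u i = s i then M (u k) (s k) else 0 := by
    intro u
    rw [← Finset.mul_prod_erase _ _ (Finset.mem_univ k)]
    by_cases h : ∀ i, i ≠ k → u i = s i
    · rw [Finset.prod_eq_one, mul_one, if_pos h, if_pos rfl]
      intro i hi
      rw [if_neg (Finset.ne_of_mem_erase hi), h i (Finset.ne_of_mem_erase hi), Matrix.one_apply_eq]
    · rw [if_neg h]
      push Not at h
      obtain ⟨i, hi, hne⟩ := h
      rw [Finset.prod_eq_zero (i := i) (by simp [hi]), mul_zero]
      rw [if_neg hi, Matrix.one_apply_ne hne]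
  ext t
  have hsum : (∑ t : Fin n → Fin 2,
      (∏ i, (if i = k then M else 1) (t i) (s i)) • ket t : Qubits n) t =
      ∏ i, (if i = k then M else 1) (t i) (s i) := by
    simp [ket, Pi.single_apply, -Finset.prod_ite_eq, -Finset.prod_ite_eq']
  rw [hsum, this, onQubit, Matrix.ofLp_toEuclideanCLM]
  simp [ket]

variable {A B : Type*} [NormedAddCommGroup A] [InnerProductSpace ℂ A]
  [NormedAddCommGroup B] [InnerProductSpace ℂ B]

theorem prod_bellCoeff (s t : Fin n → Fin 2) :
    ∏ j, bellCoeff (s j) (t j) = if s = t then (((1 / √2 : ℝ) : ℂ)) ^ n else 0 := by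
  split_ifs with h
  · subst h; simp [bellCoeff]
  · obtain ⟨i, hi⟩ := Function.ne_iff.1 h
    exact Finset.prod_eq_zero (Finset.mem_univ i) (by simp [bellCoeff, hi])

theorem bellTensor_eq (v : HilbertTensor A B) :
    bellTensor n v = ((1 / √2 : ℝ) : ℂ) ^ n • ∑ s : Fin n → Fin 2, attach (ket s) (ket s) v := by
  simp only [bellTensor, prod_bellCoeff, ite_smul, zero_smul, Finset.sum_ite_eq, Finset.mem_univ,
    if_true, Finset.smul_sum]

theorem bellTensor_sub (v w : HilbertTensor A B) :
    bellTensor n (v - w) = bellTensor n v - bellTensor n w := by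
  simp only [bellTensor_eq, map_sub, Finset.sum_sub_distrib, smul_sub]

theorem norm_bellTensor (v : HilbertTensor A B) : ‖bellTensor n v‖ = ‖v‖ := by
  have h : inner ℂ (bellTensor n v) (bellTensor n v) = inner ℂ v v := by
    rw [bellTensor_eq, inner_smul_left, inner_smul_right, sum_inner]
    simp only [inner_sum, inner_attach, inner_ket]
    simp only [ite_mul, mul_ite, mul_zero, zero_mul, mul_one, one_mul, Finset.sum_ite_eq,
      Finset.mem_univ, if_true, Finset.sum_const, Finset.card_univ, Fintype.card_pi,
      Fintype.card_fin, Finset.prod_const, map_pow, Complex.conj_ofReal, nsmul_eq_mul]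
    rw [← mul_assoc, ← mul_assoc, ← mul_pow, Nat.cast_pow, ← mul_pow]
    have : ((1 / √2 : ℝ) : ℂ) * ((1 / √2 : ℝ) : ℂ) * ((2 : ℕ) : ℂ) = 1 := by
      rw [← Complex.ofReal_mul, div_mul_div_comm, Real.mul_self_sqrt zero_le_two]
      norm_num
    rw [this, one_pow, one_mul]
  simp only [inner_self_eq_norm_sq_to_K] at h
  exact (sq_eq_sq₀ (norm_nonneg _) (norm_nonneg _)).1 (by exact_mod_cast h)

theorem norm_junk_sq (hn : 1 ≤ n) (v w : HilbertTensor A B) :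
    ‖junk n v w‖ ^ 2 = ‖v‖ ^ 2 + ‖w‖ ^ 2 := by
  have h : inner ℂ (junk n v w) (junk n v w) = inner ℂ v v + inner ℂ w w := by
    simp [junk, inner_add_left, inner_add_right, inner_attach, inner_ketRep hn,
      -inner_self_eq_norm_sq_to_K]
  simp only [inner_self_eq_norm_sq_to_K] at h
  exact_mod_cast h

end Registers

/-! ### Ordered products in a noncommutative ring. -/

section ListProducts

variable {E : Type*} [Ring E]

theorem ofFn_prod_succ {n : ℕ} (v : Fin (n + 1) → E) :
    (List.ofFn v).prod = v 0 * (List.ofFn fun i => v i.succ).prod := by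
  rw [List.ofFn_succ, List.prod_cons]

theorem ofFn_reverse_prod_succ {n : ℕ} (v : Fin (n + 1) → E) :
    (List.ofFn v).reverse.prod = (List.ofFn fun i => v i.succ).reverse.prod * v 0 := by
  rw [List.ofFn_succ, List.reverse_cons, List.prod_append, List.prod_singleton]

theorem commute_ofFn_prod {n : ℕ} {a : E} {v : Fin n → E} (h : ∀ i, Commute a (v i)) :
    Commute a (List.ofFn v).prod :=
  Commute.list_prod_right _ _ fun b hb => by
    obtain ⟨i, rfl⟩ := (List.mem_ofFn' v b).1 hb
    exact h i

theorem commute_ofFn_reverse_prod {n : ℕ} {a : E} {v : Fin n → E} (h : ∀ i, Commute a (v i)) :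
    Commute a (List.ofFn v).reverse.prod :=
  Commute.list_prod_right _ _ fun b hb => by
    obtain ⟨i, rfl⟩ := (List.mem_ofFn' v b).1 (List.mem_reverse.1 hb)
    exact h i

/-- `g` moves past the factors before `k` and is absorbed in the factor `k`. -/
theorem mul_ofFn_prod {n : ℕ} (g : E) (v : Fin n → E) (k : Fin n)
    (h : ∀ i, i ≠ k → Commute g (v i)) :
    g * (List.ofFn v).prod = (List.ofFn fun i => (if i = k then g else 1) * v i).prod := by
  induction n with
  | zero => exact k.elim0
  | succ n ih =>
    rw [ofFn_prod_succ v, ofFn_prod_succ]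
    cases k using Fin.cases with
    | zero => simp [Fin.succ_ne_zero, mul_assoc]
    | succ k =>
      rw [← mul_assoc, (h 0 (Fin.succ_ne_zero k).symm).eq, mul_assoc,
        ih (fun i => v i.succ) k (fun i hi => h _ (by simpa using hi))]
      simp [(Fin.succ_ne_zero k).symm]

end ListProducts

/-! ### The swap gadget as ring identities. -/

section SwapAlgebra

variable {E : Type*} [Ring E] [Algebra ℂ E]

/-- The projection-like element `(1 + w) / 2`. -/
noncomputable def halfPlus (w : E) : E := (1 / 2 : ℂ) • (1 + w)

/-- The Kraus operators of the swap gadget built from a bit flip `x` and a phase flip `w`. -/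
noncomputable def kraus (x w : E) (c : Fin 2) : E :=
  if c = 0 then halfPlus w else x * halfPlus (-w)

/-- The factors of `kraus` in the opposite order. -/
noncomputable def krausMirror (x w : E) (c : Fin 2) : E :=
  if c = 0 then halfPlus w else halfPlus (-w) * x

/-- The sign `(-1)ᶜ`. -/
noncomputable def bitSign (c : Fin 2) : ℂ := if c = 1 then -1 else 1

/-- The element `(1 ± j) / 2`. -/
noncomputable def branch (j : E) (c : Fin 2) : E := halfPlus (bitSign c • j)

/-- The sign that the third observable picks up in the branch `c`. -/
noncomputable def kickbackSign (q : Fin 5) (c : Fin 2) : ℂ := if q = 2 then bitSign c else 1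

/-- The five observables in the bases x, y, z, x+y, x-y. -/
noncomputable def fiveObs (x y z : E) (q : Fin 5) : E :=
  ![x, y, z, ((1 / √2 : ℝ) : ℂ) • (x + y), ((1 / √2 : ℝ) : ℂ) • (x - y)] q

theorem halfPlus_mul_self {w : E} (hw : w * w = 1) : halfPlus w * halfPlus w = halfPlus w := by
  simp only [halfPlus, smul_mul_smul_comm, mul_add, add_mul, mul_one, one_mul, hw, smul_add]
  module

theorem halfPlus_mul_neg {w : E} (hw : w * w = 1) : halfPlus w * halfPlus (-w) = 0 := by
  simp only [halfPlus, smul_mul_smul_comm, mul_add, add_mul, mul_one, one_mul, mul_neg, hw,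
    smul_add]
  module

theorem mul_halfPlus_self {w : E} (hw : w * w = 1) : w * halfPlus w = halfPlus w := by
  simp only [halfPlus, mul_smul_comm, mul_add, mul_one, hw, add_comm]

theorem mul_halfPlus_neg_of_anticomm {x w : E} (h : w * x = -(x * w)) :
    x * halfPlus (-w) = halfPlus w * x := by
  simp only [halfPlus, mul_smul_comm, smul_mul_assoc, mul_add, add_mul, mul_one, one_mul, mul_neg,
    h]

/-- Anticommutation moves the projection to the left, so both Kraus operators begin with the same
projection on the +1 eigenspace of `w`. -/
theorem kraus_eq {x w : E} (h : w * x = -(x * w)) (c : Fin 2) :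
    kraus x w c = halfPlus w * (if c = 0 then 1 else x) := by
  unfold kraus; split_ifs <;> simp [mul_halfPlus_neg_of_anticomm h]

theorem krausMirror_eq {x w : E} (h : w * x = -(x * w)) (c : Fin 2) :
    krausMirror x w c = (if c = 0 then 1 else x) * halfPlus w := by
  unfold krausMirror; split_ifs
  · simp
  · have h' : -w * x = -(x * -w) := by rw [neg_mul, h, mul_neg]
    have := mul_halfPlus_neg_of_anticomm h'
    rw [neg_neg] at this
    exact this.symm

/-- The bit flip exchanges the two eigenspaces of `w`; this makes the off-diagonal terms of the
gadget vanish. -/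
theorem halfPlus_mul_mul_halfPlus {x w : E} (hw : w * w = 1) (h : w * x = -(x * w)) :
    halfPlus w * x * halfPlus w = 0 := by
  rw [← mul_halfPlus_neg_of_anticomm h, mul_assoc]
  have := halfPlus_mul_neg (w := -w) (by rw [neg_mul_neg, hw])
  rw [neg_neg] at this
  rw [this, mul_zero]

theorem kraus_mul_krausMirror {x w : E} (hx : x * x = 1) (hw : w * w = 1)
    (h : w * x = -(x * w)) (s t : Fin 2) :
    kraus x w s * krausMirror x w t = (1 : Matrix (Fin 2) (Fin 2) ℂ) t s • halfPlus w := by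
  rw [kraus_eq h, krausMirror_eq h]
  have h1 := halfPlus_mul_mul_halfPlus hw h
  have h2 := halfPlus_mul_self hw
  have h3 : halfPlus w * x * (x * halfPlus w) = halfPlus w := by
    rw [mul_assoc, ← mul_assoc x, hx, one_mul, h2]
  fin_cases s <;> fin_cases t <;> simp [h1, h2, h3, ← mul_assoc]

/-- With x^t applied to the +1 eigenspace of `w` as the vector |t⟩, the left side is the matrix
entry ⟨s|O|t⟩. In this frame x and w are σ_x and σ_z, and y = i w x is -σ_y, the transpose of σ_y.
Hence the transposed index order `t s`: an operator on Alice's half of a Bell pair equals its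
transpose on Bob's half. -/
theorem kraus_mul_fiveObs_mul_krausMirror {x y w : E} (hx : x * x = 1) (hw : w * w = 1)
    (h : w * x = -(x * w)) (hy : y = Complex.I • (w * x)) (q : Fin 5) (s t : Fin 2) :
    kraus x w s * fiveObs x y w q * krausMirror x w t = pauli q t s • halfPlus w := by
  have h0 := halfPlus_mul_mul_halfPlus hw h
  have h1 := halfPlus_mul_self hw
  have h2 := mul_halfPlus_self hw
  have h3 : halfPlus w * w = halfPlus w := by
    simp only [halfPlus, smul_mul_assoc, add_mul, one_mul, hw, add_comm]
  set p := halfPlus w with hp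
  have hX : ∀ s t, kraus x w s * x * krausMirror x w t = pauli 0 t s • p := by
    intro s t
    rw [kraus_eq h, krausMirror_eq h, ← hp]
    fin_cases s <;> fin_cases t <;>
      (simp [pauli, mul_assoc, hx, h1, ← mul_assoc x x, h0]; try simp [← mul_assoc, h0])
  have hW : ∀ s t, kraus x w s * w * krausMirror x w t = pauli 2 t s • p := by
    intro s t
    have e1 : w * (x * p) = -(x * p) := by rw [← mul_assoc, h, neg_mul, mul_assoc, h2]
    rw [kraus_eq h, krausMirror_eq h, ← hp]
    fin_cases s <;> fin_cases t <;>
      simp [pauli, mul_assoc, hx, h1, h2, e1, ← mul_assoc x x] <;>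
      simp [← mul_assoc, h0]
  have hY : ∀ s t, kraus x w s * y * krausMirror x w t = pauli 1 t s • p := by
    intro s t
    have e1 : w * (x * p) = -(x * p) := by rw [← mul_assoc, h, neg_mul, mul_assoc, h2]
    rw [kraus_eq h, krausMirror_eq h, ← hp, hy]
    fin_cases s <;> fin_cases t <;>
      simp [pauli, mul_assoc, hx, h1, h2, e1, ← mul_assoc x x] <;>
      simp [← mul_assoc, h0]
  fin_cases q
  · exact hX s t
  · exact hY s t
  · exact hW s t
  · change kraus x w s * (((1 / √2 : ℝ) : ℂ) • (x + y)) * krausMirror x w t =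
      ((((1 / √2 : ℝ) : ℂ) • (pauli 0 + pauli 1)) t s : ℂ) • p
    rw [mul_smul_comm, smul_mul_assoc, mul_add, add_mul, hX, hY, ← add_smul, smul_smul]
    rfl
  · change kraus x w s * (((1 / √2 : ℝ) : ℂ) • (x - y)) * krausMirror x w t =
      ((((1 / √2 : ℝ) : ℂ) • (pauli 0 - pauli 1)) t s : ℂ) • p
    rw [mul_smul_comm, smul_mul_assoc, mul_sub, sub_mul, hX, hY, ← sub_smul, smul_smul]
    rfl

/-- The product collapses from the middle: the innermost pair `u 0 * v 0` becomes a multiple of `p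
0`, which commutes out to the left through the later factors `u k`. -/
theorem ofFn_reverse_prod_mul_ofFn_prod {n : ℕ} (u v p : Fin n → E) (m : Fin n → ℂ)
    (huv : ∀ i, u i * v i = m i • p i) (hpu : ∀ i k, i < k → Commute (p i) (u k)) :
    (List.ofFn u).reverse.prod * (List.ofFn v).prod = (∏ i, m i) • (List.ofFn p).prod := by
  induction n with
  | zero => simp
  | succ n ih =>
    have hc : Commute (p 0) (List.ofFn fun i : Fin n => u i.succ).reverse.prod :=
      commute_ofFn_reverse_prod fun i => hpu 0 i.succ (Fin.succ_pos i)
    have ih' := ih (fun i => u i.succ) (fun i => v i.succ) (fun i => p i.succ) (fun i => m i.succ)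
      (fun i => huv _) (fun i k hik => hpu _ _ (Fin.succ_lt_succ_iff.2 hik))
    rw [ofFn_reverse_prod_succ, ofFn_prod_succ v, ofFn_prod_succ p, mul_assoc, ← mul_assoc (u 0),
      huv, smul_mul_assoc, mul_smul_comm, ← mul_assoc, ← hc.eq, mul_assoc, ih', mul_smul_comm,
      smul_smul, Fin.prod_univ_succ]

/-- Exact Pauli relations for the observables `x k`, `y k`, `z k`, where `j` is the common value of
the products `z k * (-i y k x k)`. -/
structure PauliRelations {n : ℕ} (x y z : Fin n → E) (j : E) : Prop where
  x_sq : ∀ k, x k * x k = 1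
  y_sq : ∀ k, y k * y k = 1
  z_sq : ∀ k, z k * z k = 1
  xy : ∀ k, x k * y k = -(y k * x k)
  xz : ∀ k, x k * z k = -(z k * x k)
  yz : ∀ k, y k * z k = -(z k * y k)
  comm_xx : ∀ k l, k ≠ l → Commute (x k) (x l)
  comm_xy : ∀ k l, k ≠ l → Commute (x k) (y l)
  comm_yy : ∀ k l, k ≠ l → Commute (y k) (y l)
  z_mul : ∀ k, z k * (-Complex.I) • (y k * x k) = j

/-- The phase flip `-i y x` obtained from the observables `x` and `y`. -/
noncomputable def phaseFlip (x y : E) : E := (-Complex.I) • (y * x)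

theorem phaseFlip_mul_self {x y : E} (hx : x * x = 1) (hy : y * y = 1) (h : x * y = -(y * x)) :
    phaseFlip x y * phaseFlip x y = 1 := by
  have : y * x * (y * x) = -1 := by
    rw [mul_assoc, ← mul_assoc x, h, neg_mul, mul_assoc, hx, mul_one, mul_neg, hy]
  rw [phaseFlip, smul_mul_smul_comm, this]
  simp

namespace PauliRelations

variable {n : ℕ} {x y z : Fin n → E} {j : E}

theorem flip_sq (h : PauliRelations x y z j) (k : Fin n) :
    phaseFlip (x k) (y k) * phaseFlip (x k) (y k) = 1 :=
  phaseFlip_mul_self (h.x_sq k) (h.y_sq k) (h.xy k)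

theorem flip_mul_x (h : PauliRelations x y z j) (k : Fin n) :
    phaseFlip (x k) (y k) * x k = -(x k * phaseFlip (x k) (y k)) := by
  rw [phaseFlip, smul_mul_assoc, mul_smul_comm, ← mul_assoc, h.xy, neg_mul, smul_neg, neg_neg]

theorem flip_mul_y (h : PauliRelations x y z j) (k : Fin n) :
    phaseFlip (x k) (y k) * y k = -(y k * phaseFlip (x k) (y k)) := by
  rw [phaseFlip, smul_mul_assoc, mul_smul_comm, mul_assoc, h.xy, mul_neg, smul_neg]

theorem y_eq (h : PauliRelations x y z j) (k : Fin n) :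
    y k = Complex.I • (phaseFlip (x k) (y k) * x k) := by
  rw [phaseFlip, smul_mul_assoc, mul_assoc, h.x_sq, smul_smul]
  simp

theorem z_mul_flip (h : PauliRelations x y z j) (k : Fin n) : z k * phaseFlip (x k) (y k) = j :=
  h.z_mul k

/-- `z k` anticommutes with both factors of the phase flip, so it commutes with their product. -/
theorem flip_mul_z (h : PauliRelations x y z j) (k : Fin n) : phaseFlip (x k) (y k) * z k = j := by
  rw [← h.z_mul k, mul_smul_comm, phaseFlip, smul_mul_assoc, mul_assoc, h.xz, mul_neg,
    ← mul_assoc, h.yz, neg_mul, neg_neg, mul_assoc]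

theorem z_eq (h : PauliRelations x y z j) (k : Fin n) : z k = j * phaseFlip (x k) (y k) := by
  rw [← h.z_mul_flip k, mul_assoc, h.flip_sq, mul_one]

theorem branch_sq (h : PauliRelations x y z j) [NeZero n] : j * j = 1 := by
  have : j * j = z 0 * phaseFlip (x 0) (y 0) * (phaseFlip (x 0) (y 0) * z 0) := by
    rw [h.z_mul_flip 0, h.flip_mul_z 0]
  rw [this, mul_assoc, ← mul_assoc (phaseFlip _ _), h.flip_sq, one_mul, h.z_sq]

/-- Since `j` has the same value at all positions, it can be written with the factors at `k`, and `x
k` anticommutes with both of them. -/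
theorem commute_x (h : PauliRelations x y z j) (k : Fin n) : Commute j (x k) := by
  rw [← h.z_mul_flip k, commute_iff_eq, mul_assoc, h.flip_mul_x, mul_neg, ← mul_assoc,
    ← mul_assoc, h.xz, neg_mul]

theorem commute_y (h : PauliRelations x y z j) (k : Fin n) : Commute j (y k) := by
  rw [← h.z_mul_flip k, commute_iff_eq, mul_assoc, h.flip_mul_y, mul_neg, ← mul_assoc,
    ← mul_assoc, h.yz, neg_mul]

theorem commute_flip (h : PauliRelations x y z j) (k : Fin n) : Commute j (phaseFlip (x k) (y k)) :=
  ((h.commute_y k).mul_right (h.commute_x k)).smul_right _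

theorem commute_flip_x (h : PauliRelations x y z j) {k l : Fin n} (hkl : k ≠ l) :
    Commute (phaseFlip (x k) (y k)) (x l) :=
  ((h.comm_xy l k hkl.symm).symm.mul_left (h.comm_xx k l hkl)).smul_left _

theorem commute_flip_y (h : PauliRelations x y z j) {k l : Fin n} (hkl : k ≠ l) :
    Commute (phaseFlip (x k) (y k)) (y l) :=
  ((h.comm_yy k l hkl).mul_left (h.comm_xy k l hkl)).smul_left _

theorem commute_flip_flip (h : PauliRelations x y z j) {k l : Fin n} (hkl : k ≠ l) :
    Commute (phaseFlip (x k) (y k)) (phaseFlip (x l) (y l)) :=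
  ((h.commute_flip_y hkl).mul_right (h.commute_flip_x hkl)).smul_right _

end PauliRelations

theorem commute_halfPlus {a w : E} (h : Commute a w) : Commute a (halfPlus w) :=
  ((Commute.one_right a).add_right h).smul_right _

theorem commute_kraus {a x w : E} (hx : Commute a x) (hw : Commute a w) (c : Fin 2) :
    Commute a (kraus x w c) := by
  unfold kraus; split_ifs
  · exact commute_halfPlus hw
  · exact hx.mul_right (commute_halfPlus hw.neg_right)

theorem commute_krausMirror {a x w : E} (hx : Commute a x) (hw : Commute a w) (c : Fin 2) :
    Commute a (krausMirror x w c) := by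
  unfold krausMirror; split_ifs
  · exact commute_halfPlus hw
  · exact (commute_halfPlus hw.neg_right).mul_right hx

theorem commute_fiveObs {a x y z : E} (hx : Commute a x) (hy : Commute a y) (hz : Commute a z)
    (q : Fin 5) : Commute a (fiveObs x y z q) := by
  fin_cases q
  · exact hx
  · exact hy
  · exact hz
  · exact (hx.add_right hy).smul_right _
  · exact (hx.sub_right hy).smul_right _

theorem bitSign_mul_self (c : Fin 2) : bitSign c * bitSign c = 1 := by
  unfold bitSign; split_ifs <;> simp

theorem branch_mul_branch {j : E} (hj : j * j = 1) (c d : Fin 2) :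
    branch j c * branch j d = if c = d then branch j c else 0 := by
  have hs : ∀ c, (bitSign c • j) * (bitSign c • j) = 1 := fun c => by
    rw [smul_mul_smul_comm, bitSign_mul_self, hj, one_smul]
  split_ifs with h
  · subst h; exact halfPlus_mul_self (hs c)
  · have : bitSign d • j = -(bitSign c • j) := by
      revert h; fin_cases c <;> fin_cases d <;> simp [bitSign]
    rw [branch, branch, this]
    exact halfPlus_mul_neg (hs c)

theorem branch_mul_self {j : E} (hj : j * j = 1) (c : Fin 2) :
    branch j c * j = bitSign c • branch j c := by
  rw [branch, halfPlus, smul_mul_assoc, add_mul, one_mul, smul_mul_assoc, hj, smul_comm (bitSign c),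
    smul_add (bitSign c), smul_smul (bitSign c), bitSign_mul_self, one_smul, add_comm]

/-- The product of the Kraus operators selected by `s`, later qubits acting later. -/
noncomputable def krausWord {n : ℕ} (x w : Fin n → E) (s : Fin n → Fin 2) : E :=
  (List.ofFn fun k => kraus (x k) (w k) (s k)).reverse.prod

/-- The factors of `krausWord` in the opposite order. -/
noncomputable def krausMirrorWord {n : ℕ} (x w : Fin n → E) (s : Fin n → Fin 2) : E :=
  (List.ofFn fun k => krausMirror (x k) (w k) (s k)).prod

/-- The projection on the joint `+1` eigenspace of the phase flips. -/
noncomputable def halfPlusWord {n : ℕ} (w : Fin n → E) : E :=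
  (List.ofFn fun k => halfPlus (w k)).prod

/-- The coefficients of the operator with matrix `M` on qubit `k`, applied to one half of a maximally
entangled state of qubit registers, with a sign `e c` that depends on the branch. -/
noncomputable def swapCoeff {n : ℕ} (k : Fin n) (M : Matrix (Fin 2) (Fin 2) ℂ) (e : Fin 2 → ℂ)
    (s t : Fin n → Fin 2) (c d : Fin 2) : ℂ :=
  if c = d then e c * ∏ i, (if i = k then M else 1) (t i) (s i) else 0

namespace PauliRelations

/-- In branch `c` the observable `a` may be replaced by `e c • g`, where `g` is local to qubit `k`.
The branch projections commute with `g` and with the mirrored word, so they meet and force `c = d`;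
what is left is one local identity per qubit. -/
theorem swap_coefficient_aux {n : ℕ} {x y z : Fin n → E} {j : E}
    (h : PauliRelations x y z j) (k : Fin n) (a g : E) (M : Matrix (Fin 2) (Fin 2) ℂ)
    (e : Fin 2 → ℂ) (ha : ∀ c, branch j c * a = e c • (branch j c * g)) (hjg : Commute j g)
    (hloc : ∀ s t, kraus (x k) (phaseFlip (x k) (y k)) s * g *
      krausMirror (x k) (phaseFlip (x k) (y k)) t = M t s • halfPlus (phaseFlip (x k) (y k)))
    (hg : ∀ i, i ≠ k → Commute (x i) g ∧ Commute (phaseFlip (x i) (y i)) g)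
    (s t : Fin n → Fin 2) (c d : Fin 2) :
    krausWord x (fun i => phaseFlip (x i) (y i)) s * branch j c * a *
        (branch j d * krausMirrorWord x (fun i => phaseFlip (x i) (y i)) t) =
      swapCoeff k M e s t c d •
        (halfPlusWord (fun i => phaseFlip (x i) (y i)) * branch j c) := by
  have : NeZero n := ⟨fun h0 => by subst h0; exact k.elim0⟩
  have hj := h.branch_sq
  have hjL : ∀ {a : E} (c : Fin 2), Commute j a → Commute (branch j c) a := fun c ha =>
    (commute_halfPlus (ha.symm.smul_right _)).symm
  have hgL := hjL d hjg
  have hgL' := hjL c hjg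
  set V := krausMirrorWord x (fun i => phaseFlip (x i) (y i)) t with hV
  set U := krausWord x (fun i => phaseFlip (x i) (y i)) s with hU
  have hLV : Commute (branch j c) V := commute_ofFn_prod fun i =>
    commute_krausMirror (hjL c (h.commute_x i)) (hjL c (h.commute_flip i)) _
  -- `g` is absorbed into the factor of `V` at `k`; then the words collapse pair by pair from the
  -- middle, each qubit contributing one matrix entry.
  have hUgV : U * (g * V) = (∏ i, (if i = k then M else 1) (t i) (s i)) •
      halfPlusWord (fun i => phaseFlip (x i) (y i)) := by
    rw [hV, krausMirrorWord, mul_ofFn_prod g _ k]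
    · refine ofFn_reverse_prod_mul_ofFn_prod _ _ _ _ ?_ ?_
      · intro i
        by_cases hik : i = k
        · subst hik
          rw [if_pos rfl, if_pos rfl, ← mul_assoc]
          exact hloc _ _
        · rw [if_neg hik, if_neg hik, one_mul]
          exact kraus_mul_krausMirror (h.x_sq i) (h.flip_sq i) (h.flip_mul_x i) _ _
      · intro i l hil
        exact (commute_kraus (commute_halfPlus (h.commute_flip_x hil.ne).symm).symm
          (commute_halfPlus (h.commute_flip_flip hil.ne).symm).symm _)
    · exact fun i hi => commute_krausMirror (hg i hi).1.symm (hg i hi).2.symm _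
  rw [mul_assoc U, ha, mul_smul_comm, smul_mul_assoc, mul_assoc U, mul_assoc (branch j c),
    ← mul_assoc g, ← hgL.eq, mul_assoc (branch j d), ← mul_assoc (branch j c), branch_mul_branch hj,
    swapCoeff]
  split_ifs with hcd
  · rw [← mul_assoc (branch j c), hgL'.eq, mul_assoc g, hLV.eq, ← mul_assoc g, ← mul_assoc U, hUgV,
      smul_mul_assoc, smul_smul]
  · rw [zero_mul, mul_zero, smul_zero, zero_smul]

theorem swap_coefficient_one {n : ℕ} {x y z : Fin n → E} {j : E}
    (h : PauliRelations x y z j) (k : Fin n) (s t : Fin n → Fin 2) (c d : Fin 2) :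
    krausWord x (fun i => phaseFlip (x i) (y i)) s * branch j c *
        (branch j d * krausMirrorWord x (fun i => phaseFlip (x i) (y i)) t) =
      swapCoeff k 1 (fun _ => 1) s t c d •
        (halfPlusWord (fun i => phaseFlip (x i) (y i)) * branch j c) := by
  rw [← mul_one (krausWord x _ s * branch j c)]
  refine h.swap_coefficient_aux k 1 1 1 (fun _ => 1) (fun c => (one_smul _ _).symm)
    (Commute.one_right _) (fun s t => ?_)
    (fun i _ => ⟨Commute.one_right _, Commute.one_right _⟩) s t c d
  rw [mul_one]
  exact kraus_mul_krausMirror (h.x_sq k) (h.flip_sq k) (h.flip_mul_x k) s t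

theorem swap_coefficient {n : ℕ} {x y z : Fin n → E} {j : E}
    (h : PauliRelations x y z j) (k : Fin n) (q : Fin 5) (s t : Fin n → Fin 2) (c d : Fin 2) :
    krausWord x (fun i => phaseFlip (x i) (y i)) s * branch j c * fiveObs (x k) (y k) (z k) q *
        (branch j d * krausMirrorWord x (fun i => phaseFlip (x i) (y i)) t) =
      swapCoeff k (pauli q) (kickbackSign q) s t c d •
        (halfPlusWord (fun i => phaseFlip (x i) (y i)) * branch j c) := by
  have : NeZero n := ⟨fun h0 => by subst h0; exact k.elim0⟩
  refine h.swap_coefficient_aux k _ (fiveObs (x k) (y k) (phaseFlip (x k) (y k)) q) _ _ ?_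
    (commute_fiveObs (h.commute_x k) (h.commute_y k) (h.commute_flip k) q)
    (kraus_mul_fiveObs_mul_krausMirror (h.x_sq k) (h.flip_sq k) (h.flip_mul_x k) (h.y_eq k) q)
    (fun i hi => ⟨commute_fiveObs (h.comm_xx i k hi) (h.comm_xy i k hi)
      (h.commute_flip_x hi.symm).symm q, commute_fiveObs (h.commute_flip_x hi)
      (h.commute_flip_y hi) (h.commute_flip_flip hi) q⟩) s t c d
  -- Only the third observable sees the branch: z = j w, and `j` acts as a sign on `branch j c`.
  intro c
  by_cases hq : q = 2
  · subst hq
    change branch j c * z k = bitSign c • (branch j c * phaseFlip (x k) (y k))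
    rw [h.z_eq k, ← mul_assoc, branch_mul_self h.branch_sq, smul_mul_assoc]
  · rw [kickbackSign, if_neg hq, one_smul]
    fin_cases q <;> first | rfl | exact absurd rfl hq

end PauliRelations

end SwapAlgebra

/-! ### The swap map as an isometry of Hilbert spaces. -/

section SwapIsometry

variable {H : Type*} [NormedAddCommGroup H] [InnerProductSpace ℂ H]

theorem halfPlus_apply (w : H →L[ℂ] H) (v : H) : halfPlus w v = (1 / 2 : ℂ) • (v + w v) := by
  simp [halfPlus]

/-- By the parallelogram law, preservation of norms suffices; `w` need be neither self-adjoint nor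
an involution. The swap map is therefore an exact isometry even though Bob's operators satisfy the
Pauli relations only approximately. -/
theorem norm_sq_halfPlus_add {w : H →L[ℂ] H} (hw : ∀ v, ‖w v‖ = ‖v‖) (v : H) :
    ‖halfPlus w v‖ ^ 2 + ‖halfPlus (-w) v‖ ^ 2 = ‖v‖ ^ 2 := by
  have := parallelogram_law_with_norm ℂ v (w v)
  rw [hw v] at this
  simp only [halfPlus_apply, neg_apply, ← sub_eq_add_neg, norm_smul, mul_pow]
  norm_num
  nlinarith

theorem sum_norm_sq_kraus {x w : H →L[ℂ] H} (hx : ∀ v, ‖x v‖ = ‖v‖) (hw : ∀ v, ‖w v‖ = ‖v‖)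
    (v : H) : ∑ c, ‖kraus x w c v‖ ^ 2 = ‖v‖ ^ 2 := by
  rw [Fin.sum_univ_two, ← norm_sq_halfPlus_add hw v]
  simp [kraus, hx]

theorem sum_norm_sq_branch {j : H →L[ℂ] H} (hj : ∀ v, ‖j v‖ = ‖v‖) (v : H) :
    ∑ c, ‖branch j c v‖ ^ 2 = ‖v‖ ^ 2 := by
  rw [Fin.sum_univ_two, ← norm_sq_halfPlus_add hj v]
  simp [branch, bitSign]

theorem sum_norm_sq_krausWord {n : ℕ} {x w : Fin n → H →L[ℂ] H} (hx : ∀ k v, ‖x k v‖ = ‖v‖)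
    (hw : ∀ k v, ‖w k v‖ = ‖v‖) (v : H) :
    ∑ s : Fin n → Fin 2, ‖krausWord x w s v‖ ^ 2 = ‖v‖ ^ 2 := by
  induction n generalizing v with
  | zero => simp [krausWord]
  | succ n ih =>
    rw [← (Fin.consEquiv fun _ => Fin 2).sum_comp, Fintype.sum_prod_type,
      ← sum_norm_sq_kraus (hx 0) (hw 0) v]
    refine Finset.sum_congr rfl fun c _ => ?_
    rw [← ih (fun k => hx k.succ) (fun k => hw k.succ) (kraus (x 0) (w 0) c v)]
    refine Finset.sum_congr rfl fun s _ => ?_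
    rw [krausWord, ofFn_reverse_prod_succ, krausWord]
    rfl

theorem norm_sq_sum_of_orthogonal {ι : Type*} [Fintype ι] (f : ι → H)
    (hf : ∀ p p', p ≠ p' → inner ℂ (f p) (f p') = 0) : ‖∑ p, f p‖ ^ 2 = ∑ p, ‖f p‖ ^ 2 := by
  have h : inner ℂ (∑ p, f p) (∑ p, f p) = ∑ p, inner ℂ (f p) (f p) := by
    rw [sum_inner]
    refine Finset.sum_congr rfl fun p _ => ?_
    rw [inner_sum, Finset.sum_eq_single p (fun p' _ hp => hf p p' hp.symm) (by simp)]
  simp only [inner_self_eq_norm_sq_to_K] at h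
  exact_mod_cast h

/-- The linear map underlying the swap isometry. -/
noncomputable def swapMap {n : ℕ} (x w : Fin n → H →L[ℂ] H) (j : H →L[ℂ] H) :
    H →L[ℂ] LocalOut H n :=
  ∑ p : (Fin n → Fin 2) × Fin 2, (TensorProduct.mkL ℂ (H ⊗[ℂ] Qubits n) (Qubits n)).flip (ket p.1) ∘L
    (TensorProduct.mkL ℂ H (Qubits n)).flip (ketRep n p.2) ∘L (krausWord x w p.1 * branch j p.2)

theorem norm_swapMap {n : ℕ} (hn : 1 ≤ n) {x w : Fin n → H →L[ℂ] H} {j : H →L[ℂ] H}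
    (hx : ∀ k v, ‖x k v‖ = ‖v‖) (hw : ∀ k v, ‖w k v‖ = ‖v‖) (hj : ∀ v, ‖j v‖ = ‖v‖) (v : H) :
    ‖swapMap x w j v‖ = ‖v‖ := by
  have h3 : ‖swapMap x w j v‖ ^ 2 = ∑ p : (Fin n → Fin 2) × Fin 2,
      ‖krausWord x w p.1 (branch j p.2 v)‖ ^ 2 := by
    rw [swapMap, sum_apply]
    refine (norm_sq_sum_of_orthogonal (H := LocalOut H n) (ι := (Fin n → Fin 2) × Fin 2) (fun p =>
      ((TensorProduct.mkL ℂ (H ⊗[ℂ] Qubits n) (Qubits n)).flip (ket p.1) ∘L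
        (TensorProduct.mkL ℂ H (Qubits n)).flip (ketRep n p.2) ∘L
          (krausWord x w p.1 * branch j p.2)) v) ?_).trans ?_
    rotate_left
    · refine Finset.sum_congr rfl fun p _ => ?_
      change ‖(krausWord x w p.1 (branch j p.2 v) ⊗ₜ[ℂ] ketRep n p.2) ⊗ₜ[ℂ] ket p.1‖ ^ 2 = _
      rw [TensorProduct.norm_tmul, TensorProduct.norm_tmul, norm_ket, norm_ketRep, mul_one, mul_one]
    · intro p p' hp
      change inner ℂ ((krausWord x w p.1 (branch j p.2 v) ⊗ₜ[ℂ] ketRep n p.2) ⊗ₜ[ℂ] ket p.1)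
        ((krausWord x w p'.1 (branch j p'.2 v) ⊗ₜ[ℂ] ketRep n p'.2) ⊗ₜ[ℂ] ket p'.1) = 0
      rw [TensorProduct.inner_tmul, TensorProduct.inner_tmul, inner_ket, inner_ketRep hn]
      by_cases h : p.1 = p'.1
      · rw [if_neg (c := p.2 = p'.2) fun h' => hp (Prod.ext h h'), mul_zero, zero_mul]
      · rw [if_neg h, mul_zero]
  rw [Fintype.sum_prod_type_right] at h3
  simp only [sum_norm_sq_krausWord hx hw, sum_norm_sq_branch hj] at h3
  exact (sq_eq_sq₀ (norm_nonneg _) (norm_nonneg _)).1 h3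

/-- The swap isometry: it measures `j` coherently into the register `H''` and then swaps the qubits
with bit flips `x k` and phase flips `w k` into the register `H'`. -/
noncomputable def swapIsometry {n : ℕ} (hn : 1 ≤ n) (x w : Fin n → H →L[ℂ] H) (j : H →L[ℂ] H)
    (hx : ∀ k v, ‖x k v‖ = ‖v‖) (hw : ∀ k v, ‖w k v‖ = ‖v‖) (hj : ∀ v, ‖j v‖ = ‖v‖) :
    H →ₗᵢ[ℂ] LocalOut H n where
  toLinearMap := (swapMap x w j).toLinearMap
  norm_map' := norm_swapMap hn hx hw hj

end SwapIsometry

/-! ### Output of the local isometries, component by component. -/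

section SwapOutput

variable {A B : Type*} [NormedAddCommGroup A] [InnerProductSpace ℂ A]
  [NormedAddCommGroup B] [InnerProductSpace ℂ B] {n : ℕ}

theorem opTensor_swapMap (x w : Fin n → A →L[ℂ] A) (j : A →L[ℂ] A) (x' w' : Fin n → B →L[ℂ] B)
    (j' : B →L[ℂ] B) (v : HilbertTensor A B) :
    opTensor (swapMap x w j) (swapMap x' w' j') v =
      ∑ p : (Fin n → Fin 2) × Fin 2, ∑ r : (Fin n → Fin 2) × Fin 2,
        attach (ket p.1) (ket r.1) (attach (ketRep n p.2) (ketRep n r.2)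
          (opTensor (krausWord x w p.1 * branch j p.2) (krausWord x' w' r.1 * branch j' r.2) v)) := by
  simp only [swapMap, opTensor_eq_bilin, map_sum, LinearMap.sum_apply, sum_apply]
  rw [Finset.sum_comm]
  simp only [← opTensor_eq_bilin, attach_opTensor]

/-- The junk state with coefficients `e c` in its two branches. -/
noncomputable def weightedJunk (n : ℕ) (e : Fin 2 → ℂ) (ξ : Fin 2 → HilbertTensor A B) :
    HilbertTensor (A ⊗[ℂ] Qubits n) (B ⊗[ℂ] Qubits n) :=
  ∑ c, e c • attach (ketRep n c) (ketRep n c) (ξ c)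

theorem weightedJunk_one (ξ : Fin 2 → HilbertTensor A B) :
    weightedJunk n (fun _ => 1) ξ = junk n (ξ 0) (ξ 1) := by
  simp only [weightedJunk, Fin.sum_univ_two, one_smul, junk]

theorem weightedJunk_kickbackSign (hn : 1 ≤ n) (q : Fin 5) (ξ : Fin 2 → HilbertTensor A B) :
    weightedJunk n (kickbackSign q) ξ = if q = 2 then
      onBob (ContinuousLinearMap.lTensor B (kickbackZ n)) (junk n (ξ 0) (ξ 1))
      else junk n (ξ 0) (ξ 1) := by
  split_ifs with hq
  · rw [weightedJunk, Fin.sum_univ_two, junk, map_add, onBob_lTensor_attach, onBob_lTensor_attach,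
      kickbackZ_ketRep hn, kickbackZ_ketRep hn]
    have (c : Fin 2) := attach_sum_right {()} (ketRep n c) (fun _ => bitSign c)
      (fun _ => ketRep n c) (ξ c)
    simp only [Finset.sum_singleton] at this
    simp only [kickbackSign, if_pos hq]
    exact (congrArg₂ (· + ·) (this 0) (this 1)).symm
  · simp only [weightedJunk, Fin.sum_univ_two, kickbackSign, if_neg hq, one_smul, junk]

theorem weightedJunk_smul (e : Fin 2 → ℂ) (r : ℂ) (ξ : Fin 2 → HilbertTensor A B) :
    weightedJunk n e (fun c => r • ξ c) = r • weightedJunk n e ξ := by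
  simp only [weightedJunk, map_smul, Finset.smul_sum, smul_comm r]

theorem bellTensor_smul (r : ℂ) (v : HilbertTensor A B) :
    bellTensor n (r • v) = r • bellTensor n v := by
  simp only [bellTensor_eq, map_smul, ← Finset.smul_sum, smul_comm r]

theorem sum_swapCoeff_attach (k : Fin n) (M : Matrix (Fin 2) (Fin 2) ℂ) (e : Fin 2 → ℂ)
    (ξ : Fin 2 → HilbertTensor A B) (s t : Fin n → Fin 2) :
    ∑ c, ∑ d, attach (ketRep n c) (ketRep n d) (swapCoeff k M e s t c d • ξ c) =
      (∏ i, (if i = k then M else 1) (t i) (s i)) • weightedJunk n e ξ := by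
  rw [weightedJunk, Finset.smul_sum]
  refine Finset.sum_congr rfl fun c _ => ?_
  rw [Finset.sum_eq_single c]
  · rw [swapCoeff, if_pos rfl, map_smul, smul_smul, mul_comm]
  · intro d _ hd
    rw [swapCoeff, if_neg hd.symm, zero_smul, map_zero]
  · simp

/-- The factor `√2 ^ n` cancels the normalisation of the `n` Bell pairs, leaving exactly the
coefficients of the Kraus words. -/
theorem onBob_onQubit_bellTensor (k : Fin n) (M : Matrix (Fin 2) (Fin 2) ℂ)
    (v : HilbertTensor A B) :
    onBob (ContinuousLinearMap.lTensor B (onQubit k M)) (bellTensor n (((√2 : ℝ) : ℂ) ^ n • v)) =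
      ∑ s : Fin n → Fin 2, ∑ t : Fin n → Fin 2,
        attach (ket s) (ket t) ((∏ i, (if i = k then M else 1) (t i) (s i)) • v) := by
  have h2 : ((√2 : ℝ) : ℂ) ^ n * ((1 / √2 : ℝ) : ℂ) ^ n = 1 := by
    rw [← mul_pow, ← Complex.ofReal_mul, mul_one_div_cancel (by positivity), Complex.ofReal_one,
      one_pow]
  rw [bellTensor_smul, bellTensor_eq, smul_smul, h2, one_smul]
  simp only [map_smul, map_sum, onBob_lTensor_attach, onQubit_ket, attach_sum_right]

theorem norm_sum_attach_ket_sub_le (f g : (Fin n → Fin 2) → (Fin n → Fin 2) → HilbertTensor A B) :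
    ‖∑ s, ∑ t, attach (ket s) (ket t) (f s t) - ∑ s, ∑ t, attach (ket s) (ket t) (g s t)‖ ≤
      ∑ s, ∑ t, ‖f s t - g s t‖ := by
  simp only [← Finset.sum_sub_distrib, ← map_sub]
  refine (norm_sum_le _ _).trans (Finset.sum_le_sum fun s _ => (norm_sum_le _ _).trans
    (Finset.sum_le_sum fun t _ => le_of_eq ?_))
  rw [norm_attach, norm_ket, norm_ket, one_mul, one_mul]

theorem norm_sum_attach_ketRep_sub_le (f g : Fin 2 → Fin 2 → HilbertTensor A B) :
    ‖∑ c, ∑ d, attach (ketRep n c) (ketRep n d) (f c d) -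
      ∑ c, ∑ d, attach (ketRep n c) (ketRep n d) (g c d)‖ ≤ ∑ c, ∑ d, ‖f c d - g c d‖ := by
  simp only [← Finset.sum_sub_distrib, ← map_sub]
  refine (norm_sum_le _ _).trans (Finset.sum_le_sum fun s _ => (norm_sum_le _ _).trans
    (Finset.sum_le_sum fun t _ => le_of_eq ?_))
  rw [norm_attach, norm_ketRep, norm_ketRep, one_mul, one_mul]

theorem opTensor_swapMap_eq (x w : Fin n → A →L[ℂ] A) (j : A →L[ℂ] A)
    (x' w' : Fin n → B →L[ℂ] B) (j' : B →L[ℂ] B) (v : HilbertTensor A B) :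
    opTensor (swapMap x w j) (swapMap x' w' j') v =
      ∑ s : Fin n → Fin 2, ∑ t : Fin n → Fin 2, attach (ket s) (ket t)
        (∑ c, ∑ d, attach (ketRep n c) (ketRep n d)
          (opTensor (krausWord x w s * branch j c) (krausWord x' w' t * branch j' d) v)) := by
  rw [opTensor_swapMap, Fintype.sum_prod_type]
  refine Finset.sum_congr rfl fun s _ => ?_
  simp only [Fintype.sum_prod_type, map_sum]
  exact Finset.sum_comm

theorem onBob_onQubit_bellTensor_weightedJunk (k : Fin n) (M : Matrix (Fin 2) (Fin 2) ℂ)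
    (e : Fin 2 → ℂ) (ξ : Fin 2 → HilbertTensor A B) :
    onBob (ContinuousLinearMap.lTensor (B ⊗[ℂ] Qubits n) (onQubit k M))
        (bellTensor n (weightedJunk n e fun c => ((√2 : ℝ) : ℂ) ^ n • ξ c)) =
      ∑ s : Fin n → Fin 2, ∑ t : Fin n → Fin 2, attach (ket s) (ket t)
        (∑ c, ∑ d, attach (ketRep n c) (ketRep n d) (swapCoeff k M e s t c d • ξ c)) := by
  rw [weightedJunk_smul, onBob_onQubit_bellTensor]
  simp only [sum_swapCoeff_attach]

theorem norm_swap_sub_le (k : Fin n) (M : Matrix (Fin 2) (Fin 2) ℂ) (e : Fin 2 → ℂ)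
    (ξ : Fin 2 → HilbertTensor A B) (x w : Fin n → A →L[ℂ] A) (j : A →L[ℂ] A)
    (x' w' : Fin n → B →L[ℂ] B) (j' : B →L[ℂ] B) (v : HilbertTensor A B) :
    ‖opTensor (swapMap x w j) (swapMap x' w' j') v -
        onBob (ContinuousLinearMap.lTensor (B ⊗[ℂ] Qubits n) (onQubit k M))
          (bellTensor n (weightedJunk n e fun c => ((√2 : ℝ) : ℂ) ^ n • ξ c))‖ ≤
      ∑ s, ∑ t, ∑ c, ∑ d,
        ‖opTensor (krausWord x w s * branch j c) (krausWord x' w' t * branch j' d) v -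
          swapCoeff k M e s t c d • ξ c‖ := by
  rw [opTensor_swapMap_eq, onBob_onQubit_bellTensor_weightedJunk]
  refine (norm_sum_attach_ket_sub_le _ _).trans ?_
  exact Finset.sum_le_sum fun s _ => Finset.sum_le_sum fun t _ => norm_sum_attach_ketRep_sub_le _ _

/-- This makes the claim about the state the case `M = 1` of the claim about observables. -/
theorem onQubit_one (k : Fin n) : onQubit k (1 : Matrix (Fin 2) (Fin 2) ℂ) = 1 := by
  rw [onQubit, ← map_one (Matrix.toEuclideanCLM (𝕜 := ℂ) (n := Fin n → Fin 2))]
  congr 1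
  ext s t
  by_cases h : s = t
  · subst h; simp
  · rw [Matrix.one_apply_ne h, Matrix.of_apply]
    split_ifs with h'
    · refine Matrix.one_apply_ne fun hk => h (funext fun i => ?_)
      by_cases hik : i = k
      · rw [hik, hk]
      · exact h' i hik
    · rfl

theorem onBob_onQubit_one (k : Fin n) (v : HilbertTensor A (B ⊗[ℂ] Qubits n)) :
    onBob (ContinuousLinearMap.lTensor B (onQubit k 1)) v = v := by
  rw [onQubit_one, ContinuousLinearMap.lTensor_one]
  exact opTensor_id_id _

end SwapOutput

/-! ### Operators of one party. -/

section OneSided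

variable {A B : Type*} [NormedAddCommGroup A] [InnerProductSpace ℂ A]
  [NormedAddCommGroup B] [InnerProductSpace ℂ B]

theorem onAlice_mul (S T : A →L[ℂ] A) (v : HilbertTensor A B) :
    onAlice (S * T) v = onAlice S (onAlice T v) :=
  (opTensor_comp_apply S (ContinuousLinearMap.id ℂ B) T (ContinuousLinearMap.id ℂ B) v).symm

theorem onBob_mul (S T : B →L[ℂ] B) (v : HilbertTensor A B) :
    onBob (S * T) v = onBob S (onBob T v) :=
  (opTensor_comp_apply (ContinuousLinearMap.id ℂ A) S (ContinuousLinearMap.id ℂ A) T v).symm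

theorem onAlice_onBob (S : A →L[ℂ] A) (T : B →L[ℂ] B) (v : HilbertTensor A B) :
    onAlice S (onBob T v) = opTensor S T v :=
  opTensor_comp_apply _ _ _ _ v

theorem onBob_onAlice (S : A →L[ℂ] A) (T : B →L[ℂ] B) (v : HilbertTensor A B) :
    onBob T (onAlice S v) = opTensor S T v :=
  opTensor_comp_apply _ _ _ _ v

theorem onAlice_one (v : HilbertTensor A B) : onAlice (1 : A →L[ℂ] A) v = v := opTensor_id_id v

theorem onBob_one (v : HilbertTensor A B) : onBob (1 : B →L[ℂ] B) v = v := opTensor_id_id v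

theorem onAlice_add (S T : A →L[ℂ] A) (v : HilbertTensor A B) :
    onAlice (S + T) v = onAlice S v + onAlice T v := by
  simp only [onAlice, opTensor_eq_bilin, map_add, LinearMap.add_apply, add_apply]

theorem onBob_add (S T : B →L[ℂ] B) (v : HilbertTensor A B) :
    onBob (S + T) v = onBob S v + onBob T v := by
  simp only [onBob, opTensor_eq_bilin, map_add, add_apply]

theorem onAlice_smul (r : ℂ) (S : A →L[ℂ] A) (v : HilbertTensor A B) :
    onAlice (r • S) v = r • onAlice S v := by
  simp only [onAlice, opTensor_eq_bilin, map_smul, LinearMap.smul_apply, smul_apply]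

theorem onBob_smul (r : ℂ) (S : B →L[ℂ] B) (v : HilbertTensor A B) :
    onBob (r • S) v = r • onBob S v := by
  simp only [onBob, opTensor_eq_bilin, map_smul, smul_apply]

theorem onAlice_sub (S T : A →L[ℂ] A) (v : HilbertTensor A B) :
    onAlice (S - T) v = onAlice S v - onAlice T v := by
  simp only [onAlice, opTensor_eq_bilin, map_sub, LinearMap.sub_apply, sub_apply]

theorem onAlice_zero (v : HilbertTensor A B) : onAlice (0 : A →L[ℂ] A) v = 0 := by
  simp only [onAlice, opTensor_eq_bilin, map_zero, LinearMap.zero_apply, zero_apply]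

theorem norm_onAlice_apply_le (S : A →L[ℂ] A) (v : HilbertTensor A B) :
    ‖onAlice S v‖ ≤ ‖S‖ * ‖v‖ := by
  refine (norm_opTensor_apply_le S _ v).trans ?_
  refine mul_le_mul_of_nonneg_right ?_ (norm_nonneg v)
  exact mul_le_of_le_one_right (norm_nonneg S) ContinuousLinearMap.norm_id_le

theorem norm_onBob_apply_le (S : B →L[ℂ] B) (v : HilbertTensor A B) :
    ‖onBob S v‖ ≤ ‖S‖ * ‖v‖ := by
  refine (norm_opTensor_apply_le _ S v).trans ?_
  refine mul_le_mul_of_nonneg_right ?_ (norm_nonneg v)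
  exact mul_le_of_le_one_left (norm_nonneg S) ContinuousLinearMap.norm_id_le

end OneSided

/-! ### Uniform errors over a family, and the mirror algebra. -/

section Families

variable {ι : Type*}

/-- A family that is bounded in norm. -/
def IsBoundedFamily {F : ι → Type*} [∀ i, NormedAddCommGroup (F i)] (T : ∀ i, F i) : Prop :=
  ∃ C : ℝ, ∀ i, ‖T i‖ ≤ C

/-- A family of vectors whose norm is bounded by a constant multiple of `ρ`. -/
def IsSmall {F : ι → Type*} [∀ i, NormedAddCommGroup (F i)] (ρ : ι → ℝ) (u : ∀ i, F i) : Prop :=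
  ∃ C : ℝ, ∀ i, ‖u i‖ ≤ C * ρ i

section Norm

variable {F : ι → Type*} [∀ i, NormedAddCommGroup (F i)] {ρ : ι → ℝ}

theorem IsSmall.congr {u v : ∀ i, F i} (hu : IsSmall ρ u) (h : ∀ i, v i = u i) : IsSmall ρ v :=
  (funext h : v = u) ▸ hu

theorem IsSmall.zero : IsSmall ρ (fun i => (0 : F i)) := ⟨0, fun i => by simp⟩

theorem IsSmall.add {u v : ∀ i, F i} (hu : IsSmall ρ u) (hv : IsSmall ρ v) :
    IsSmall ρ (fun i => u i + v i) := by
  obtain ⟨C, hC⟩ := hu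
  obtain ⟨D, hD⟩ := hv
  exact ⟨C + D, fun i => (norm_add_le _ _).trans (by linarith [hC i, hD i])⟩

theorem IsSmall.neg {u : ∀ i, F i} (hu : IsSmall ρ u) : IsSmall ρ (fun i => -u i) := by
  obtain ⟨C, hC⟩ := hu
  exact ⟨C, fun i => (norm_neg _).trans_le (hC i)⟩

theorem IsSmall.sub {u v : ∀ i, F i} (hu : IsSmall ρ u) (hv : IsSmall ρ v) :
    IsSmall ρ (fun i => u i - v i) := by
  simpa only [sub_eq_add_neg] using hu.add hv.neg

theorem IsSmall.smul [∀ i, NormedSpace ℂ (F i)] {u : ∀ i, F i} (r : ℂ) (hu : IsSmall ρ u) :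
    IsSmall ρ (fun i => r • u i) := by
  obtain ⟨C, hC⟩ := hu
  refine ⟨‖r‖ * C, fun i => ?_⟩
  rw [norm_smul, mul_assoc]
  exact mul_le_mul_of_nonneg_left (hC i) (norm_nonneg r)

theorem IsSmall.of_le {G : ι → Type*} [∀ i, NormedAddCommGroup (G i)] {T : ∀ i, G i}
    {u v : ∀ i, F i} (hT : IsBoundedFamily T) (hu : IsSmall ρ u) (h : ∀ i, ‖v i‖ ≤ ‖T i‖ * ‖u i‖) :
    IsSmall ρ v := by
  obtain ⟨C, hC⟩ := hu
  obtain ⟨D, hD⟩ := hT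
  refine ⟨D * C, fun i => (h i).trans ?_⟩
  have hD0 : 0 ≤ D := (norm_nonneg _).trans (hD i)
  calc ‖T i‖ * ‖u i‖ ≤ D * ‖u i‖ := mul_le_mul_of_nonneg_right (hD i) (norm_nonneg _)
    _ ≤ D * (C * ρ i) := mul_le_mul_of_nonneg_left (hC i) hD0
    _ = D * C * ρ i := (mul_assoc _ _ _).symm

theorem IsBoundedFamily.add {u v : ∀ i, F i} (hu : IsBoundedFamily u) (hv : IsBoundedFamily v) :
    IsBoundedFamily (fun i => u i + v i) := by
  obtain ⟨C, hC⟩ := hu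
  obtain ⟨D, hD⟩ := hv
  exact ⟨C + D, fun i => (norm_add_le _ _).trans (add_le_add (hC i) (hD i))⟩

end Norm

section Mirror

variable {A B : ι → Type*} [∀ i, NormedAddCommGroup (A i)] [∀ i, InnerProductSpace ℂ (A i)]
  [∀ i, NormedAddCommGroup (B i)] [∀ i, InnerProductSpace ℂ (B i)]

theorem IsBoundedFamily.mul {S T : ∀ i, A i →L[ℂ] A i} (hS : IsBoundedFamily S)
    (hT : IsBoundedFamily T) : IsBoundedFamily (fun i => S i * T i) := by
  obtain ⟨C, hC⟩ := hS
  obtain ⟨D, hD⟩ := hT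
  exact ⟨C * D, fun i => (norm_mul_le _ _).trans
    (mul_le_mul (hC i) (hD i) (norm_nonneg _) ((norm_nonneg _).trans (hC i)))⟩

theorem IsBoundedFamily.smul_one (r : ℂ) : IsBoundedFamily (fun i => r • (1 : A i →L[ℂ] A i)) :=
  ⟨‖r‖, fun i => by
    rw [norm_smul]
    exact mul_le_of_le_one_right (norm_nonneg r) ContinuousLinearMap.norm_id_le⟩

theorem IsSmall.onAlice {ρ : ι → ℝ} {u : ∀ i, HilbertTensor (A i) (B i)} {S : ∀ i, A i →L[ℂ] A i}
    (hS : IsBoundedFamily S) (hu : IsSmall ρ u) : IsSmall ρ (fun i => onAlice (S i) (u i)) :=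
  hu.of_le hS fun _ => norm_onAlice_apply_le _ _

theorem IsSmall.onBob {ρ : ι → ℝ} {u : ∀ i, HilbertTensor (A i) (B i)} {S : ∀ i, B i →L[ℂ] B i}
    (hS : IsBoundedFamily S) (hu : IsSmall ρ u) : IsSmall ρ (fun i => onBob (S i) (u i)) :=
  hu.of_le hS fun _ => norm_onBob_apply_le _ _

variable (ψ : ∀ i, HilbertTensor (A i) (B i)) (ρ : ι → ℝ)

/-- Bounded operator families `a` of Alice and `b` of Bob that act on `ψ` in the same way, up to
errors of order `ρ`. -/
structure IsMirrored (a : ∀ i, A i →L[ℂ] A i) (b : ∀ i, B i →L[ℂ] B i) : Prop where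
  bdd_left : IsBoundedFamily a
  bdd_right : IsBoundedFamily b
  small : IsSmall ρ (fun i => onAlice (a i) (ψ i) - onBob (b i) (ψ i))

/-- The algebra of mirrored pairs of operator families. -/
def mirrorAlgebra : Subalgebra ℂ ((∀ i, A i →L[ℂ] A i) × (∀ i, B i →L[ℂ] B i)ᵐᵒᵖ) where
  carrier := {p | IsMirrored ψ ρ p.1 p.2.unop}
  mul_mem' {p q} hp hq := by
    refine ⟨hp.bdd_left.mul hq.bdd_left, hq.bdd_right.mul hp.bdd_right, ?_⟩
    -- a a' ψ ≈ a b' ψ = b' a ψ ≈ b' b ψ: the two sides commute, which reverses Bob's product.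
    refine ((hq.small.onAlice hp.bdd_left).add (hp.small.onBob hq.bdd_right)).congr fun i => ?_
    simp only [Prod.fst_mul, Prod.snd_mul, MulOpposite.unop_mul, Pi.mul_apply, onAlice_mul,
      onBob_mul, map_sub, onAlice_onBob, onBob_onAlice]
    abel
  add_mem' {p q} hp hq := by
    refine ⟨hp.bdd_left.add hq.bdd_left, hp.bdd_right.add hq.bdd_right, ?_⟩
    refine (hp.small.add hq.small).congr fun i => ?_
    simp only [Prod.fst_add, Prod.snd_add, MulOpposite.unop_add, Pi.add_apply, onAlice_add,
      onBob_add]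
    abel
  algebraMap_mem' r := by
    refine ⟨IsBoundedFamily.smul_one r, IsBoundedFamily.smul_one r, ?_⟩
    refine IsSmall.zero.congr fun i => ?_
    have h1 : ((algebraMap ℂ ((∀ i, A i →L[ℂ] A i) × (∀ i, B i →L[ℂ] B i)ᵐᵒᵖ)) r).1 i =
      r • 1 := rfl
    have h2 : ((algebraMap ℂ ((∀ i, A i →L[ℂ] A i) × (∀ i, B i →L[ℂ] B i)ᵐᵒᵖ)) r).2.unop i =
      r • 1 := rfl
    rw [h1, h2, onAlice_smul, onBob_smul, onAlice_one, onBob_one, sub_self]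

/-- The mirrored pairs that annihilate `ψ` up to errors of order `ρ`. -/
def mirrorIdeal : Ideal (mirrorAlgebra ψ ρ) where
  carrier := {p | IsSmall ρ (fun i => onAlice (p.1.1 i) (ψ i))}
  add_mem' hp hq := IsSmall.congr (IsSmall.add hp hq) fun _ => onAlice_add _ _ _
  zero_mem' := IsSmall.zero.congr fun _ => onAlice_zero _
  smul_mem' r _ hp := (IsSmall.onAlice r.2.bdd_left hp).congr fun _ => onAlice_mul _ _ _

/-- For `p` in the ideal, p r ψ is handled by moving `r` to Bob's side: p r ψ ≈ p r' ψ = r' p ψ,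
which is small. A left ideal would not give a ring, and this is why only operators with a partner on
the other side are admitted. -/
instance : (mirrorIdeal ψ ρ).IsTwoSided where
  mul_mem_of_left {p} r hp := by
    have h1 := IsSmall.onBob r.2.bdd_right
      (show IsSmall ρ (fun i => onAlice (p.1.1 i) (ψ i)) from hp)
    have h2 := r.2.small.onAlice p.2.bdd_left
    refine (h2.add h1).congr fun i => ?_
    rw [map_sub, onAlice_onBob, onBob_onAlice, sub_add_cancel]
    exact onAlice_mul _ _ _

/-- The algebra of mirrored pairs, modulo those that annihilate `ψ` up to errors of order `ρ`. -/
def MirrorQuotient : Type _ := mirrorAlgebra ψ ρ ⧸ mirrorIdeal ψ ρ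

noncomputable instance : Ring (MirrorQuotient ψ ρ) :=
  inferInstanceAs (Ring (mirrorAlgebra ψ ρ ⧸ mirrorIdeal ψ ρ))

noncomputable instance : Algebra ℂ (MirrorQuotient ψ ρ) :=
  inferInstanceAs (Algebra ℂ (mirrorAlgebra ψ ρ ⧸ mirrorIdeal ψ ρ))

/-- The quotient map. -/
noncomputable def mirrorMk : mirrorAlgebra ψ ρ →ₐ[ℂ] MirrorQuotient ψ ρ :=
  Ideal.Quotient.mkₐ ℂ (mirrorIdeal ψ ρ)

variable {ψ ρ}

theorem mirrorMk_eq_iff {p q : mirrorAlgebra ψ ρ} : mirrorMk ψ ρ p = mirrorMk ψ ρ q ↔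
    IsSmall ρ (fun i => onAlice (p.1.1 i) (ψ i) - onAlice (q.1.1 i) (ψ i)) := by
  have : mirrorMk ψ ρ p = mirrorMk ψ ρ q ↔ p - q ∈ mirrorIdeal ψ ρ :=
    Ideal.Quotient.mk_eq_mk_iff_sub_mem p q
  rw [this]
  simp only [← onAlice_sub]
  rfl

theorem mirrorMk_eq_of_fst {p q : mirrorAlgebra ψ ρ} (h : p.1.1 = q.1.1) :
    mirrorMk ψ ρ p = mirrorMk ψ ρ q := by
  rw [mirrorMk_eq_iff, h]
  simp only [sub_self]
  exact IsSmall.zero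

/-- Both act on the state like their common partner. Together with `mirrorMk_eq_of_fst` this lets
relations valid on either side enter the quotient, and identifies different operators of Alice that
share a partner. -/
theorem mirrorMk_eq_of_snd {p q : mirrorAlgebra ψ ρ} (h : p.1.2 = q.1.2) :
    mirrorMk ψ ρ p = mirrorMk ψ ρ q := by
  rw [mirrorMk_eq_iff]
  refine (p.2.small.sub q.2.small).congr fun i => ?_
  rw [h]
  abel

/-- The element of the mirror algebra given by a mirrored pair. -/
def IsMirrored.elem {a : ∀ i, A i →L[ℂ] A i} {b : ∀ i, B i →L[ℂ] B i} (h : IsMirrored ψ ρ a b) :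
    mirrorAlgebra ψ ρ :=
  ⟨(a, MulOpposite.op b), h⟩

/-- Alice's operator in a mirrored pair. -/
def aliceEval (i : ι) : mirrorAlgebra ψ ρ →ₐ[ℂ] (A i →L[ℂ] A i) :=
  ((Pi.evalAlgHom ℂ _ i).comp (AlgHom.fst ℂ _ _)).comp (mirrorAlgebra ψ ρ).val

/-- Bob's operator in a mirrored pair. -/
def bobEval (i : ι) : mirrorAlgebra ψ ρ →ₐ[ℂ] (B i →L[ℂ] B i)ᵐᵒᵖ :=
  ((AlgHom.op (Pi.evalAlgHom ℂ _ i)).comp (AlgHom.snd ℂ _ _)).comp (mirrorAlgebra ψ ρ).val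

/-- The way back from the quotient to estimates: the rightmost factor `v` acts first on the state,
so it can be traded for its partner on Bob's side, and likewise `p`. -/
theorem isSmall_of_mirrorMk_eq {u a v p : mirrorAlgebra ψ ρ} {κ : ℂ}
    (h : mirrorMk ψ ρ (u * a * v) = κ • mirrorMk ψ ρ p) :
    IsSmall ρ (fun i => opTensor (aliceEval i u) (bobEval i v).unop
      (onAlice (aliceEval i a) (ψ i)) - κ • onBob (bobEval i p).unop (ψ i)) := by
  have h := h.trans (map_smul (mirrorMk ψ ρ).toLinearMap κ p).symm
  rw [AlgHom.toLinearMap_apply, mirrorMk_eq_iff] at h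
  have h1 := (p.2.small.smul κ)
  have h2 := v.2.small.onAlice (u * a).2.bdd_left
  refine ((h.add h1).sub h2).congr fun i => ?_
  have e1 : onAlice ((u * a * v).1.1 i) (ψ i) = onAlice ((u * a).1.1 i) (onAlice (v.1.1 i) (ψ i)) :=
    onAlice_mul _ _ _
  have e2 : onAlice ((κ • p).1.1 i) (ψ i) = κ • onAlice (p.1.1 i) (ψ i) := onAlice_smul _ _ _
  have e3 : opTensor (aliceEval i u) (bobEval i v).unop (onAlice (aliceEval i a) (ψ i)) =
      onAlice ((u * a).1.1 i) (onBob (v.1.2.unop i) (ψ i)) := by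
    rw [← onAlice_onBob, onBob_onAlice, ← onAlice_onBob, ← onAlice_mul]
    rfl
  rw [e1, e2, e3, map_sub, smul_sub]
  change _ - κ • onBob (p.1.2.unop i) (ψ i) = _
  abel

end Mirror

end Families

/-! ### Transport of the gadget along homomorphisms. -/

section Homs

variable {E E' : Type*} [Ring E] [Algebra ℂ E] [Ring E'] [Algebra ℂ E'] (f : E →ₐ[ℂ] E')

theorem map_halfPlus (w : E) : f (halfPlus w) = halfPlus (f w) := by
  simp only [halfPlus, map_smul, map_add, map_one]

theorem map_branch (j : E) (c : Fin 2) : f (branch j c) = branch (f j) c := by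
  simp only [branch, map_halfPlus, map_smul]

theorem map_kraus (x w : E) (c : Fin 2) : f (kraus x w c) = kraus (f x) (f w) c := by
  unfold kraus; split_ifs <;> simp only [map_halfPlus, map_mul, map_neg]

theorem map_krausMirror (x w : E) (c : Fin 2) :
    f (krausMirror x w c) = krausMirror (f x) (f w) c := by
  unfold krausMirror; split_ifs <;> simp only [map_halfPlus, map_mul, map_neg]

theorem map_krausWord {n : ℕ} (x w : Fin n → E) (s : Fin n → Fin 2) :
    f (krausWord x w s) = krausWord (fun k => f (x k)) (fun k => f (w k)) s := by
  rw [krausWord, map_list_prod, List.map_reverse, List.map_ofFn]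
  simp only [Function.comp_def, map_kraus, krausWord]

theorem map_krausMirrorWord {n : ℕ} (x w : Fin n → E) (s : Fin n → Fin 2) :
    f (krausMirrorWord x w s) = krausMirrorWord (fun k => f (x k)) (fun k => f (w k)) s := by
  rw [krausMirrorWord, map_list_prod, List.map_ofFn]
  simp only [Function.comp_def, map_krausMirror, krausMirrorWord]

theorem map_halfPlusWord {n : ℕ} (w : Fin n → E) :
    f (halfPlusWord w) = halfPlusWord (fun k => f (w k)) := by
  rw [halfPlusWord, map_list_prod, List.map_ofFn]
  simp only [Function.comp_def, map_halfPlus, halfPlusWord]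

theorem unop_branch (j : Eᵐᵒᵖ) (c : Fin 2) : (branch j c).unop = branch j.unop c := rfl

/-- Passing to Bob reverses products, and the mirrored words are designed to turn into his genuine
Kraus words. -/
theorem unop_krausMirrorWord {n : ℕ} (x w : Fin n → Eᵐᵒᵖ) (s : Fin n → Fin 2) :
    (krausMirrorWord x w s).unop = krausWord (fun k => (x k).unop) (fun k => (w k).unop) s := by
  rw [krausMirrorWord, MulOpposite.unop_list_prod, List.map_ofFn, krausWord]
  congr 2
  refine congrArg List.ofFn (funext fun k => ?_)
  simp only [Function.comp_def, krausMirror, kraus]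
  split_ifs <;> rfl

end Homs

/-! ### Observables of projective measurements are reflections. -/

section Reflections

variable {H : Type*} [NormedAddCommGroup H] [InnerProductSpace ℂ H]

/-- A self-adjoint involution. -/
structure IsReflection (T : H →L[ℂ] H) : Prop where
  sq : T * T = 1
  symm : ∀ u v, inner ℂ (T u) v = inner ℂ u (T v)

theorem IsReflection.norm_apply {T : H →L[ℂ] H} (hT : IsReflection T) (v : H) : ‖T v‖ = ‖v‖ := by
  have h : inner ℂ (T v) (T v) = inner ℂ v v := by
    rw [hT.symm, ← mul_apply_eq_comp, hT.sq, one_apply_eq_self]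
  simp only [inner_self_eq_norm_sq_to_K] at h
  exact (sq_eq_sq₀ (norm_nonneg _) (norm_nonneg _)).1 (by exact_mod_cast h)

theorem norm_le_one_of_isometric {T : H →L[ℂ] H} (hT : ∀ v, ‖T v‖ = ‖v‖) : ‖T‖ ≤ 1 :=
  ContinuousLinearMap.opNorm_le_bound _ zero_le_one fun v => by rw [hT, one_mul]

/-- The operator `∑ a, f a • P a` of a measurement. -/
noncomputable def measObs {α : Type*} [Fintype α] (P : α → H →L[ℂ] H) (f : α → ℂ) : H →L[ℂ] H :=
  ∑ a, f a • P a

variable [CompleteSpace H] {α : Type*} [Fintype α] {P : α → H →L[ℂ] H}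

theorem measObs_mul (hP : IsProjectiveMeasurement P) (f g : α → ℂ) :
    measObs P f * measObs P g = measObs P fun a => f a * g a := by
  classical
  rw [measObs, measObs, measObs, Finset.sum_mul]
  refine Finset.sum_congr rfl fun a _ => ?_
  rw [Finset.mul_sum, Finset.sum_eq_single a]
  · rw [smul_mul_smul_comm, (hP.isProj a).isIdempotentElem]
  · intro b _ hb
    rw [smul_mul_smul_comm, hP.orthogonal a b hb.symm, smul_zero]
  · simp

theorem measObs_one (hP : IsProjectiveMeasurement P) : (measObs P fun _ => 1) = 1 := by
  simp only [measObs, one_smul, hP.complete]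

theorem isReflection_measObs (hP : IsProjectiveMeasurement P) {f : α → ℂ}
    (hf : ∀ a, f a = 1 ∨ f a = -1) : IsReflection (measObs P f) where
  sq := by
    rw [measObs_mul hP, ← measObs_one hP]
    congr 1
    funext a
    rcases hf a with h | h <;> rw [h] <;> norm_num
  symm u v := by
    rw [measObs, sum_apply, sum_apply, sum_inner, inner_sum]
    refine Finset.sum_congr rfl fun a _ => ?_
    have h : inner ℂ (P a u) v = inner ℂ u (P a v) := by
      rw [← ContinuousLinearMap.adjoint_inner_right, ← ContinuousLinearMap.star_eq_adjoint,
        (hP.isProj a).isSelfAdjoint.star_eq]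
    rw [smul_apply, smul_apply, inner_smul_left, inner_smul_right, h]
    rcases hf a with h | h <;> rw [h] <;> simp

end Reflections

/-! ### Isometric replacement of (D + E)/√2. -/

section Regularisation

variable {H : Type*} [NormedAddCommGroup H] [InnerProductSpace ℂ H] [CompleteSpace H]

/-- Put u = D E, a unitary with (D + E)/√2 = D (1 + u)/√2. The Möbius map u ↦ (u + a)/(1 + a u) with
real a preserves the unit circle, and for a = tan(π/8) = √2 - 1 it agrees with (1 + u)/√2 at u = ±
i, the zeros of u + u⁻¹. So X = D (u + a)(1 + a u)⁻¹ preserves norms and differs from (D + E)/√2 by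
a bounded multiple of D E + E D. -/
theorem exists_regularisation {D E : H →L[ℂ] H} (hD : IsReflection D) (hE : IsReflection E) :
    ∃ X T : H →L[ℂ] H, (∀ v, ‖X v‖ = ‖v‖) ∧ ‖T‖ ≤ 2 ∧
      X = ((1 / √2 : ℝ) : ℂ) • (D + E) + T * (D * E + E * D) := by
  set a : ℝ := √2 - 1 with ha
  have h2 : √2 * √2 = 2 := Real.mul_self_sqrt zero_le_two
  have hs1 : 1 < √2 := by nlinarith [Real.sqrt_nonneg 2]
  have hs2 : √2 ≤ 3 / 2 := by nlinarith [Real.sqrt_nonneg 2]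
  have ha0 : 0 < a := by linarith
  have ha1 : a ≤ 1 / 2 := by linarith
  set u : H →L[ℂ] H := D * E with hu
  set u' : H →L[ℂ] H := E * D with hu'
  have huu' : u * u' = 1 := by rw [hu, hu', mul_assoc, ← mul_assoc E, hE.sq, one_mul, hD.sq]
  have hu'u : u' * u = 1 := by rw [hu, hu', mul_assoc, ← mul_assoc D, hD.sq, one_mul, hE.sq]
  have hnu : ∀ v, ‖u v‖ = ‖v‖ := fun v => (hD.norm_apply _).trans (hE.norm_apply v)
  have hnu1 : ‖u‖ ≤ 1 := norm_le_one_of_isometric hnu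
  have hau : ‖-((a : ℂ) • u)‖ < 1 := by
    rw [norm_neg, norm_smul, Complex.norm_real, Real.norm_of_nonneg ha0.le]
    nlinarith [norm_nonneg u]
  -- 1 + a u is invertible by the Neumann series, and a ≤ 1/2 bounds the inverse by 2.
  set U := Units.oneSub _ hau with hU
  set m : H →L[ℂ] H := 1 + (a : ℂ) • u with hm
  have hUm : (U : H →L[ℂ] H) = m := by rw [hU, Units.val_oneSub, sub_neg_eq_add]
  set R : H →L[ℂ] H := ((U⁻¹ : (H →L[ℂ] H)ˣ) : H →L[ℂ] H) with hR
  have hmR : m * R = 1 := by rw [← hUm, hR, Units.mul_inv]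
  have hRm : R * m = 1 := by rw [← hUm, hR, Units.inv_mul]
  have hRnorm : ‖R‖ ≤ 2 := by
    have h1 : R = 1 - (a : ℂ) • (u * R) := by
      rw [eq_sub_iff_add_eq, ← smul_mul_assoc]
      simpa [hm, add_mul] using hmR
    have h3 : ‖R‖ ≤ 1 + a * ‖R‖ := by
      calc ‖R‖ = ‖1 - (a : ℂ) • (u * R)‖ := by rw [← h1]
        _ ≤ ‖(1 : H →L[ℂ] H)‖ + ‖(a : ℂ) • (u * R)‖ := norm_sub_le _ _
        _ ≤ 1 + a * ‖R‖ := by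
          refine add_le_add ContinuousLinearMap.norm_id_le ?_
          rw [norm_smul, Complex.norm_real, Real.norm_of_nonneg ha0.le]
          refine mul_le_mul_of_nonneg_left ((norm_mul_le _ _).trans ?_) ha0.le
          exact mul_le_of_le_one_left (norm_nonneg R) hnu1
    nlinarith [norm_nonneg R]
  have hum : Commute u m := (Commute.one_right u).add_right ((Commute.refl u).smul_right _)
  have huR : Commute u R := by
    have := hum
    rw [← hUm] at this
    exact this.units_inv_right
  refine ⟨D * ((u + (a : ℂ) • 1) * R), -(((a / √2 : ℝ) : ℂ) • (D * R * u)), ?_, ?_, ?_⟩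
  · intro v
    rw [mul_apply_eq_comp, hD.norm_apply, mul_apply_eq_comp]
    have hv : m (R v) = v := by rw [← mul_apply_eq_comp, hmR, one_apply_eq_self]
    set y := R v with hy
    have e1 : (u + (a : ℂ) • 1) y = u y + (a : ℂ) • y := by simp
    have e2 : m y = y + (a : ℂ) • u y := by simp [hm]
    rw [e1]
    conv_rhs => rw [← hv, e2]
    -- ‖u y + a y‖ = ‖y + a u y‖: `u` preserves norms and, `a` being real, the cross terms have the
    -- same real part.
    have n1 := norm_add_sq (𝕜 := ℂ) (u y) ((a : ℂ) • y)
    have n2 := norm_add_sq (𝕜 := ℂ) y ((a : ℂ) • u y)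
    have : RCLike.re (inner ℂ (u y) ((a : ℂ) • y)) = RCLike.re (inner ℂ y ((a : ℂ) • u y)) := by
      have hs : (inner ℂ (u y) y).re = (inner ℂ y (u y)).re := inner_re_symm (𝕜 := ℂ) _ _
      rw [inner_smul_right, inner_smul_right]
      change ((a : ℂ) * inner ℂ (u y) y).re = ((a : ℂ) * inner ℂ y (u y)).re
      rw [Complex.re_ofReal_mul, Complex.re_ofReal_mul, hs]
    rw [norm_smul, hnu, this] at n1
    rw [norm_smul, hnu] at n2
    exact (sq_eq_sq₀ (norm_nonneg _) (norm_nonneg _)).1 (n1.trans n2.symm)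
  · rw [norm_neg, norm_smul, Complex.norm_real, Real.norm_of_nonneg (by positivity)]
    have hd : ‖D * R * u‖ ≤ 1 * 2 * 1 := by
      refine (norm_mul_le _ _).trans (mul_le_mul ((norm_mul_le _ _).trans ?_) hnu1
        (norm_nonneg _) (by norm_num))
      exact mul_le_mul (norm_le_one_of_isometric hD.norm_apply) hRnorm (norm_nonneg _) zero_le_one
    have hd' : a / √2 ≤ 1 := by rw [div_le_one (by linarith)]; linarith
    have hd'' : 0 ≤ a / √2 := by positivity
    nlinarith [norm_nonneg (D * R * u)]
  · have hDE : D + E = D * (1 + u) := by rw [mul_add, mul_one, hu, ← mul_assoc, hD.sq, one_mul]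
    -- The comparison of the Möbius map with (1 + u)/√2 after multiplication by 1 + a u. The
    -- coefficients match because (1 - a)/√2 = a and (1 + a)/√2 = 1.
    have key : u + (a : ℂ) • (1 : H →L[ℂ] H) = ((1 / √2 : ℝ) : ℂ) • ((1 + u) * m) -
        ((a / √2 : ℝ) : ℂ) • (u * (u + u')) := by
      rw [mul_add u, huu', hm]
      simp only [mul_add, add_mul, mul_one, one_mul, mul_smul_comm]
      have c1 : ((1 / √2 : ℝ) : ℂ) * (1 - a) = a := by
        rw [← Complex.ofReal_one, ← Complex.ofReal_sub, ← Complex.ofReal_mul, Complex.ofReal_inj, ha]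
        field_simp
        nlinarith
      have c2 : ((1 / √2 : ℝ) : ℂ) * (1 + a) = 1 := by
        rw [← Complex.ofReal_one, ← Complex.ofReal_add, ← Complex.ofReal_mul, Complex.ofReal_inj, ha]
        field_simp
        ring
      have c3 : ((a / √2 : ℝ) : ℂ) = ((1 / √2 : ℝ) : ℂ) * a := by
        rw [← Complex.ofReal_mul]; congr 1; ring
      rw [c3]
      calc u + (a : ℂ) • (1 : H →L[ℂ] H) =
          (((1 / √2 : ℝ) : ℂ) * (1 + a)) • u + (((1 / √2 : ℝ) : ℂ) * (1 - a)) • 1 := by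
            rw [c1, c2, one_smul]
        _ = _ := by module
    have hRu : Commute R (u * (u + u')) := by
      have hu'R : Commute u' R := by
        have : R * u' = u' * R := by
          calc R * u' = (u' * u) * R * u' := by rw [hu'u, one_mul]
            _ = u' * (R * u) * u' := by rw [mul_assoc u', huR.eq]
            _ = u' * R := by rw [mul_assoc, mul_assoc R, huu', mul_one]
        exact this.symm
      exact huR.symm.mul_right (huR.symm.add_right hu'R.symm)
    rw [key, sub_mul, mul_sub, smul_mul_assoc, mul_assoc (1 + u), hmR, mul_one, mul_smul_comm, hDE,
      sub_eq_add_neg, smul_mul_assoc, ← hRu.eq, mul_smul_comm, neg_mul, smul_mul_assoc]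
    simp only [mul_assoc]

end Regularisation

/-! ### Sum-of-squares decomposition of the CHSH operator. -/

section SumOfSquares

variable {A B : Type*} [NormedAddCommGroup A] [InnerProductSpace ℂ A]
  [NormedAddCommGroup B] [InnerProductSpace ℂ B]

theorem norm_sq_onAlice_sub_onBob {a : A →L[ℂ] A} (ha : IsReflection a) (T : B →L[ℂ] B)
    (v : HilbertTensor A B) :
    ‖onAlice a v - onBob T v‖ ^ 2 =
      ‖v‖ ^ 2 + ‖onBob T v‖ ^ 2 - 2 * (inner ℂ v (opTensor a T v)).re := by
  have h1 : ∀ u w : HilbertTensor A B, inner ℂ (onAlice a u) w = inner ℂ u (onAlice a w) :=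
    inner_opTensor_of_selfAdjoint a _ ha.symm fun _ _ => rfl
  have h2 : ‖onAlice a v‖ = ‖v‖ := by
    have h : inner ℂ (onAlice a v) (onAlice a v) = inner ℂ v v := by
      rw [h1, ← onAlice_mul, ha.sq, onAlice_one]
    simp only [inner_self_eq_norm_sq_to_K] at h
    exact (sq_eq_sq₀ (norm_nonneg _) (norm_nonneg _)).1 (by exact_mod_cast h)
  rw [norm_sub_sq (𝕜 := ℂ), h1, onAlice_onBob, h2]
  change _ - 2 * (inner ℂ v (opTensor a T v)).re + _ = _
  ring

theorem isReflection_onBob {D : B →L[ℂ] B} (hD : IsReflection D) :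
    IsReflection (onBob D : HilbertTensor A B →L[ℂ] HilbertTensor A B) where
  sq := by
    ext v
    rw [mul_apply_eq_comp, ← onBob_mul, hD.sq, onBob_one, one_apply_eq_self]
  symm := inner_opTensor_of_selfAdjoint _ D (fun _ _ => rfl) hD.symm

/-- `(D + E) / √2` -/
noncomputable def normSum (D E : B →L[ℂ] B) : B →L[ℂ] B := ((1 / √2 : ℝ) : ℂ) • (D + E)

/-- `(D - E) / √2` -/
noncomputable def normDiff (D E : B →L[ℂ] B) : B →L[ℂ] B := ((1 / √2 : ℝ) : ℂ) • (D - E)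

theorem inv_sqrt_two_mul_self : ((1 / √2 : ℝ) : ℂ) * ((1 / √2 : ℝ) : ℂ) = 1 / 2 := by
  rw [← Complex.ofReal_mul, div_mul_div_comm, Real.mul_self_sqrt zero_le_two]
  norm_num

theorem normSum_mul_normSum {D E : B →L[ℂ] B} (hD : IsReflection D) (hE : IsReflection E) :
    D * E + E * D = (2 : ℂ) • (normSum D E * normSum D E) - (2 : ℂ) • 1 := by
  rw [normSum, smul_mul_smul_comm, inv_sqrt_two_mul_self, mul_add, add_mul, add_mul, hD.sq, hE.sq]
  module

theorem normSum_mul_normDiff {D E : B →L[ℂ] B} (hD : IsReflection D) (hE : IsReflection E) :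
    normSum D E * normDiff D E = (1 / 2 : ℂ) • (E * D - D * E) := by
  rw [normSum, normDiff, smul_mul_smul_comm, inv_sqrt_two_mul_self, mul_sub, add_mul, add_mul,
    hD.sq, hE.sq]
  congr 1
  abel

theorem normDiff_mul_normSum {D E : B →L[ℂ] B} (hD : IsReflection D) (hE : IsReflection E) :
    normDiff D E * normSum D E = (1 / 2 : ℂ) • (D * E - E * D) := by
  rw [normSum, normDiff, smul_mul_smul_comm, inv_sqrt_two_mul_self, mul_add, sub_mul, sub_mul,
    hD.sq, hE.sq]
  congr 1
  abel

/-- Exact for any two reflections, with no assumption on the state: the source of all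
anticommutation relations. -/
theorem normDiff_mul_normSum_eq_neg {D E : B →L[ℂ] B} (hD : IsReflection D)
    (hE : IsReflection E) : normDiff D E * normSum D E = -(normSum D E * normDiff D E) := by
  rw [normDiff_mul_normSum hD hE, normSum_mul_normDiff hD hE, ← smul_neg, neg_sub]

theorem norm_sq_normSum_add {D E : B →L[ℂ] B} (hD : IsReflection D) (hE : IsReflection E)
    (v : HilbertTensor A B) :
    ‖onBob (normSum D E) v‖ ^ 2 + ‖onBob (normDiff D E) v‖ ^ 2 = 2 * ‖v‖ ^ 2 := by
  have h := parallelogram_law_with_norm ℂ (onBob D v) (onBob E v)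
  rw [(isReflection_onBob hD).norm_apply, (isReflection_onBob hE).norm_apply] at h
  have h2 : ‖((1 / √2 : ℝ) : ℂ)‖ ^ 2 = 1 / 2 := by
    rw [Complex.norm_real, Real.norm_eq_abs, sq_abs, div_pow, Real.sq_sqrt zero_le_two, one_pow]
  rw [normSum, normDiff, onBob_smul, onBob_smul, norm_smul, norm_smul, mul_pow, mul_pow, h2,
    sub_eq_add_neg D, onBob_add, onBob_add, ← neg_one_smul ℂ E, onBob_smul, neg_one_smul,
    ← sub_eq_add_neg]
  nlinarith

theorem re_inner_opTensor_normSum (a : A →L[ℂ] A) (D E : B →L[ℂ] B) (v : HilbertTensor A B) :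
    (inner ℂ v (opTensor a (normSum D E) v)).re =
      1 / √2 * (inner ℂ v (opTensor a (D + E) v)).re := by
  rw [normSum, opTensor_eq_bilin, map_smul, ← opTensor_eq_bilin, smul_apply, inner_smul_right,
    Complex.re_ofReal_mul]

theorem re_inner_opTensor_normDiff (a : A →L[ℂ] A) (D E : B →L[ℂ] B) (v : HilbertTensor A B) :
    (inner ℂ v (opTensor a (normDiff D E) v)).re =
      1 / √2 * (inner ℂ v (opTensor a (D - E) v)).re := by
  rw [normDiff, opTensor_eq_bilin, map_smul, ← opTensor_eq_bilin, smul_apply, inner_smul_right,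
    Complex.re_ofReal_mul]

/-- Expanding the squares, the terms in D and E alone sum to 2 by the parallelogram law. The gap to
Tsirelson's bound 2√2, times √2, is thus a sum of two squares. -/
theorem chsh_sos {a a' : A →L[ℂ] A} (ha : IsReflection a) (ha' : IsReflection a')
    {D E : B →L[ℂ] B} (hD : IsReflection D) (hE : IsReflection E) {v : HilbertTensor A B}
    (hv : ‖v‖ = 1) :
    ‖onAlice a v - onBob (normSum D E) v‖ ^ 2 + ‖onAlice a' v - onBob (normDiff D E) v‖ ^ 2 =
      4 - √2 * ((inner ℂ v (opTensor a (D + E) v)).re + (inner ℂ v (opTensor a' (D - E) v)).re) := by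
  have h := norm_sq_normSum_add hD hE v
  have h2 : 2 * (1 / √2) = √2 := by
    rw [mul_one_div, Real.div_sqrt]
  rw [norm_sq_onAlice_sub_onBob ha, norm_sq_onAlice_sub_onBob ha', re_inner_opTensor_normSum,
    re_inner_opTensor_normDiff, ← mul_assoc 2, ← mul_assoc 2, h2, hv]
  rw [hv] at h
  linarith

theorem norm_onAlice_sub_onBob_le {a : A →L[ℂ] A} (ha : IsReflection a) {D : B →L[ℂ] B}
    (hD : IsReflection D) {v : HilbertTensor A B} (hv : ‖v‖ = 1) {ε : ℝ}
    (h : 1 - ε ≤ (inner ℂ v (opTensor a D v)).re) :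
    ‖onAlice a v - onBob D v‖ ^ 2 ≤ 2 * ε := by
  rw [norm_sq_onAlice_sub_onBob ha, (isReflection_onBob hD).norm_apply, hv]
  linarith

end SumOfSquares

/-! ### Estimates for a single strategy. -/

namespace Strategy

variable {n : ℕ} {S : Set (Question n)} {A B : Type*}
  [NormedAddCommGroup A] [InnerProductSpace ℂ A] [CompleteSpace A]
  [NormedAddCommGroup B] [InnerProductSpace ℂ B] [CompleteSpace B]
  (st : Strategy n S A B)

theorem _root_.SelfTest.sub_filter_eq_measObs {H : Type*} [NormedAddCommGroup H]
    [InnerProductSpace ℂ H] (P : (Fin n → ℤˣ) → H →L[ℂ] H) (j : Fin n) :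
    (∑ s with s j = 1, P s) - ∑ s with s j = -1, P s =
      measObs P fun s => ((s j : ℤ) : ℂ) := by
  simp only [Finset.sum_filter, measObs, ← Finset.sum_sub_distrib]
  refine Finset.sum_congr rfl fun s _ => ?_
  rcases Int.units_eq_one_or (s j) with h | h <;> simp [h]

theorem aliceObs_eq (x : Question n) (j : Fin n) :
    st.aliceObs x j = measObs (st.alice x) fun s => ((s j : ℤ) : ℂ) :=
  sub_filter_eq_measObs (st.alice x) j

theorem bobObs_eq (y : Fin 6) (j : Fin n) :
    st.bobObs y j = measObs (st.bob y) fun s => ((s j : ℤ) : ℂ) :=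
  sub_filter_eq_measObs (st.bob y) j

theorem isReflection_aliceObs {x : Question n} (hx : x ∈ questionSet S) (j : Fin n) :
    IsReflection (st.aliceObs x j) := by
  rw [st.aliceObs_eq]
  refine isReflection_measObs (st.alice_meas x hx) fun s => ?_
  rcases Int.units_eq_one_or (s j) with h | h <;> simp [h]

theorem isReflection_bobObs (y : Fin 6) (j : Fin n) : IsReflection (st.bobObs y j) := by
  rw [st.bobObs_eq]
  refine isReflection_measObs (st.bob_meas y) fun s => ?_
  rcases Int.units_eq_one_or (s j) with h | h <;> simp [h]

theorem commute_aliceObs {x : Question n} (hx : x ∈ questionSet S) (j k : Fin n) :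
    Commute (st.aliceObs x j) (st.aliceObs x k) := by
  rw [st.aliceObs_eq, st.aliceObs_eq, commute_iff_eq, measObs_mul (st.alice_meas x hx),
    measObs_mul (st.alice_meas x hx)]
  simp only [mul_comm]

theorem isReflection_aliceObs_mul {x : Question n} (hx : x ∈ questionSet S) (j k : Fin n) :
    IsReflection (st.aliceObs x j * st.aliceObs x k) := by
  rw [st.aliceObs_eq, st.aliceObs_eq, measObs_mul (st.alice_meas x hx)]
  refine isReflection_measObs (st.alice_meas x hx) fun s => ?_
  rcases Int.units_eq_one_or (s j) with h | h <;>
    rcases Int.units_eq_one_or (s k) with h' | h' <;> simp [h, h']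

/-- The signs of the four Bell projections in `bellObs`. -/
noncomputable def _root_.SelfTest.bellSign (q : Fin 5) : Fin 4 → ℂ :=
  ![if q = 1 then -1 else 1, if q = 0 then -1 else 1, if q = 2 then -1 else 1, -1]

/-- Treats the measurements ◇ and ◆ uniformly, so that the parity of `j` is needed only here. -/
theorem exists_bellObs_eq (j : ℕ) (hj : j + 1 < n) :
    ∃ (α : Type) (_ : Fintype α) (P : α → B →L[ℂ] B) (g : α → Fin 4),
      IsProjectiveMeasurement P ∧
        ∀ q, st.bellObs j hj q = measObs P fun s => bellSign q (g s) := by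
  obtain ⟨α, _, P, g, hP, hg⟩ : ∃ (α : Type) (_ : Fintype α) (P : α → B →L[ℂ] B) (g : α → Fin 4),
      IsProjectiveMeasurement P ∧ ∀ b, st.bellProj j hj b = ∑ s with g s = b, P s := by
    by_cases hpar : j % 2 = 0
    · exact ⟨_, inferInstance, st.bobWhite, fun s => s ⟨j / 2, by omega⟩, st.bobWhite_meas,
        fun b => by rw [bellProj, dif_pos hpar]⟩
    · exact ⟨_, inferInstance, st.bobBlack, fun s => s ⟨j / 2, by omega⟩, st.bobBlack_meas,
        fun b => by rw [bellProj, dif_neg hpar]⟩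
  refine ⟨α, inferInstance, P, g, hP, fun q => ?_⟩
  simp only [bellObs, hg, Finset.sum_filter, Finset.smul_sum, ← Finset.sum_add_distrib,
    ← Finset.sum_sub_distrib, measObs]
  refine Finset.sum_congr rfl fun s _ => ?_
  generalize g s = b
  fin_cases b <;> simp [bellSign]

theorem isReflection_bellObs (j : ℕ) (hj : j + 1 < n) (q : Fin 5) :
    IsReflection (st.bellObs j hj q) := by
  obtain ⟨α, _, P, g, hP, h⟩ := st.exists_bellObs_eq j hj
  rw [h]
  refine isReflection_measObs hP fun s => ?_
  have key : ∀ (p : Prop) [Decidable p], (if p then (-1 : ℂ) else 1) = 1 ∨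
      (if p then (-1 : ℂ) else 1) = -1 := fun p _ => by
    split_ifs
    · exact Or.inr rfl
    · exact Or.inl rfl
  generalize g s = b
  fin_cases b
  · exact key _
  · exact key _
  · exact key _
  · exact Or.inr rfl

/-- The sign patterns are those of σ_x ⊗ σ_x, σ_y ⊗ σ_y and σ_z ⊗ σ_z on the four Bell states, where
the product of the first two is minus the third. -/
theorem bellObs_zero_mul_one (j : ℕ) (hj : j + 1 < n) :
    st.bellObs j hj 0 * st.bellObs j hj 1 = -st.bellObs j hj 2 := by
  obtain ⟨α, _, P, g, hP, h⟩ := st.exists_bellObs_eq j hj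
  rw [h, h, h, measObs_mul hP, measObs, measObs, ← Finset.sum_neg_distrib]
  refine Finset.sum_congr rfl fun s _ => ?_
  rw [← neg_smul]
  congr 1
  generalize g s = b
  fin_cases b <;> simp [bellSign]

/-- The six combinations of Bob's observables that are mirrored by Alice's observables. -/
noncomputable def bobLin (m : Fin 6) (j : Fin n) : B →L[ℂ] B :=
  ![normSum (st.Dzx j) (st.Ezx j), normDiff (st.Dzx j) (st.Ezx j),
    normSum (st.Dzy j) (st.Ezy j), normDiff (st.Dzy j) (st.Ezy j),
    normSum (st.Dxy j) (st.Exy j), normDiff (st.Dxy j) (st.Exy j)] m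

/-- The question of Alice whose observable is mirrored by `bobLin m`. -/
def _root_.SelfTest.aliceLabel : Fin 6 → Fin 5 := ![2, 0, 2, 1, 0, 1]

theorem _root_.SelfTest.insertAt_removeAt (j : Fin n) (x : Question n) :
    insertAt j (x j) (removeAt j x) = x := by
  funext i
  unfold insertAt removeAt
  split_ifs with h
  · rw [h]
  · rfl

theorem _root_.SelfTest.insertAt_mem_questionSet {j : Fin n} (q : Fin 5)
    {r : {i : Fin n // i ≠ j} → Fin 5} (hr : r ∈ remainingSet S j) :
    insertAt j q r ∈ questionSet S := by
  obtain ⟨χ, hχ, rfl | ⟨i, k, rfl⟩⟩ := hr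
  · refine ⟨χ, hχ, j, j, q - χ j, 0, funext fun l => ?_⟩
    by_cases h : l = j
    · subst h; simp [insertAt]
    · simp [insertAt, removeAt, h]
  · refine ⟨χ, hχ, j, i, q - χ j, k, funext fun l => ?_⟩
    by_cases h : l = j
    · subst h; simp [insertAt, i.2.symm]
    · by_cases h' : l = i
      · have : (⟨l, h⟩ : {i : Fin n // i ≠ j}) = i := Subtype.ext h'
        subst this
        simp [insertAt, removeAt, h]
      · have : (⟨l, h⟩ : {i : Fin n // i ≠ j}) ≠ i := fun he => h' (congrArg Subtype.val he)
        simp [insertAt, removeAt, h, h', this]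

/-- The three CHSH identities sum to six squares with total 12 - √2 ⟨C⟩ ≤ ε, so each square is at
most ε. -/
theorem norm_aliceObsAt_sub_bobLin_le {ε : ℝ≥0} (hst : st.AttainsRequests ε) (m : Fin 6)
    {j : Fin n} {r : {i : Fin n // i ≠ j} → Fin 5} (hr : r ∈ remainingSet S j) :
    ‖onAlice (st.aliceObsAt j (aliceLabel m) r) st.ψ - onBob (st.bobLin m j) st.ψ‖ ≤ √ε := by
  have href : ∀ q, IsReflection (st.aliceObsAt j q r) := fun q =>
    st.isReflection_aliceObs (insertAt_mem_questionSet q hr) j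
  have h := hst.chsh j r hr
  have h1 := chsh_sos (href 2) (href 0) (st.isReflection_bobObs 0 j) (st.isReflection_bobObs 1 j)
    st.norm_ψ
  have h2 := chsh_sos (href 2) (href 1) (st.isReflection_bobObs 2 j) (st.isReflection_bobObs 3 j)
    st.norm_ψ
  have h3 := chsh_sos (href 0) (href 1) (st.isReflection_bobObs 4 j) (st.isReflection_bobObs 5 j)
    st.norm_ψ
  have hs : √2 * (6 * √2 - ε / √2) = 12 - ε := by
    have : √2 * √2 = 2 := Real.mul_self_sqrt zero_le_two
    rw [mul_sub, mul_div_cancel₀ _ (by positivity)]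
    linarith
  have h' := mul_le_mul_of_nonneg_left h (Real.sqrt_nonneg 2)
  have he : st.expect (st.tripleCHSH j r) =
      (inner ℂ st.ψ (opTensor (st.aliceObsAt j 2 r) (st.bobObs 0 j + st.bobObs 1 j) st.ψ)).re +
      (inner ℂ st.ψ (opTensor (st.aliceObsAt j 0 r) (st.bobObs 0 j - st.bobObs 1 j) st.ψ)).re +
      (inner ℂ st.ψ (opTensor (st.aliceObsAt j 2 r) (st.bobObs 2 j + st.bobObs 3 j) st.ψ)).re +
      (inner ℂ st.ψ (opTensor (st.aliceObsAt j 1 r) (st.bobObs 2 j - st.bobObs 3 j) st.ψ)).re +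
      (inner ℂ st.ψ (opTensor (st.aliceObsAt j 0 r) (st.bobObs 4 j + st.bobObs 5 j) st.ψ)).re +
      (inner ℂ st.ψ (opTensor (st.aliceObsAt j 1 r) (st.bobObs 4 j - st.bobObs 5 j) st.ψ)).re := by
    simp only [expect, tripleCHSH, add_apply, inner_add_right, Complex.add_re]
    rfl
  rw [hs, he] at h'
  refine Real.le_sqrt_of_sq_le ?_
  have p1 := sq_nonneg ‖onAlice (st.aliceObsAt j 2 r) st.ψ -
    onBob (normSum (st.bobObs 0 j) (st.bobObs 1 j)) st.ψ‖
  have p2 := sq_nonneg ‖onAlice (st.aliceObsAt j 0 r) st.ψ -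
    onBob (normDiff (st.bobObs 0 j) (st.bobObs 1 j)) st.ψ‖
  have p3 := sq_nonneg ‖onAlice (st.aliceObsAt j 2 r) st.ψ -
    onBob (normSum (st.bobObs 2 j) (st.bobObs 3 j)) st.ψ‖
  have p4 := sq_nonneg ‖onAlice (st.aliceObsAt j 1 r) st.ψ -
    onBob (normDiff (st.bobObs 2 j) (st.bobObs 3 j)) st.ψ‖
  have p5 := sq_nonneg ‖onAlice (st.aliceObsAt j 0 r) st.ψ -
    onBob (normSum (st.bobObs 4 j) (st.bobObs 5 j)) st.ψ‖
  have p6 := sq_nonneg ‖onAlice (st.aliceObsAt j 1 r) st.ψ -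
    onBob (normDiff (st.bobObs 4 j) (st.bobObs 5 j)) st.ψ‖
  fin_cases m
  · change ‖onAlice (st.aliceObsAt j 2 r) st.ψ -
      onBob (normSum (st.bobObs 0 j) (st.bobObs 1 j)) st.ψ‖ ^ 2 ≤ ε
    linarith
  · change ‖onAlice (st.aliceObsAt j 0 r) st.ψ -
      onBob (normDiff (st.bobObs 0 j) (st.bobObs 1 j)) st.ψ‖ ^ 2 ≤ ε
    linarith
  · change ‖onAlice (st.aliceObsAt j 2 r) st.ψ -
      onBob (normSum (st.bobObs 2 j) (st.bobObs 3 j)) st.ψ‖ ^ 2 ≤ ε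
    linarith
  · change ‖onAlice (st.aliceObsAt j 1 r) st.ψ -
      onBob (normDiff (st.bobObs 2 j) (st.bobObs 3 j)) st.ψ‖ ^ 2 ≤ ε
    linarith
  · change ‖onAlice (st.aliceObsAt j 0 r) st.ψ -
      onBob (normSum (st.bobObs 4 j) (st.bobObs 5 j)) st.ψ‖ ^ 2 ≤ ε
    linarith
  · change ‖onAlice (st.aliceObsAt j 1 r) st.ψ -
      onBob (normDiff (st.bobObs 4 j) (st.bobObs 5 j)) st.ψ‖ ^ 2 ≤ ε
    linarith

end Strategy

theorem norm_inv_sqrt_two_smul_le {V : Type*} [NormedAddCommGroup V]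
    [NormedSpace ℂ V] (v : V) : ‖((1 / √2 : ℝ) : ℂ) • v‖ ≤ ‖v‖ := by
  rw [norm_smul, Complex.norm_real, Real.norm_of_nonneg (by positivity)]
  refine mul_le_of_le_one_left (norm_nonneg v) ?_
  rw [div_le_one (by positivity)]
  exact Real.one_le_sqrt.2 one_le_two

/-! ### Membership in the question sets. -/

section Questions

variable {n : ℕ}

theorem removeAt_insertAt (j : Fin n) (q : Fin 5) (r : {i : Fin n // i ≠ j} → Fin 5) :
    removeAt j (insertAt j q r) = r := by
  funext i
  simp [removeAt, insertAt, i.2]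

theorem insertAt_self (j : Fin n) (q : Fin 5) (r : {i : Fin n // i ≠ j} → Fin 5) :
    insertAt j q r j = q := by
  simp [insertAt]

theorem removeAt_mem_remainingSet {S : Set (Question n)} {χ : Question n} (hχ : χ ∈ S)
    (j : Fin n) : removeAt j χ ∈ remainingSet S j :=
  ⟨χ, hχ, Or.inl rfl⟩

theorem removeAt_update_mem_remainingSet {S : Set (Question n)} {χ : Question n} (hχ : χ ∈ S)
    {j l : Fin n} (hjl : l ≠ j) (q : Fin 5) :
    removeAt j (Function.update χ l q) ∈ remainingSet S j := by
  refine ⟨χ, hχ, Or.inr ⟨⟨l, hjl⟩, q - χ l, funext fun i => ?_⟩⟩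
  by_cases h : (i : Fin n) = l
  · have : i = ⟨l, hjl⟩ := Subtype.ext h
    subst this
    simp [removeAt]
  · have : i ≠ ⟨l, hjl⟩ := fun he => h (congrArg Subtype.val he)
    simp [removeAt, h, this]

theorem removeAt_update_self (χ : Question n) (j : Fin n) (q : Fin 5) :
    removeAt j (Function.update χ j q) = removeAt j χ := by
  funext i
  simp [removeAt, i.2]

theorem update_mem_questionSet {S : Set (Question n)} {χ : Question n} (hχ : χ ∈ S) {k l : Fin n}
    (hkl : k ≠ l) (q q' : Fin 5) :
    Function.update (Function.update χ k q) l q' ∈ questionSet S := by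
  rw [← insertAt_removeAt l (Function.update (Function.update χ k q) l q'), removeAt_update_self]
  exact insertAt_mem_questionSet _ (removeAt_update_mem_remainingSet hχ hkl q)

end Questions

-- All strategies for a given n as one family, and the relations in its mirror quotient.

universe u v

/-- A strategy that attains the requests within the tolerance `ε`, with a special question `χ`. -/
structure Scenario (n : ℕ) where
  S : Set (Question n)
  A : Type u
  B : Type v
  [normedA : NormedAddCommGroup A]
  [innerA : InnerProductSpace ℂ A]
  [completeA : CompleteSpace A]
  [normedB : NormedAddCommGroup B]
  [innerB : InnerProductSpace ℂ B]
  [completeB : CompleteSpace B]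
  st : Strategy n S A B
  ε : ℝ≥0
  attains : st.AttainsRequests ε
  χ : Question n
  mem : χ ∈ S

namespace Scenario

instance {n : ℕ} (i : Scenario.{u, v} n) : NormedAddCommGroup i.A := i.normedA
instance {n : ℕ} (i : Scenario.{u, v} n) : InnerProductSpace ℂ i.A := i.innerA
instance {n : ℕ} (i : Scenario.{u, v} n) : CompleteSpace i.A := i.completeA
instance {n : ℕ} (i : Scenario.{u, v} n) : NormedAddCommGroup i.B := i.normedB
instance {n : ℕ} (i : Scenario.{u, v} n) : InnerProductSpace ℂ i.B := i.innerB
instance {n : ℕ} (i : Scenario.{u, v} n) : CompleteSpace i.B := i.completeB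

variable {n : ℕ}

/-- The state of a scenario. -/
def state (i : Scenario.{u, v} n) : HilbertTensor i.A i.B := i.st.ψ

/-- The order of the errors in a scenario. -/
noncomputable def err (i : Scenario.{u, v} n) : ℝ := √(i.ε : ℝ)

theorem isBoundedFamily_aliceObs {j : Fin n} {x : Scenario.{u, v} n → Question n}
    (hx : ∀ i, x i ∈ questionSet i.S) :
    IsBoundedFamily fun i : Scenario.{u, v} n => i.st.aliceObs (x i) j :=
  ⟨1, fun i => norm_le_one_of_isometric (i.st.isReflection_aliceObs (hx i) j).norm_apply⟩

theorem isBoundedFamily_bobObs (y : Fin 6) (j : Fin n) :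
    IsBoundedFamily fun i : Scenario.{u, v} n => i.st.bobObs y j :=
  ⟨1, fun i => norm_le_one_of_isometric (i.st.isReflection_bobObs y j).norm_apply⟩

theorem isBoundedFamily_bobLin (m : Fin 6) (j : Fin n) :
    IsBoundedFamily fun i : Scenario.{u, v} n => i.st.bobLin m j := by
  refine ⟨2, fun i => ?_⟩
  have hb : ∀ y, ‖i.st.bobObs y j‖ ≤ 1 := fun y =>
    norm_le_one_of_isometric (i.st.isReflection_bobObs y j).norm_apply
  have hs : ∀ y y', ‖normSum (i.st.bobObs y j) (i.st.bobObs y' j)‖ ≤ 2 := fun y y' =>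
    (norm_inv_sqrt_two_smul_le _).trans ((norm_add_le _ _).trans (by linarith [hb y, hb y']))
  have hd : ∀ y y', ‖normDiff (i.st.bobObs y j) (i.st.bobObs y' j)‖ ≤ 2 := fun y y' =>
    (norm_inv_sqrt_two_smul_le _).trans ((norm_sub_le _ _).trans (by linarith [hb y, hb y']))
  fin_cases m
  exacts [hs 0 1, hd 0 1, hs 2 3, hd 2 3, hs 4 5, hd 4 5]

theorem isMirrored_bobLin (m : Fin 6) (j : Fin n) {x : Scenario.{u, v} n → Question n}
    (hx : ∀ i, x i j = aliceLabel m) (hr : ∀ i, removeAt j (x i) ∈ remainingSet i.S j) :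
    IsMirrored state err (fun i => i.st.aliceObs (x i) j) fun i => i.st.bobLin m j where
  bdd_left := isBoundedFamily_aliceObs fun i => by
    rw [← insertAt_removeAt j (x i)]
    exact insertAt_mem_questionSet _ (hr i)
  bdd_right := isBoundedFamily_bobLin m j
  small := ⟨1, fun i => by
    have := i.st.norm_aliceObsAt_sub_bobLin_le i.attains m (hr i)
    rw [← hx i, Strategy.aliceObsAt, insertAt_removeAt] at this
    rw [one_mul]
    exact this⟩

theorem isMirrored_aliceObsAt (m : Fin 6) (k : Fin n) :
    IsMirrored state err
      (fun i : Scenario.{u, v} n => i.st.aliceObsAt k (aliceLabel m) (removeAt k i.χ))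
      fun i => i.st.bobLin m k :=
  isMirrored_bobLin m k (x := fun i => insertAt k (aliceLabel m) (removeAt k i.χ))
    (fun i => insertAt_self _ _ _) fun i => by
      rw [removeAt_insertAt]
      exact removeAt_mem_remainingSet i.mem k

/-- The class of Alice's observable that is mirrored by `bobLin m k`. -/
noncomputable def cls (m : Fin 6) (k : Fin n) :
    MirrorQuotient (state (n := n)) (err.{u, v} (n := n)) :=
  mirrorMk state err (isMirrored_aliceObsAt m k).elem

/-- Each of x, y, z occurs in two of the three CHSH games. Bob's two combinations differ, but they
have the same partner on Alice's side. -/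
theorem cls_eq_cls {m m' : Fin 6} (h : aliceLabel m = aliceLabel m') (k : Fin n) :
    cls.{u, v} m k = cls m' k :=
  mirrorMk_eq_of_fst (funext fun i =>
    congrArg (fun q => i.st.aliceObsAt k q (removeAt k i.χ)) h)

/-- Bob's partner does not depend on the other entries of Alice's question, so her observables in
different contexts have the same class. -/
theorem mirrorMk_eq_cls {m : Fin 6} {k : Fin n} {a : ∀ i : Scenario.{u, v} n, i.A →L[ℂ] i.A}
    (h : IsMirrored state err a fun i => i.st.bobLin m k) : mirrorMk state err h.elem = cls m k :=
  mirrorMk_eq_of_snd rfl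

theorem cls_mul_self (m : Fin 6) (k : Fin n) : cls.{u, v} m k * cls m k = 1 := by
  rw [cls, ← map_mul, ← map_one (mirrorMk state err)]
  refine mirrorMk_eq_of_fst (funext fun i => ?_)
  exact (i.st.isReflection_aliceObs (insertAt_mem_questionSet _
    (removeAt_mem_remainingSet i.mem k)) k).sq

theorem cls_anticomm_of_bobLin {m m' : Fin 6} (k : Fin n)
    (h : ∀ i : Scenario.{u, v} n, i.st.bobLin m' k * i.st.bobLin m k =
      -(i.st.bobLin m k * i.st.bobLin m' k)) :
    cls.{u, v} m k * cls m' k = -(cls m' k * cls m k) := by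
  rw [cls, cls, ← map_mul, ← map_mul, ← map_neg]
  exact mirrorMk_eq_of_snd (MulOpposite.unop_injective (funext h))

theorem cls_anticomm_zx (k : Fin n) : cls.{u, v} 0 k * cls 1 k = -(cls 1 k * cls 0 k) :=
  cls_anticomm_of_bobLin k fun i =>
    normDiff_mul_normSum_eq_neg (i.st.isReflection_bobObs 0 k) (i.st.isReflection_bobObs 1 k)

theorem cls_anticomm_zy (k : Fin n) : cls.{u, v} 2 k * cls 3 k = -(cls 3 k * cls 2 k) :=
  cls_anticomm_of_bobLin k fun i =>
    normDiff_mul_normSum_eq_neg (i.st.isReflection_bobObs 2 k) (i.st.isReflection_bobObs 3 k)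

theorem cls_anticomm_xy (k : Fin n) : cls.{u, v} 4 k * cls 5 k = -(cls 5 k * cls 4 k) :=
  cls_anticomm_of_bobLin k fun i =>
    normDiff_mul_normSum_eq_neg (i.st.isReflection_bobObs 4 k) (i.st.isReflection_bobObs 5 k)

theorem isMirrored_update_left (m m' : Fin 6) {k l : Fin n} (hkl : k ≠ l)
    {χ : Scenario.{u, v} n → Question n} (hχ : ∀ i, χ i ∈ i.S) :
    IsMirrored state err (fun i => i.st.aliceObs
      (Function.update (Function.update (χ i) k (aliceLabel m)) l (aliceLabel m')) k)
      fun i => i.st.bobLin m k :=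
  isMirrored_bobLin m k
    (fun i => by rw [Function.update_of_ne hkl, Function.update_self]) fun i => by
      rw [Function.update_comm hkl, removeAt_update_self]
      exact removeAt_update_mem_remainingSet (hχ i) hkl.symm _

theorem isMirrored_update_right (m m' : Fin 6) {k l : Fin n} (hkl : k ≠ l)
    {χ : Scenario.{u, v} n → Question n} (hχ : ∀ i, χ i ∈ i.S) :
    IsMirrored state err (fun i => i.st.aliceObs
      (Function.update (Function.update (χ i) k (aliceLabel m)) l (aliceLabel m')) l)
      fun i => i.st.bobLin m' l :=
  isMirrored_bobLin m' l (fun i => Function.update_self _ _ _) fun i => by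
      rw [removeAt_update_self]
      exact removeAt_update_mem_remainingSet (hχ i) hkl _

/-- Both classes are represented by observables of one question, the special question changed at `k`
and at `l`; these come from one measurement and commute. This is the use of questions with two
changed entries. -/
theorem commute_cls (m m' : Fin 6) {k l : Fin n} (hkl : k ≠ l) :
    Commute (cls.{u, v} m k) (cls m' l) := by
  have hχ : ∀ i : Scenario.{u, v} n, i.χ ∈ i.S := fun i => i.mem
  rw [← mirrorMk_eq_cls (isMirrored_update_left m m' hkl hχ),
    ← mirrorMk_eq_cls (isMirrored_update_right m m' hkl hχ), commute_iff_eq, ← map_mul, ← map_mul]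
  refine mirrorMk_eq_of_fst (funext fun i => ?_)
  exact i.st.commute_aliceObs (update_mem_questionSet i.mem hkl _ _) k l

theorem isMirrored_bellObs (m : Fin 6) (j : ℕ) (hj : j + 1 < n)
    {χ : Scenario.{u, v} n → Question n} (hχ : ∀ i, χ i ∈ i.S)
    (h : ∀ i, let j₀ : Fin n := ⟨j, by omega⟩
      let j₁ : Fin n := ⟨j + 1, hj⟩
      let w : Question n := Function.update (Function.update (χ i) j₀ (aliceLabel m)) j₁ (aliceLabel m)
      1 - (i.ε : ℝ) / 2 ≤ i.st.expect (opTensor (i.st.aliceObs w j₀ * i.st.aliceObs w j₁)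
        (i.st.bellObs j hj (aliceLabel m)))) :
    IsMirrored state err (fun i => i.st.aliceObs (Function.update (Function.update (χ i)
        (⟨j, by omega⟩ : Fin n) (aliceLabel m)) ⟨j + 1, hj⟩ (aliceLabel m)) ⟨j, by omega⟩ *
      i.st.aliceObs (Function.update (Function.update (χ i)
        (⟨j, by omega⟩ : Fin n) (aliceLabel m)) ⟨j + 1, hj⟩ (aliceLabel m)) ⟨j + 1, hj⟩)
      fun i => i.st.bellObs j hj (aliceLabel m) := by
  have hne : (⟨j, by omega⟩ : Fin n) ≠ ⟨j + 1, hj⟩ := fun he => by simp at he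
  have hmem := fun i => update_mem_questionSet (hχ i) hne (aliceLabel m) (aliceLabel m)
  refine ⟨(isBoundedFamily_aliceObs hmem).mul (isBoundedFamily_aliceObs hmem),
    ⟨1, fun i => norm_le_one_of_isometric (i.st.isReflection_bellObs j hj _).norm_apply⟩,
    1, fun i => ?_⟩
  have := norm_onAlice_sub_onBob_le (i.st.isReflection_aliceObs_mul (hmem i) _ _)
    (i.st.isReflection_bellObs j hj (aliceLabel m)) i.st.norm_ψ (h i)
  rw [mul_div_cancel₀ _ two_ne_zero] at this
  rw [one_mul]
  exact Real.le_sqrt_of_sq_le this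

theorem cls_bell (j : ℕ) (hj : j + 1 < n) :
    cls.{u, v} 5 (⟨j, by omega⟩ : Fin n) * cls 5 ⟨j + 1, hj⟩ *
        (cls 4 ⟨j, by omega⟩ * cls 4 ⟨j + 1, hj⟩) =
      -(cls 0 ⟨j, by omega⟩ * cls 0 ⟨j + 1, hj⟩) := by
  have hne : (⟨j, by omega⟩ : Fin n) ≠ ⟨j + 1, hj⟩ := fun he => by simp at he
  -- The special question of the Bell correlations may differ from `i.χ`; this is harmless because
  -- the classes do not depend on the context.
  choose χ hχ hc using fun i : Scenario.{u, v} n => i.attains.conj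
  have hm : ∀ m : Fin 6, aliceLabel m ∈ ({0, 1, 2} : Set (Fin 5)) := by
    intro m; fin_cases m <;> simp [aliceLabel]
  have H := fun m => isMirrored_bellObs m j hj hχ fun i => hc i j hj (aliceLabel m) (hm m)
  have key : ∀ m, cls.{u, v} m (⟨j, by omega⟩ : Fin n) * cls m ⟨j + 1, hj⟩ =
      mirrorMk state err (H m).elem := by
    intro m
    rw [← mirrorMk_eq_cls (isMirrored_update_left m m hne hχ),
      ← mirrorMk_eq_cls (isMirrored_update_right m m hne hχ), ← map_mul]
    exact mirrorMk_eq_of_fst rfl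
  rw [key, key, key, ← map_mul, ← map_neg]
  exact mirrorMk_eq_of_snd (MulOpposite.unop_injective
    (funext fun i => i.st.bellObs_zero_mul_one j hj))

end Scenario

/-- The Bell relation says w w' = z z' for the phase flips w and w'. Multiplying by z on the left
and by w' on the right gives z w = z' w'. -/
theorem mul_flip_succ {E : Type*} [Ring E] [Algebra ℂ E] {x y z x' y' z' : E} (hx : x * x = 1)
    (hy : y * y = 1) (hz : z * z = 1) (hx' : x' * x' = 1) (hy' : y' * y' = 1)
    (hxy : x * y = -(y * x)) (hxy' : x' * y' = -(y' * x')) (hyx' : Commute y' x)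
    (h : y * y' * (x * x') = -(z * z')) :
    z' * phaseFlip x' y' = z * phaseFlip x y := by
  have hw := phaseFlip_mul_self hx hy hxy
  have hw' := phaseFlip_mul_self hx' hy' hxy'
  have h1 : phaseFlip x y * phaseFlip x' y' = z * z' := by
    rw [phaseFlip, phaseFlip, smul_mul_smul_comm]
    have e : y * x * (y' * x') = -(z * z') := by
      rw [← h, mul_assoc, ← mul_assoc x, ← hyx'.eq]
      simp only [mul_assoc]
    rw [e]
    simp
  calc z' * phaseFlip x' y' = z * (z * z') * phaseFlip x' y' := by
        rw [← mul_assoc z, hz, one_mul]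
    _ = z * phaseFlip x y := by rw [← h1, mul_assoc z, mul_assoc, hw', mul_one]

/-! ### Isometric partners on Bob's side. -/

section Mirror

variable {ι : Type*} {A B : ι → Type*} [∀ i, NormedAddCommGroup (A i)]
  [∀ i, InnerProductSpace ℂ (A i)] [∀ i, NormedAddCommGroup (B i)]
  [∀ i, InnerProductSpace ℂ (B i)] {ψ : ∀ i, HilbertTensor (A i) (B i)} {ρ : ι → ℝ}
  {a a' : ∀ i, A i →L[ℂ] A i} {b b' D E : ∀ i, B i →L[ℂ] B i}

theorem IsMirrored.mul (h : IsMirrored ψ ρ a b) (h' : IsMirrored ψ ρ a' b') :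
    IsMirrored ψ ρ (fun i => a i * a' i) fun i => b' i * b i :=
  (h.elem * h'.elem).2

theorem IsMirrored.smul (r : ℂ) (h : IsMirrored ψ ρ a b) :
    IsMirrored ψ ρ (fun i => r • a i) fun i => r • b i :=
  (r • h.elem).2

theorem IsMirrored.congr_right (h : IsMirrored ψ ρ a b) (hb : IsBoundedFamily b')
    (hs : IsSmall ρ fun i => onBob (b' i) (ψ i) - onBob (b i) (ψ i)) : IsMirrored ψ ρ a b' where
  bdd_left := h.bdd_left
  bdd_right := hb
  small := (h.small.sub hs).congr fun i => by abel

/-- D E + E D = 2 ((D + E)/√2)² - 2, and the square acts on the state like a² = 1. -/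
theorem isSmall_onBob_anticommutator (ha : ∀ i, IsReflection (a i)) (hD : ∀ i, IsReflection (D i))
    (hE : ∀ i, IsReflection (E i)) (h : IsMirrored ψ ρ a fun i => normSum (D i) (E i)) :
    IsSmall ρ fun i => onBob (D i * E i + E i * D i) (ψ i) := by
  refine ((h.mul h).small.smul (-2)).congr fun i => ?_
  rw [normSum_mul_normSum (hD i) (hE i), (ha i).sq, onAlice_one, sub_eq_add_neg, onBob_add,
    ← smul_neg, ← neg_one_smul ℂ (1 : B i →L[ℂ] B i), onBob_smul, onBob_smul, onBob_smul, onBob_one]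
  module

theorem IsMirrored.regularise (ha : ∀ i, IsReflection (a i)) (hD : ∀ i, IsReflection (D i))
    (hE : ∀ i, IsReflection (E i)) (h : IsMirrored ψ ρ a fun i => normSum (D i) (E i))
    (hb : ∀ i, ∃ T, (∀ v, ‖b i v‖ = ‖v‖) ∧ ‖T‖ ≤ 2 ∧
      b i = ((1 / √2 : ℝ) : ℂ) • (D i + E i) + T * (D i * E i + E i * D i)) :
    IsMirrored ψ ρ a b := by
  choose T hiso hT hb using hb
  refine h.congr_right ⟨1, fun i => norm_le_one_of_isometric (hiso i)⟩ ?_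
  refine ((isSmall_onBob_anticommutator ha hD hE h).onBob ⟨2, hT⟩).congr fun i => ?_
  rw [hb, onBob_add, ← onBob_mul, normSum, add_sub_cancel_left]

/-- The direct partner is -(i/2)(E D - D E). Since E D ≈ -D E on the state it may be replaced by i D
E, which preserves norms exactly. -/
theorem IsMirrored.phaseFlip (ha : ∀ i, IsReflection (a i)) (hD : ∀ i, IsReflection (D i))
    (hE : ∀ i, IsReflection (E i)) (h : IsMirrored ψ ρ a fun i => normSum (D i) (E i))
    (h' : IsMirrored ψ ρ a' fun i => normDiff (D i) (E i)) :
    IsMirrored ψ ρ (fun i => phaseFlip (a i) (a' i)) fun i => Complex.I • (D i * E i) := by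
  refine ((h'.mul h).smul (-Complex.I)).congr_right ?_ ?_
  · refine ⟨1, fun i => norm_le_one_of_isometric fun v => ?_⟩
    rw [smul_apply, norm_smul, Complex.norm_I, one_mul, mul_apply_eq_comp, (hD i).norm_apply,
      (hE i).norm_apply]
  · refine ((isSmall_onBob_anticommutator ha hD hE h).smul (Complex.I / 2)).congr fun i => ?_
    rw [normSum_mul_normDiff (hD i) (hE i), sub_eq_add_neg (E i * D i),
      ← neg_one_smul ℂ (D i * E i)]
    simp only [onBob_smul, onBob_add]
    module

theorem unop_halfPlusWord {E : Type*} [Ring E] [Algebra ℂ E] {n : ℕ} (w : Fin n → Eᵐᵒᵖ) :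
    (halfPlusWord w).unop = (List.ofFn fun k => halfPlus (w k).unop).reverse.prod := by
  rw [halfPlusWord, MulOpposite.unop_list_prod, List.map_ofFn]
  rfl

theorem isSmall_of_word_relation {n : ℕ} {X W : Fin n → mirrorAlgebra ψ ρ}
    {J g : mirrorAlgebra ψ ρ} {s t : Fin n → Fin 2} {c d : Fin 2} {κ : ℂ}
    (h : krausWord (fun k => mirrorMk ψ ρ (X k)) (fun k => mirrorMk ψ ρ (W k)) s *
        branch (mirrorMk ψ ρ J) c * mirrorMk ψ ρ g * (branch (mirrorMk ψ ρ J) d *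
          krausMirrorWord (fun k => mirrorMk ψ ρ (X k)) (fun k => mirrorMk ψ ρ (W k)) t) =
      κ • (halfPlusWord (fun k => mirrorMk ψ ρ (W k)) * branch (mirrorMk ψ ρ J) c)) :
    IsSmall ρ fun i =>
      opTensor (krausWord (fun k => aliceEval i (X k)) (fun k => aliceEval i (W k)) s *
          branch (aliceEval i J) c)
        (krausWord (fun k => (bobEval i (X k)).unop) (fun k => (bobEval i (W k)).unop) t *
          branch (bobEval i J).unop d) (onAlice (aliceEval i g) (ψ i)) -
        κ • onBob (branch (bobEval i J).unop c *
          (List.ofFn fun k => halfPlus (bobEval i (W k)).unop).reverse.prod) (ψ i) := by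
  rw [← map_krausWord, ← map_krausMirrorWord, ← map_halfPlusWord, ← map_branch, ← map_branch,
    ← map_mul, ← map_mul, ← map_mul, ← map_mul, ← map_mul] at h
  refine (isSmall_of_mirrorMk_eq h).congr fun i => ?_
  rw [map_mul, map_mul, map_mul, map_krausWord, map_krausMirrorWord, map_halfPlusWord, map_branch,
    map_branch, map_branch, MulOpposite.unop_mul, MulOpposite.unop_mul, unop_krausMirrorWord,
    unop_halfPlusWord, unop_branch, unop_branch]

end Mirror

/-! ### Exact Pauli relations in the mirror quotient. -/

namespace Scenario

variable {n : ℕ}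

/-- Induction along neighbouring positions: the Bell measurements ensure that either all qubits are
complex conjugated or none is. -/
theorem cls_mul_phaseFlip (hn : 1 ≤ n) (k : Fin n) :
    cls.{u, v} 0 k * phaseFlip (cls 4 k) (cls 5 k) =
      cls 0 ⟨0, hn⟩ * phaseFlip (cls 4 ⟨0, hn⟩) (cls 5 ⟨0, hn⟩) := by
  obtain ⟨k, hk⟩ := k
  induction k with
  | zero => rfl
  | succ k ih =>
    rw [← ih (by omega)]
    exact mul_flip_succ (cls_mul_self _ _) (cls_mul_self _ _) (cls_mul_self _ _) (cls_mul_self _ _)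
      (cls_mul_self _ _) (cls_anticomm_xy _) (cls_anticomm_xy _)
      (commute_cls _ _ fun h => by simp at h) (cls_bell k hk)

theorem pauliRelations_cls (hn : 1 ≤ n) :
    PauliRelations (cls.{u, v} (n := n) 4) (cls 5) (cls 0)
      (cls 0 ⟨0, hn⟩ * phaseFlip (cls 4 ⟨0, hn⟩) (cls 5 ⟨0, hn⟩)) where
  x_sq := cls_mul_self 4
  y_sq := cls_mul_self 5
  z_sq := cls_mul_self 0
  xy := cls_anticomm_xy
  xz k := by
    rw [← cls_eq_cls (show aliceLabel 1 = aliceLabel 4 from rfl), cls_anticomm_zx, neg_neg]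
  yz k := by
    rw [← cls_eq_cls (show aliceLabel 3 = aliceLabel 5 from rfl),
      ← cls_eq_cls (show aliceLabel 2 = aliceLabel 0 from rfl), cls_anticomm_zy, neg_neg]
  comm_xx _ _ := commute_cls 4 4
  comm_xy _ _ := commute_cls 4 5
  comm_yy _ _ := commute_cls 5 5
  z_mul := cls_mul_phaseFlip hn

end Scenario

/-! ### The local isometries of a strategy. -/

namespace Strategy

variable {n : ℕ} {S : Set (Question n)} {A B : Type*}
  [NormedAddCommGroup A] [InnerProductSpace ℂ A] [CompleteSpace A]
  [NormedAddCommGroup B] [InnerProductSpace ℂ B] [CompleteSpace B]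
  (st : Strategy n S A B)

/-- An isometry of Bob close to `(D + E) / √2` for his observables `D` and `E` upon `y` and `y'`. -/
noncomputable def regularSum (y y' : Fin 6) (j : Fin n) : B →L[ℂ] B :=
  (exists_regularisation (st.isReflection_bobObs y j) (st.isReflection_bobObs y' j)).choose

theorem regularSum_spec (y y' : Fin 6) (j : Fin n) :
    ∃ T : B →L[ℂ] B, (∀ v, ‖st.regularSum y y' j v‖ = ‖v‖) ∧ ‖T‖ ≤ 2 ∧
      st.regularSum y y' j = ((1 / √2 : ℝ) : ℂ) • (st.bobObs y j + st.bobObs y' j) +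
        T * (st.bobObs y j * st.bobObs y' j + st.bobObs y' j * st.bobObs y j) :=
  (exists_regularisation (st.isReflection_bobObs y j) (st.isReflection_bobObs y' j)).choose_spec

theorem norm_regularSum (y y' : Fin 6) (j : Fin n) (v : B) : ‖st.regularSum y y' j v‖ = ‖v‖ :=
  let ⟨_, h, _⟩ := st.regularSum_spec y y' j
  h v

/-- Bob's phase flip. -/
noncomputable def bobFlip (j : Fin n) : B →L[ℂ] B := Complex.I • (st.bobObs 4 j * st.bobObs 5 j)

theorem norm_bobFlip (j : Fin n) (v : B) : ‖st.bobFlip j v‖ = ‖v‖ := by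
  rw [bobFlip, smul_apply, norm_smul, Complex.norm_I, one_mul, mul_apply_eq_comp,
    (st.isReflection_bobObs 4 j).norm_apply, (st.isReflection_bobObs 5 j).norm_apply]

/-- Bob's operator whose eigenspaces distinguish the two branches of the junk state. -/
noncomputable def bobBranch (hn : 1 ≤ n) : B →L[ℂ] B :=
  st.bobFlip ⟨0, hn⟩ * st.regularSum 0 1 ⟨0, hn⟩

theorem norm_bobBranch (hn : 1 ≤ n) (v : B) : ‖st.bobBranch hn v‖ = ‖v‖ := by
  rw [bobBranch, mul_apply_eq_comp, norm_bobFlip, norm_regularSum]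

/-- The isometry of Bob. -/
noncomputable def bobIsometry (hn : 1 ≤ n) : B →ₗᵢ[ℂ] LocalOut B n :=
  swapIsometry hn (st.regularSum 4 5) st.bobFlip (st.bobBranch hn) (st.norm_regularSum 4 5)
    st.norm_bobFlip (st.norm_bobBranch hn)

/-- Bob's operators that prepare the two branches of the junk state. -/
noncomputable def junkOp (hn : 1 ≤ n) (c : Fin 2) : B →L[ℂ] B :=
  branch (st.bobBranch hn) c * (List.ofFn fun k => halfPlus (st.bobFlip k)).reverse.prod

/-- Alice's observable in the context of the special question `χ`. -/
noncomputable def aliceAt (χ : Question n) (q : Fin 5) (k : Fin n) : A →L[ℂ] A :=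
  st.aliceObsAt k q (removeAt k χ)

variable {χ : Question n}

theorem isReflection_aliceAt (hχ : χ ∈ S) (q : Fin 5) (k : Fin n) :
    IsReflection (st.aliceAt χ q k) :=
  st.isReflection_aliceObs (insertAt_mem_questionSet q (removeAt_mem_remainingSet hχ k)) k

/-- Alice's phase flip. -/
noncomputable def aliceFlip (χ : Question n) (k : Fin n) : A →L[ℂ] A :=
  phaseFlip (st.aliceAt χ 0 k) (st.aliceAt χ 1 k)

theorem norm_aliceFlip (hχ : χ ∈ S) (k : Fin n) (v : A) : ‖st.aliceFlip χ k v‖ = ‖v‖ := by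
  rw [aliceFlip, phaseFlip, smul_apply, norm_smul, norm_neg, Complex.norm_I, one_mul,
    mul_apply_eq_comp, (st.isReflection_aliceAt hχ 1 k).norm_apply,
    (st.isReflection_aliceAt hχ 0 k).norm_apply]

/-- Alice's operator whose eigenspaces distinguish the two branches of the junk state. -/
noncomputable def aliceBranch (hn : 1 ≤ n) (χ : Question n) : A →L[ℂ] A :=
  st.aliceAt χ 2 ⟨0, hn⟩ * st.aliceFlip χ ⟨0, hn⟩

theorem norm_aliceBranch (hn : 1 ≤ n) (hχ : χ ∈ S) (v : A) : ‖st.aliceBranch hn χ v‖ = ‖v‖ := by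
  rw [aliceBranch, mul_apply_eq_comp, (st.isReflection_aliceAt hχ 2 _).norm_apply,
    st.norm_aliceFlip hχ]

/-- The isometry of Alice for the special question `χ`. -/
noncomputable def aliceIsometry (hn : 1 ≤ n) (hχ : χ ∈ S) : A →ₗᵢ[ℂ] LocalOut A n :=
  swapIsometry hn (st.aliceAt χ 0) (st.aliceFlip χ) (st.aliceBranch hn χ)
    (fun k => (st.isReflection_aliceAt hχ 0 k).norm_apply) (st.norm_aliceFlip hχ)
    (st.norm_aliceBranch hn hχ)

end Strategy

/-! ### Mirrored pairs for the operators in the isometries. -/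

namespace Scenario

variable {n : ℕ}

theorem isReflection_aliceAt (i : Scenario.{u, v} n) (q : Fin 5) (k : Fin n) :
    IsReflection (i.st.aliceAt i.χ q k) :=
  i.st.isReflection_aliceAt i.mem q k

theorem isMirrored_flip (k : Fin n) :
    IsMirrored state err (fun i : Scenario.{u, v} n => i.st.aliceAt i.χ 0 k)
      fun i => i.st.regularSum 4 5 k :=
  IsMirrored.regularise (fun i => i.isReflection_aliceAt 0 k) (fun i => i.st.isReflection_bobObs 4 k)
    (fun i => i.st.isReflection_bobObs 5 k) (isMirrored_aliceObsAt 4 k)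
    fun i => i.st.regularSum_spec 4 5 k

theorem isMirrored_regularSum_z (k : Fin n) :
    IsMirrored state err (fun i : Scenario.{u, v} n => i.st.aliceAt i.χ 2 k)
      fun i => i.st.regularSum 0 1 k :=
  IsMirrored.regularise (fun i => i.isReflection_aliceAt 2 k) (fun i => i.st.isReflection_bobObs 0 k)
    (fun i => i.st.isReflection_bobObs 1 k) (isMirrored_aliceObsAt 0 k)
    fun i => i.st.regularSum_spec 0 1 k

theorem isMirrored_phaseFlip (k : Fin n) :
    IsMirrored state err (fun i : Scenario.{u, v} n => i.st.aliceFlip i.χ k)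
      fun i => i.st.bobFlip k :=
  IsMirrored.phaseFlip (fun i => i.isReflection_aliceAt 0 k) (fun i => i.st.isReflection_bobObs 4 k)
    (fun i => i.st.isReflection_bobObs 5 k) (isMirrored_aliceObsAt 4 k) (isMirrored_aliceObsAt 5 k)

theorem isMirrored_branch (hn : 1 ≤ n) :
    IsMirrored state err (fun i : Scenario.{u, v} n => i.st.aliceBranch hn i.χ)
      fun i => i.st.bobBranch hn :=
  (isMirrored_regularSum_z ⟨0, hn⟩).mul (isMirrored_phaseFlip ⟨0, hn⟩)

theorem isMirrored_of_expect {q : Fin 5} {y : Fin 6} {k : Fin n}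
    (h : ∀ i : Scenario.{u, v} n,
      1 - (i.ε : ℝ) ≤ i.st.expect (opTensor (i.st.aliceAt i.χ q k) (i.st.bobObs y k))) :
    IsMirrored state err (fun i : Scenario.{u, v} n => i.st.aliceAt i.χ q k)
      fun i => i.st.bobObs y k where
  bdd_left := ⟨1, fun i => norm_le_one_of_isometric (i.isReflection_aliceAt q k).norm_apply⟩
  bdd_right := isBoundedFamily_bobObs y k
  small := ⟨√2, fun i => by
    rw [err, ← Real.sqrt_mul zero_le_two]
    exact Real.le_sqrt_of_sq_le (norm_onAlice_sub_onBob_le (i.isReflection_aliceAt q k)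
      (i.st.isReflection_bobObs y k) i.st.norm_ψ (h i))⟩

theorem isMirrored_diag_add (k : Fin n) :
    IsMirrored state err (fun i : Scenario.{u, v} n => i.st.aliceAt i.χ 3 k)
      fun i => i.st.bobObs 4 k :=
  isMirrored_of_expect fun i => i.attains.corr_add i.χ i.mem k

theorem isMirrored_diag_sub (k : Fin n) :
    IsMirrored state err (fun i : Scenario.{u, v} n => i.st.aliceAt i.χ 4 k)
      fun i => i.st.bobObs 5 k :=
  isMirrored_of_expect fun i => i.attains.corr_sub i.χ i.mem k

/-- Bob's D is itself (normalised sum + normalised difference)/√2, so Alice's fourth observable,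
which is mirrored by D, has the class (x + y)/√2. -/
theorem mirrorMk_diag_add (k : Fin n) : mirrorMk state err (isMirrored_diag_add.{u, v} k).elem =
    ((1 / √2 : ℝ) : ℂ) • (cls 4 k + cls 5 k) := by
  rw [cls, cls, ← map_add, ← map_smul]
  refine mirrorMk_eq_of_snd (MulOpposite.unop_injective (funext fun i => ?_))
  change i.st.bobObs 4 k = ((1 / √2 : ℝ) : ℂ) • (normSum (i.st.bobObs 4 k) (i.st.bobObs 5 k) +
    normDiff (i.st.bobObs 4 k) (i.st.bobObs 5 k))
  rw [normSum, normDiff, ← smul_add, smul_smul, inv_sqrt_two_mul_self]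
  module

theorem mirrorMk_diag_sub (k : Fin n) : mirrorMk state err (isMirrored_diag_sub.{u, v} k).elem =
    ((1 / √2 : ℝ) : ℂ) • (cls 4 k - cls 5 k) := by
  rw [cls, cls, ← map_sub, ← map_smul]
  refine mirrorMk_eq_of_snd (MulOpposite.unop_injective (funext fun i => ?_))
  change i.st.bobObs 5 k = ((1 / √2 : ℝ) : ℂ) • (normSum (i.st.bobObs 4 k) (i.st.bobObs 5 k) -
    normDiff (i.st.bobObs 4 k) (i.st.bobObs 5 k))
  rw [normSum, normDiff, ← smul_sub, smul_smul, inv_sqrt_two_mul_self]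
  module

theorem exists_elem_aliceAt (k : Fin n) (q : Fin 5) :
    ∃ a : mirrorAlgebra (state (n := n)) err.{u, v},
      (∀ i, aliceEval i a = i.st.aliceAt i.χ q k) ∧
        mirrorMk state err a = fiveObs (cls 4 k) (cls 5 k) (cls 0 k) q := by
  fin_cases q
  · exact ⟨(isMirrored_aliceObsAt 4 k).elem, fun i => rfl, rfl⟩
  · exact ⟨(isMirrored_aliceObsAt 5 k).elem, fun i => rfl, rfl⟩
  · exact ⟨(isMirrored_aliceObsAt 0 k).elem, fun i => rfl, rfl⟩
  · exact ⟨(isMirrored_diag_add k).elem, fun i => rfl, mirrorMk_diag_add k⟩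
  · exact ⟨(isMirrored_diag_sub k).elem, fun i => rfl, mirrorMk_diag_sub k⟩

/-- Regularisation changes only Bob's partner, and the class is determined by Alice's operator. -/
theorem mirrorMk_flip (k : Fin n) : mirrorMk state err (isMirrored_flip.{u, v} k).elem = cls 4 k :=
  mirrorMk_eq_of_fst rfl

theorem mirrorMk_phaseFlip (k : Fin n) :
    mirrorMk state err (isMirrored_phaseFlip.{u, v} k).elem = phaseFlip (cls 4 k) (cls 5 k) := by
  rw [cls, cls, phaseFlip, ← map_mul, ← map_smul]
  exact mirrorMk_eq_of_fst rfl

theorem mirrorMk_branch (hn : 1 ≤ n) : mirrorMk state err (isMirrored_branch.{u, v} hn).elem =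
    cls 0 ⟨0, hn⟩ * phaseFlip (cls 4 ⟨0, hn⟩) (cls 5 ⟨0, hn⟩) := by
  rw [← mirrorMk_phaseFlip, cls, ← map_mul]
  exact mirrorMk_eq_of_fst rfl

theorem isSmall_of_relation {hn : 1 ≤ n} {a : mirrorAlgebra (state (n := n)) err.{u, v}}
    {s t : Fin n → Fin 2} {c d : Fin 2} {κ : ℂ}
    (h : krausWord (cls 4) (fun k => phaseFlip (cls 4 k) (cls 5 k)) s *
        branch (cls 0 ⟨0, hn⟩ * phaseFlip (cls 4 ⟨0, hn⟩) (cls 5 ⟨0, hn⟩)) c * mirrorMk state err a *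
        (branch (cls 0 ⟨0, hn⟩ * phaseFlip (cls 4 ⟨0, hn⟩) (cls 5 ⟨0, hn⟩)) d *
          krausMirrorWord (cls 4) (fun k => phaseFlip (cls 4 k) (cls 5 k)) t) =
      κ • (halfPlusWord (fun k => phaseFlip (cls 4 k) (cls 5 k)) *
        branch (cls 0 ⟨0, hn⟩ * phaseFlip (cls 4 ⟨0, hn⟩) (cls 5 ⟨0, hn⟩)) c)) :
    IsSmall err fun i : Scenario.{u, v} n =>
      opTensor (krausWord (i.st.aliceAt i.χ 0) (i.st.aliceFlip i.χ) s *
          branch (i.st.aliceBranch hn i.χ) c)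
        (krausWord (i.st.regularSum 4 5) i.st.bobFlip t * branch (i.st.bobBranch hn) d)
        (onAlice (aliceEval i a) i.state) - κ • onBob (i.st.junkOp hn c) i.state := by
  refine isSmall_of_word_relation (X := fun k => (isMirrored_flip k).elem)
    (W := fun k => (isMirrored_phaseFlip k).elem) (J := (isMirrored_branch hn).elem) ?_
  simp only [mirrorMk_flip, mirrorMk_phaseFlip, mirrorMk_branch]
  exact h

end Scenario

/-! ### Normalisation of the junk state. -/

section Normalise

variable {A B : Type*} [NormedAddCommGroup A] [InnerProductSpace ℂ A]
  [NormedAddCommGroup B] [InnerProductSpace ℂ B] {n : ℕ}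

theorem weightedJunk_eq_junk (e : Fin 2 → ℂ) (ξ : Fin 2 → HilbertTensor A B) :
    weightedJunk n e ξ = junk n (e 0 • ξ 0) (e 1 • ξ 1) := by
  simp only [weightedJunk, Fin.sum_univ_two, junk, map_smul]

theorem norm_weightedJunk_sq (hn : 1 ≤ n) {e : Fin 2 → ℂ} (he : ∀ c, ‖e c‖ = 1)
    (ξ : Fin 2 → HilbertTensor A B) : ‖weightedJunk n e ξ‖ ^ 2 = ‖ξ 0‖ ^ 2 + ‖ξ 1‖ ^ 2 := by
  rw [weightedJunk_eq_junk, norm_junk_sq hn, norm_smul, norm_smul, he, he, one_mul, one_mul]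

theorem weightedJunk_sub (e : Fin 2 → ℂ) (ξ ξ' : Fin 2 → HilbertTensor A B) :
    weightedJunk n e ξ - weightedJunk n e ξ' = weightedJunk n e fun c => ξ c - ξ' c := by
  simp only [weightedJunk, Fin.sum_univ_two, map_sub, smul_sub]
  abel

/-- One rescaling must serve all phases `e`, since the same ξ₀ and ξ₁ appear with and without the
sign of σ_z. -/
theorem exists_unit_weightedJunk (hn : 1 ≤ n) {ψ : HilbertTensor A B} (hψ : ‖ψ‖ = 1)
    (ξ : Fin 2 → HilbertTensor A B) :
    ∃ ξ' : Fin 2 → HilbertTensor A B, ‖ξ' 0‖ ^ 2 + ‖ξ' 1‖ ^ 2 = 1 ∧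
      ∀ e : Fin 2 → ℂ, (∀ c, ‖e c‖ = 1) →
        ‖weightedJunk n e ξ' - weightedJunk n e ξ‖ ≤ |1 - ‖weightedJunk n (fun _ => 1) ξ‖| := by
  have hN2 := norm_weightedJunk_sq hn (fun _ => norm_one) ξ
  generalize ‖weightedJunk n (fun _ => 1) ξ‖ = N at hN2 ⊢
  by_cases h0 : N = 0
  · have hξ : ∀ c, ξ c = 0 := by
      rw [h0] at hN2
      have := sq_nonneg ‖ξ 0‖
      have := sq_nonneg ‖ξ 1‖
      have h0 : ‖ξ 0‖ ^ 2 = 0 := by linarith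
      have h1 : ‖ξ 1‖ ^ 2 = 0 := by linarith
      exact Fin.forall_fin_two.2 ⟨norm_eq_zero.1 (pow_eq_zero_iff two_ne_zero |>.1 h0),
        norm_eq_zero.1 (pow_eq_zero_iff two_ne_zero |>.1 h1)⟩
    -- If the junk vanishes, any unit vector will do: the allowed distance is then 1.
    refine ⟨![ψ, 0], by simp [hψ], fun e he => abs_le_of_sq_le_sq' ?_ (abs_nonneg _) |>.2⟩
    rw [weightedJunk_sub, norm_weightedJunk_sq hn he, h0, hξ, hξ]
    simp [hψ]
  · refine ⟨fun c => ((N⁻¹ : ℝ) : ℂ) • ξ c, ?_, fun e he =>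
      abs_le_of_sq_le_sq' ?_ (abs_nonneg _) |>.2⟩
    · rw [norm_smul, norm_smul, mul_pow, mul_pow, ← mul_add, ← hN2, Complex.norm_real,
        Real.norm_eq_abs, sq_abs, ← mul_pow, inv_mul_cancel₀ h0, one_pow]
    · have h1 : ∀ c, ((N⁻¹ : ℝ) : ℂ) • ξ c - ξ c = ((N⁻¹ - 1 : ℝ) : ℂ) • ξ c := fun c => by
        rw [Complex.ofReal_sub, sub_smul, Complex.ofReal_one, one_smul]
      rw [weightedJunk_sub, norm_weightedJunk_sq hn he, h1, h1, norm_smul, norm_smul, mul_pow,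
        mul_pow, ← mul_add, ← hN2, Complex.norm_real, Real.norm_eq_abs, sq_abs, sq_abs, ← mul_pow,
        sub_mul, inv_mul_cancel₀ h0, one_mul]

end Normalise

namespace Strategy

variable {n : ℕ} {S : Set (Question n)} {A B : Type*}
  [NormedAddCommGroup A] [InnerProductSpace ℂ A] [CompleteSpace A]
  [NormedAddCommGroup B] [InnerProductSpace ℂ B] [CompleteSpace B]
  (st : Strategy n S A B)

/-- The vectors of the junk state in the two branches, before normalisation. -/
noncomputable def junkVec (hn : 1 ≤ n) (c : Fin 2) : HilbertTensor A B :=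
  ((√2 : ℝ) : ℂ) ^ n • onBob (st.junkOp hn c) st.ψ

end Strategy

/-! ### Uniform bounds for the swapped state and observables. -/

namespace Scenario

variable {n : ℕ}

theorem exists_swap_bound (hn : 1 ≤ n) {g : mirrorAlgebra (state (n := n)) err.{u, v}}
    {ψ' : ∀ i : Scenario.{u, v} n, HilbertTensor i.A i.B}
    (hψ' : ∀ i, onAlice (aliceEval i g) i.st.ψ = ψ' i) (k : Fin n)
    (M : Matrix (Fin 2) (Fin 2) ℂ) (e : Fin 2 → ℂ)
    (h : ∀ s t c d, krausWord (cls 4) (fun k => phaseFlip (cls 4 k) (cls 5 k)) s *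
        branch (cls 0 ⟨0, hn⟩ * phaseFlip (cls 4 ⟨0, hn⟩) (cls 5 ⟨0, hn⟩)) c * mirrorMk state err g *
        (branch (cls 0 ⟨0, hn⟩ * phaseFlip (cls 4 ⟨0, hn⟩) (cls 5 ⟨0, hn⟩)) d *
          krausMirrorWord (cls 4) (fun k => phaseFlip (cls 4 k) (cls 5 k)) t) =
      swapCoeff k M e s t c d • (halfPlusWord (fun k => phaseFlip (cls 4 k) (cls 5 k)) *
        branch (cls 0 ⟨0, hn⟩ * phaseFlip (cls 4 ⟨0, hn⟩) (cls 5 ⟨0, hn⟩)) c)) :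
    ∃ C : ℝ, ∀ i : Scenario.{u, v} n,
      ‖opTensor (i.st.aliceIsometry hn i.mem).toContinuousLinearMap
          (i.st.bobIsometry hn).toContinuousLinearMap (ψ' i) -
        onBob (ContinuousLinearMap.lTensor (i.B ⊗[ℂ] Qubits n) (onQubit k M))
          (bellTensor n (weightedJunk n e (i.st.junkVec hn)))‖ ≤ C * i.err := by
  obtain rfl : (fun i => onAlice (aliceEval i g) i.st.ψ) = ψ' := funext hψ'
  choose C hC using fun s t c d => isSmall_of_relation (h s t c d)
  -- Each component of the output has its own constant; there are finitely many components, with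
  -- index sets depending on n only.
  refine ⟨∑ s, ∑ t, ∑ c, ∑ d, C s t c d, fun i => (norm_swap_sub_le k M e
    (fun c => onBob (i.st.junkOp hn c) i.st.ψ) _ _ _ _ _ _ _).trans ?_⟩
  simp only [Finset.sum_mul]
  exact Finset.sum_le_sum fun s _ => Finset.sum_le_sum fun t _ => Finset.sum_le_sum fun c _ =>
    Finset.sum_le_sum fun d _ => hC s t c d i

theorem exists_swap_state_bound (hn : 1 ≤ n) : ∃ C : ℝ, ∀ i : Scenario.{u, v} n,
    ‖opTensor (i.st.aliceIsometry hn i.mem).toContinuousLinearMap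
        (i.st.bobIsometry hn).toContinuousLinearMap i.st.ψ -
      bellTensor n (weightedJunk n (fun _ => 1) (i.st.junkVec hn))‖ ≤ C * i.err := by
  obtain ⟨C, hC⟩ := exists_swap_bound.{u, v} hn (g := 1) (ψ' := fun i => i.st.ψ)
    (fun i => by rw [map_one, onAlice_one]) ⟨0, hn⟩ 1 (fun _ => 1) fun s t c d => by
      rw [map_one, mul_one]
      exact (pauliRelations_cls hn).swap_coefficient_one ⟨0, hn⟩ s t c d
  exact ⟨C, fun i => (le_of_eq (congrArg (fun z => ‖_ - z‖)
    (onBob_onQubit_one (⟨0, hn⟩ : Fin n) _).symm)).trans (hC i)⟩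

theorem exists_swap_obs_bound (hn : 1 ≤ n) (k : Fin n) (q : Fin 5) :
    ∃ C : ℝ, ∀ i : Scenario.{u, v} n,
      ‖opTensor (i.st.aliceIsometry hn i.mem).toContinuousLinearMap
          (i.st.bobIsometry hn).toContinuousLinearMap (onAlice (i.st.aliceAt i.χ q k) i.st.ψ) -
        onBob (ContinuousLinearMap.lTensor (i.B ⊗[ℂ] Qubits n) (onQubit k (pauli q)))
          (bellTensor n (weightedJunk n (kickbackSign q) (i.st.junkVec hn)))‖ ≤ C * i.err := by
  obtain ⟨g, hg, hcls⟩ := exists_elem_aliceAt.{u, v} k q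
  exact exists_swap_bound.{u, v} hn (g := g)
    (ψ' := fun i => onAlice (i.st.aliceAt i.χ q k) i.st.ψ) (fun i => by rw [hg]) k (pauli q)
    (kickbackSign q) fun s t c d => by
      rw [hcls]
      exact (pauliRelations_cls hn).swap_coefficient k q s t c d

end Scenario

/-! ### From unnormalised to normalised junk. -/

section Reference

variable {A B : Type*} [NormedAddCommGroup A] [InnerProductSpace ℂ A]
  [NormedAddCommGroup B] [InnerProductSpace ℂ B] {n : ℕ}

theorem norm_onBob_bellTensor_sub_le (T : B ⊗[ℂ] Qubits n →L[ℂ] B ⊗[ℂ] Qubits n)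
    (v w : HilbertTensor A B) :
    ‖onBob T (bellTensor n v) - onBob T (bellTensor n w)‖ ≤ ‖T‖ * ‖v - w‖ := by
  rw [← map_sub, ← bellTensor_sub, ← norm_bellTensor (n := n) (v - w)]
  exact norm_onBob_apply_le T _

theorem norm_sub_onBob_bellTensor_le {u : HilbertTensor (A ⊗[ℂ] Qubits n) (B ⊗[ℂ] Qubits n)}
    {T : B ⊗[ℂ] Qubits n →L[ℂ] B ⊗[ℂ] Qubits n} {v w : HilbertTensor A B} {K r s : ℝ}
    (h : ‖u - onBob T (bellTensor n v)‖ ≤ r) (hT : ‖T‖ ≤ K) (hs : ‖w - v‖ ≤ s) :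
    ‖u - onBob T (bellTensor n w)‖ ≤ r + K * s := by
  rw [norm_sub_rev] at hs
  refine (norm_sub_le_norm_sub_add_norm_sub _ (onBob T (bellTensor n v)) _).trans
    (add_le_add h ((norm_onBob_bellTensor_sub_le T v w).trans
      (mul_le_mul hT hs (norm_nonneg _) ((ContinuousLinearMap.opNorm_nonneg T).trans hT))))

theorem norm_sub_bellTensor_le {u : HilbertTensor (A ⊗[ℂ] Qubits n) (B ⊗[ℂ] Qubits n)}
    {v w : HilbertTensor A B} {r s : ℝ} (h : ‖u - bellTensor n v‖ ≤ r) (hs : ‖w - v‖ ≤ s) :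
    ‖u - bellTensor n w‖ ≤ r + s := by
  rw [norm_sub_rev, ← norm_bellTensor (n := n), bellTensor_sub] at hs
  exact (norm_sub_le_norm_sub_add_norm_sub _ (bellTensor n v) _).trans (add_le_add h hs)

theorem abs_one_sub_norm_le {u : HilbertTensor (A ⊗[ℂ] Qubits n) (B ⊗[ℂ] Qubits n)}
    {v : HilbertTensor A B} {r : ℝ} (hu : ‖u‖ = 1) (h : ‖u - bellTensor n v‖ ≤ r) :
    |1 - ‖v‖| ≤ r := by
  rw [← hu, ← norm_bellTensor (n := n) v]
  exact (abs_norm_sub_norm_le _ _).trans h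

theorem norm_kickbackSign (q : Fin 5) (c : Fin 2) : ‖kickbackSign q c‖ = 1 := by
  unfold kickbackSign bitSign
  split_ifs <;> simp

variable [CompleteSpace A] [CompleteSpace B] {S : Set (Question n)} (st : Strategy n S A B)
  {χ : Question n} (hn : 1 ≤ n) (hχ : χ ∈ S)

namespace Strategy

/-- The local isometries map the state and the vectors of Alice's observables to the reference
vectors with the junk state given by `ξ₀` and `ξ₁`, within the distance `r`. -/
def SwapBounds (ξ₀ ξ₁ : HilbertTensor A B) (r : ℝ) : Prop :=
  ‖opTensor (st.aliceIsometry hn hχ).toContinuousLinearMap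
      (st.bobIsometry hn).toContinuousLinearMap st.ψ - bellTensor n (junk n ξ₀ ξ₁)‖ ≤ r ∧
    ∀ k q, ‖opTensor (st.aliceIsometry hn hχ).toContinuousLinearMap
        (st.bobIsometry hn).toContinuousLinearMap
        (onAlice (st.aliceObsAt k q (removeAt k χ)) st.ψ) -
      onBob (ContinuousLinearMap.lTensor (B ⊗[ℂ] Qubits n) (onQubit k (pauli q)))
        (bellTensor n (if q = 2 then
          onBob (ContinuousLinearMap.lTensor B (kickbackZ n)) (junk n ξ₀ ξ₁)
          else junk n ξ₀ ξ₁))‖ ≤ r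

theorem norm_swap (v : HilbertTensor A B) :
    ‖opTensor (H' := LocalOut A n) (K' := LocalOut B n)
      (st.aliceIsometry hn hχ).toContinuousLinearMap
      (st.bobIsometry hn).toContinuousLinearMap v‖ = ‖v‖ :=
  norm_opTensor_isometry (H' := LocalOut A n) (K' := LocalOut B n) _ _ v

theorem swapBounds_of_le {r₀ r : ℝ} {r₁ : Fin n → Fin 5 → ℝ}
    (h₀ : ‖opTensor (st.aliceIsometry hn hχ).toContinuousLinearMap
        (st.bobIsometry hn).toContinuousLinearMap st.ψ -
      bellTensor n (weightedJunk n (fun _ => 1) (st.junkVec hn))‖ ≤ r₀)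
    (h₁ : ∀ k q, ‖opTensor (st.aliceIsometry hn hχ).toContinuousLinearMap
          (st.bobIsometry hn).toContinuousLinearMap (onAlice (st.aliceAt χ q k) st.ψ) -
        onBob (ContinuousLinearMap.lTensor (B ⊗[ℂ] Qubits n) (onQubit k (pauli q)))
          (bellTensor n (weightedJunk n (kickbackSign q) (st.junkVec hn)))‖ ≤ r₁ k q)
    {ξ : Fin 2 → HilbertTensor A B}
    (hξ : ∀ e : Fin 2 → ℂ, (∀ c, ‖e c‖ = 1) →
      ‖weightedJunk n e ξ - weightedJunk n e (st.junkVec hn)‖ ≤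
        |1 - ‖weightedJunk n (fun _ => 1) (st.junkVec hn)‖|)
    (hr₀ : r₀ + r₀ ≤ r) (hr₁ : ∀ k q, r₁ k q + ‖onQubit k (pauli q)‖ * r₀ ≤ r) :
    st.SwapBounds hn hχ (ξ 0) (ξ 1) r := by
  -- The isometries send the unit vector ψ to within `r₀` of the Bell pairs with the unnormalised
  -- junk, so the norm of the junk is within `r₀` of 1.
  have hN : |1 - ‖weightedJunk n (fun _ => 1) (st.junkVec hn)‖| ≤ r₀ :=
    abs_one_sub_norm_le (A := A ⊗[ℂ] Qubits n) (B := B ⊗[ℂ] Qubits n)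
      ((st.norm_swap hn hχ st.ψ).trans st.norm_ψ) h₀
  have hξ₀ : ‖junk n (ξ 0) (ξ 1) - weightedJunk n (fun _ => 1) (st.junkVec hn)‖ ≤ r₀ := by
    rw [← weightedJunk_one]
    exact (hξ _ fun _ => norm_one).trans hN
  have hξ₁ : ∀ q : Fin 5, ‖(if q = 2 then
        onBob (ContinuousLinearMap.lTensor B (kickbackZ n)) (junk n (ξ 0) (ξ 1))
      else junk n (ξ 0) (ξ 1)) - weightedJunk n (kickbackSign q) (st.junkVec hn)‖ ≤ r₀ :=
    fun q => by
      rw [← weightedJunk_kickbackSign hn]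
      exact (hξ _ (norm_kickbackSign q)).trans hN
  exact ⟨(norm_sub_bellTensor_le (A := A ⊗[ℂ] Qubits n) (B := B ⊗[ℂ] Qubits n)
      h₀ hξ₀).trans hr₀, fun k q =>
    (norm_sub_onBob_bellTensor_le (A := A ⊗[ℂ] Qubits n) (B := B ⊗[ℂ] Qubits n)
      (h₁ k q) (ContinuousLinearMap.norm_lTensor_le _ _) (hξ₁ q)).trans (hr₁ k q)⟩

end Strategy

end Reference

theorem Scenario.exists_swapBounds {n : ℕ} (hn : 1 ≤ n) :
    ∃ C : ℝ≥0, ∀ (i : Scenario.{u, v} n) (ξ : Fin 2 → HilbertTensor i.A i.B),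
      (∀ e : Fin 2 → ℂ, (∀ c, ‖e c‖ = 1) →
        ‖weightedJunk n e ξ - weightedJunk n e (i.st.junkVec hn)‖ ≤
          |1 - ‖weightedJunk n (fun _ => 1) (i.st.junkVec hn)‖|) →
      i.st.SwapBounds hn i.mem (ξ 0) (ξ 1) (C * NNReal.sqrt i.ε : ℝ≥0) := by
  obtain ⟨C₀, h₀⟩ := exists_swap_state_bound.{u, v} hn
  choose C₁ h₁ using exists_swap_obs_bound.{u, v} hn
  -- A common bound over the finitely many positions and labels.
  obtain ⟨M, hM⟩ := Finite.exists_le fun p : Fin n × Fin 5 =>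
    C₁ p.1 p.2 + ‖onQubit p.1 (pauli p.2)‖ * C₀
  refine ⟨Real.toNNReal (max (C₀ + C₀) M), fun i ξ hξ => ?_⟩
  have herr : 0 ≤ i.err := Real.sqrt_nonneg _
  have hle : max (C₀ + C₀) M * i.err ≤
      (Real.toNNReal (max (C₀ + C₀) M) * NNReal.sqrt i.ε : ℝ≥0) := by
    rw [NNReal.coe_mul, Real.coe_sqrt]
    exact mul_le_mul_of_nonneg_right (Real.le_coe_toNNReal _) herr
  refine i.st.swapBounds_of_le hn i.mem (h₀ i) (fun k q => h₁ k q i) hξ ?_ fun k q => ?_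
  · rw [← add_mul]
    exact (mul_le_mul_of_nonneg_right (le_max_left _ _) herr).trans hle
  · rw [← mul_assoc, ← add_mul]
    exact (mul_le_mul_of_nonneg_right ((hM (k, q)).trans (le_max_right _ _)) herr).trans hle

end SelfTest

/-! ### The self-testing theorem. -/

theorem mainTheorem2 :
    ∃ δ : ℝ≥0 → ℕ → ℝ≥0, (∀ n, 1 ≤ n → δ 0 n = 0) ∧
      ∀ (n : ℕ), 1 ≤ n → ∀ (S : Set (SelfTest.Question n)) (A B : Type*)
        [NormedAddCommGroup A] [InnerProductSpace ℂ A] [CompleteSpace A]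
        [NormedAddCommGroup B] [InnerProductSpace ℂ B] [CompleteSpace B]
        (st : SelfTest.Strategy n S A B) (ε : ℝ≥0), st.AttainsRequests ε →
        ∃ (ξ₀ ξ₁ : SelfTest.HilbertTensor A B)
          (VA : S → A →ₗᵢ[ℂ] SelfTest.LocalOut A n) (VB : B →ₗᵢ[ℂ] SelfTest.LocalOut B n),
          ‖ξ₀‖ ^ 2 + ‖ξ₁‖ ^ 2 = 1 ∧
          ∀ (χ : S) (k : Fin n) (q : Fin 5),
            let V := SelfTest.opTensor (VA χ).toContinuousLinearMap VB.toContinuousLinearMap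
            let ξ := SelfTest.junk n ξ₀ ξ₁
            ‖V st.ψ - SelfTest.bellTensor n ξ‖ ≤ δ ε n ∧
            ‖V (SelfTest.onAlice (st.aliceObsAt k q (SelfTest.removeAt k χ.1)) st.ψ) -
              SelfTest.onBob (ContinuousLinearMap.lTensor (B ⊗[ℂ] SelfTest.Qubits n)
                  (SelfTest.onQubit k (SelfTest.pauli q)))
                (SelfTest.bellTensor n
                  (if q = 2 then
                    SelfTest.onBob (ContinuousLinearMap.lTensor B (SelfTest.kickbackZ n)) ξ
                  else ξ))‖ ≤ δ ε n := by
  choose! C hC using fun (n : ℕ) (hn : 1 ≤ n) => SelfTest.Scenario.exists_swapBounds hn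
  refine ⟨fun ε n => C n * NNReal.sqrt ε, fun n _ => by simp only [NNReal.sqrt_zero, mul_zero], ?_⟩
  intro n hn S A B _ _ _ _ _ _ st ε hst
  -- `junkVec` involves only the state and Bob's operators, so ξ is fixed before χ is chosen.
  obtain ⟨ξ, hξ, hle⟩ := SelfTest.exists_unit_weightedJunk hn st.norm_ψ (st.junkVec hn)
  refine ⟨ξ 0, ξ 1, fun χ => st.aliceIsometry hn χ.2, st.bobIsometry hn, hξ, fun χ k q => ?_⟩
  have h := hC n hn ⟨S, A, B, st, ε, hst, χ.1, χ.2⟩ ξ hle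
  exact ⟨h.1, h.2 k q⟩
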